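/- Let $T=\{t_1,\dots,t_n\}\subset\mathbb{Q}[z_1,\dots,z_n]$ be a radical zero-dimensional triangular set: $t_i$ has main variable $z_i$, is monic in $z_i$, satisfies $\deg_{z_j}(t_i)<\deg_{z_j}(t_j)$ for $j<i$, and $\langle T\rangle$ is a radical ideal. Put $R=\mathbb{Q}[z_1,\dots,z_n]/\langle T\rangle$ and let $a,b\in R[x]$. Consider the following algorithm ModularC-GCD$(a,b)$ modulo $T$, in which elements of $R$ and of its analogues are represented by polynomials reduced modulo the triangular set and $T_{k}=\{t_1,\dots,t_k\}$. **Monic Euclidean algorithm** over $F[z_1,\dots,z_k]/\langle T_k\rangle$, $F$ a field. It divides each nonzero remainder by its leading coefficient before the next division, and returns the last nonzero remainder made monic (and $0$ for the pair $0,0$). An element $u\ne0$ of $F[z_1,\dots,z_k]/\langle T_k\rangle$, $k\ge1$, is inverted by running the extended version of this algorithm on $t_k$ and $u$ modulo $T_{k-1}$; if the resulting monic gcd $g$ is not $1$, the zero-divisor $g$ is reported and the computation stops. Zero-divisors reported by recursive inversions are passed on. **Main loop**, started with $d:=\deg b$ ($d:=\deg a$ if $b=0$), $M:=1$, $G:=0$.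 (1) Pick a prime $p$ that this call has not picked before and that is not bad, i.e. divides no denominator in $T,a,b$ and does not make the leading coefficient of a nonzero one of $a,b$ vanish. (2) For $i=1,\dots,n$ compute $\gcd(t_i,\partial t_i/\partial z_i)$ modulo $(T_{i-1},p)$ by the monic Euclidean algorithm; if one of them is not $1$, go to (1). (3) Compute $g=\gcd(a,b)$ modulo $(T,p)$ by the monic Euclidean algorithm. If $\deg g>d$, go to (1). If $\deg g=d$, combine $g$ with $G$ by Chinese remaindering and put $M:=Mp$; if $\deg g<d$, put $G:=g$, $M:=p$, $d:=\deg g$. (4) Let $h$ be the rational reconstruction of $G$ modulo $M$ (each coefficient is the fraction $r/s$ in lowest terms congruent to it with $2r^2,2s^2<M$, $\gcd(s,M)=1$). If it exists and $h\mid a$ and $h\mid b$ in $R[x]$, return $h$; otherwise go to (1). **Zero-divisors.** If a zero-divisor $u_0$ with main variable $z_k$ is encountered modulo $p$ in (2) or (3), let $v_0$ be the quotient of $t_k$ by $u_0$ modulo $(T_{k-1},p)$, set the global bound $B$ to $2^{60}$ the first time and to $B^2$ afterwards, and try to lift $t_k\equiv u_0v_0$ by Hensel lifting. For this, solve $su_0+tv_0=1$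 modulo $(T_{k-1},p)$ by the monic extended Euclidean algorithm; if this encounters a zero-divisor $w$, treat $w$ in the same way instead of $u_0$. Then, for $i=1,2,\dots$, compute the lift $u$ of $u_0$ modulo $p^i$ and try rational reconstruction of $u$; if its result divides $t_k$ modulo $T_{k-1}$ over $\mathbb{Q}$, the lifting has succeeded; otherwise, if $p^i>2B$, it has failed. After a failure go to (1). After a success, with the factorization $t_k=wv$ modulo $T_{k-1}$ over $\mathbb{Q}$, return the results of the algorithm run on $a,b$ modulo $T^{(w)}$ and modulo $T^{(v)}$, in which $t_k$ is replaced by $w$ and by $v$, respectively, and $t_i$, $i>k$, is reduced accordingly. Then, for every choice of the primes, only finitely many zero-divisors are encountered (counted over the whole run, including all recursive calls), and the algorithm terminates: every run reaches its end after finitely many steps, and a run that has not ended can always be continued. -/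

import Mathlib

namespace ModularCGcd

noncomputable section

open scoped Classical
open Polynomial

/-! ### Triangular sets -/

/-- `T = {t₀, …, t_{n-1}}` is a (zero-dimensional, reduced) triangular set in `k[z₀, …, z_{n-1}]`:
the main variable of `tᵢ` is `zᵢ`, `tᵢ` is monic with respect to `zᵢ`, and
`deg_{zⱼ}(tᵢ) < mdeg(tⱼ)` for `j < i`. -/
structure IsTriangularSet {k : Type} [Field k] {n : ℕ} (T : Fin n → MvPolynomial (Fin n) k) :
    Prop where
  mdeg_pos : ∀ i, 0 < (T i).degreeOf i
  main_var : ∀ i j, i < j → (T i).degreeOf j = 0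
  monic : ∀ i, (T i - MvPolynomial.X i ^ (T i).degreeOf i).degreeOf i < (T i).degreeOf i
  reduced : ∀ i j, j < i → (T i).degreeOf j < (T j).degreeOf j

/-! ### Recursive representation of polynomials

The algorithms compute with the recursive representation `F[z₀][z₁]…[z_{k-1}]` of polynomials.
Elements of `R_k = F[z₀, …, z_{k-1}] / ⟨t₀, …, t_{k-1}⟩` are stored as reduced polynomials. -/

/-- The ring `F[z₀][z₁]…[z_{k-1}]`, bundled with its ring structure. -/
def iterPolyAux (F : Type) [CommRing F] : ℕ → (R : Type) × CommRing R
  | 0 => ⟨F, inferInstance⟩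
  | k + 1 =>
    letI := (iterPolyAux F k).2
    ⟨Polynomial (iterPolyAux F k).1, inferInstance⟩

/-- The ring `F[z₀][z₁]…[z_{k-1}]`; by definition `IterPoly F (k + 1) = (IterPoly F k)[X]`. -/
def IterPoly (F : Type) [CommRing F] (k : ℕ) : Type := (iterPolyAux F k).1

instance instCommRingIterPoly (F : Type) [CommRing F] (k : ℕ) : CommRing (IterPoly F k) :=
  (iterPolyAux F k).2

/-- Apply a function that preserves `0` to every coefficient of a polynomial. -/
def mapCoeffs {R S : Type} [Semiring R] [Semiring S] (f : R → S) (a : R[X]) : S[X] :=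
  a.sum fun i c => monomial i (f c)

/-- Apply a function that preserves `0` to every base coefficient of a recursive polynomial. -/
def mapBase {A B : Type} [CommRing A] [CommRing B] (f : A → B) :
    (k : ℕ) → IterPoly A k → IterPoly B k
  | 0 => f
  | k + 1 => fun a => mapCoeffs (R := IterPoly A k) (S := IterPoly B k) (mapBase f k) a

/-- The same for a polynomial in one more variable. -/
def mapPoly {A B : Type} [CommRing A] [CommRing B] (f : A → B) (k : ℕ)
    (a : (IterPoly A k)[X]) : (IterPoly B k)[X] :=
  mapCoeffs (mapBase f k) a

/-- Every base coefficient of a recursive polynomial satisfies `Q`. -/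
def AllBase {A : Type} [CommRing A] (Q : A → Prop) : (k : ℕ) → IterPoly A k → Prop
  | 0 => Q
  | k + 1 => fun (a : (IterPoly A k)[X]) => ∀ i, AllBase Q k (a.coeff i)

/-- The same for a polynomial in one more variable. -/
def AllPoly {A : Type} [CommRing A] (Q : A → Prop) (k : ℕ) (a : (IterPoly A k)[X]) : Prop :=
  ∀ i, AllBase Q k (a.coeff i)

/-- Constants of `F[z₀]…[z_{k-1}]`. -/
def constHom (F : Type) [CommRing F] : (k : ℕ) → F →+* IterPoly F k
  | 0 => RingHom.id F
  | k + 1 => (C : IterPoly F k →+* (IterPoly F k)[X]).comp (constHom F k)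

/-- The variable `zⱼ` of `F[z₀]…[z_{k-1}]` (and `0` if `k ≤ j`). -/
def gen (F : Type) [CommRing F] : (k : ℕ) → ℕ → IterPoly F k
  | 0, _ => (0 : F)
  | k + 1, j => if j = k then (X : (IterPoly F k)[X]) else (C (gen F k j) : (IterPoly F k)[X])

/-- Recursive representation of a polynomial in which only `z₀, …, z_{k-1}` occur. -/
def toIter (F : Type) [CommRing F] (n k : ℕ) : MvPolynomial (Fin n) F →+* IterPoly F k :=
  MvPolynomial.eval₂Hom (constHom F k) (fun j => gen F k j)

/-- Polynomials `t₀, t₁, …` with `tᵢ` in `F[z₀]…[z_{i-1}][zᵢ]`; a triangular set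
`{t₀, …, t_{n-1}}` is stored in the entries of index `i < n`, the others are never used. -/
abbrev TriSet (F : Type) [CommRing F] : Type := (i : ℕ) → (IterPoly F i)[X]

/-- The normal form of an element of `F[z₀]…[z_{k-1}]` modulo `⟨t₀, …, t_{k-1}⟩`. -/
def nf {F : Type} [CommRing F] (T : TriSet F) : (k : ℕ) → IterPoly F k → IterPoly F k
  | 0 => id
  | k + 1 => fun (a : (IterPoly F k)[X]) =>
      mapCoeffs (R := IterPoly F k) (S := IterPoly F k) (nf T k) (a %ₘ T k)

/-- Reduce the coefficients of a polynomial over `F[z₀]…[z_{k-1}]` modulo `⟨t₀, …, t_{k-1}⟩`.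
Reduced polynomials represent the elements of `R_k[X]`. -/
def nfPoly {F : Type} [CommRing F] (T : TriSet F) (k : ℕ) (a : (IterPoly F k)[X]) :
    (IterPoly F k)[X] :=
  mapCoeffs (nf T k) a

/-- Divisibility `h ∣ a` in `R_k[X]`. -/
def Divides {F : Type} [CommRing F] (T : TriSet F) (k : ℕ) (h a : (IterPoly F k)[X]) : Prop :=
  ∃ q, nfPoly T k (a - h * q) = 0

/-! ### The monic Euclidean algorithm modulo a triangular set -/

/-- The message `["ZERODIVISOR", u]`; here `u` is a monic polynomial in `z_k` (`k = level`) over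
`R_k`, a zero-divisor of `R_k[z_k] / ⟨t_k⟩`. -/
structure ZeroDiv (F : Type) [CommRing F] where
  level : ℕ
  poly : (IterPoly F level)[X]

/-- The result `g = s * a + t * b` of an extended Euclidean algorithm. -/
structure Bezout (F : Type) [CommRing F] (k : ℕ) where
  g : (IterPoly F k)[X]
  s : (IterPoly F k)[X]
  t : (IterPoly F k)[X]

/-- The loop of the monic (extended) Euclidean algorithm over `R_k`; `inv` inverts elements of
`R_k` or reports a zero-divisor. The first argument bounds the number of turns. -/
def euclidLoop {F : Type} [CommRing F] (T : TriSet F) (k : ℕ)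
    (inv : IterPoly F k → Except (ZeroDiv F) (IterPoly F k)) :
    ℕ → (r₀ s₀ t₀ r₁ s₁ t₁ : (IterPoly F k)[X]) → Except (ZeroDiv F) (Bezout F k)
  | 0, r₀, s₀, t₀, _, _, _ => .ok ⟨r₀, s₀, t₀⟩
  | m + 1, r₀, s₀, t₀, r₁, s₁, t₁ =>
    if r₁ = 0 then .ok ⟨r₀, s₀, t₀⟩
    else
      match inv r₁.leadingCoeff with
      | .error z => .error z
      | .ok c =>
        let r := nfPoly T k (C c * r₁)
        let s := nfPoly T k (C c * s₁)
        let t := nfPoly T k (C c * t₁)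
        let q := nfPoly T k (r₀ /ₘ r)
        euclidLoop T k inv m r s t
          (nfPoly T k (r₀ %ₘ r)) (nfPoly T k (s₀ - q * s)) (nfPoly T k (t₀ - q * t))

/-- The monic (extended) Euclidean algorithm for `a, b ∈ R_k[X]`. The degree of the remainders
drops in every turn, so that `natDegree b + 1` turns suffice. -/
def monicEuclid {F : Type} [CommRing F] (T : TriSet F) (k : ℕ)
    (inv : IterPoly F k → Except (ZeroDiv F) (IterPoly F k))
    (a b : (IterPoly F k)[X]) : Except (ZeroDiv F) (Bezout F k) :=
  if b = 0 then
    if a = 0 then .ok ⟨0, 0, 0⟩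
    else
      match inv a.leadingCoeff with
      | .error z => .error z
      | .ok c => .ok ⟨nfPoly T k (C c * a), C c, 0⟩
  else euclidLoop T k inv (b.natDegree + 1) a 1 0 b 0 1

/-- Inversion of a nonzero element `u` of `R_k`, `k ≥ 1`, by the extended Euclidean algorithm
for `t_{k-1}` and `u` over `R_{k-1}`. If the monic gcd `g` is not `1`, then `g` is reported
as a zero-divisor; zero-divisors met on the way are passed on. -/
def inverse {F : Type} [Field F] (T : TriSet F) :
    (k : ℕ) → IterPoly F k → Except (ZeroDiv F) (IterPoly F k)
  | 0 => fun (u : F) => .ok (u⁻¹ : F)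
  | k + 1 => fun (u : (IterPoly F k)[X]) =>
    match monicEuclid T k (inverse T k) (T k) u with
    | .error z => .error z
    | .ok e => if e.g = 1 then .ok e.t else .error ⟨k, e.g⟩

/-- Extended version of MonicEuclideanC-GCD for `a, b ∈ R_k[X]`. -/
def monicExtGcd {F : Type} [Field F] (T : TriSet F) (k : ℕ) (a b : (IterPoly F k)[X]) :
    Except (ZeroDiv F) (Bezout F k) :=
  monicEuclid T k (inverse T k) a b

/-- IsRadicalPrime, run on the triangular set `{t₀, …, t_{n-1}}` modulo `p`. -/
def isRadical {F : Type} [Field F] (T : TriSet F) : ℕ → Except (ZeroDiv F) Bool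
  | 0 => .ok true
  | i + 1 =>
    match isRadical T i with
    | .error z => .error z
    | .ok false => .ok false
    | .ok true =>
      match monicExtGcd T i (T i) (derivative (T i)) with
      | .error z => .error z
      | .ok e => .ok (decide (e.g = 1))

/-! ### Reduction modulo a prime, lifting, rational reconstruction -/

/-- Reduction modulo `p` of rational numbers whose denominator is prime to `p`. -/
def redRat (p : ℕ) [Fact p.Prime] (q : ℚ) : ZMod p := (q.num : ZMod p) / (q.den : ZMod p)

/-- `T mod p`. -/
def redTri (p : ℕ) [Fact p.Prime] (T : TriSet ℚ) : TriSet (ZMod p) :=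
  fun i => mapPoly (redRat p) i (T i)

/-- The lift of a residue class modulo `p` to an integer in `[0, p)`. -/
def liftInt (p : ℕ) (x : ZMod p) : ℤ := (x.val : ℤ)

/-- Rational reconstruction of `u mod M`: the only fraction congruent to `u` modulo `M` whose
numerator and denominator are less than `√(M/2)` in absolute value, or FAIL (`none`). -/
def ratRecon (M : ℕ) (u : ℤ) : Option ℚ :=
  if h : ∃ q : ℚ, 2 * q.num ^ 2 < (M : ℤ) ∧ 2 * q.den ^ 2 < M ∧ q.den.Coprime M ∧
      (M : ℤ) ∣ q.num - (q.den : ℤ) * u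
  then some h.choose else none

/-- Rational reconstruction of all coefficients; FAIL (`none`) if it fails for one of them. -/
def ratReconPoly (M k : ℕ) (u : (IterPoly ℤ k)[X]) : Option ((IterPoly ℚ k)[X]) :=
  if AllPoly (fun c => (ratRecon M c).isSome = true) k u
  then some (mapPoly (fun c => (ratRecon M c).getD 0) k u) else none

/-! ### Hensel lifting -/

/-- The loop of HenselLift over `R_k`, at exponent `i`, for `f ≡ u * v` modulo `p ^ i` and
`s * a₀ + t * b₀ = 1` modulo `p`. FAIL is `none`. The first numerical argument bounds the number of
turns. -/
def henselLoop (T : TriSet ℚ) (k p : ℕ) [Fact p.Prime] (f : (IterPoly ℚ k)[X])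
    (a₀ b₀ s t : (IterPoly (ZMod p) k)[X]) (B : ℕ) :
    ℕ → ℕ → (u v : (IterPoly ℤ k)[X]) → Option ((IterPoly ℚ k)[X] × (IterPoly ℚ k)[X])
  | 0, _, _, _ => none
  | m + 1, i, u, v =>
    let next : Option ((IterPoly ℚ k)[X] × (IterPoly ℚ k)[X]) :=
      if 2 * B < p ^ i then none
      else
        let e := nfPoly T k (f - mapPoly (fun x : ℤ => (x : ℚ)) k u *
          mapPoly (fun x : ℤ => (x : ℚ)) k v)
        let c := mapPoly (fun x : ℚ => redRat p (x / (p : ℚ) ^ i)) k e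
        let q := nfPoly (redTri p T) k ((c * s) /ₘ b₀)
        let σ := nfPoly (redTri p T) k ((c * s) %ₘ b₀)
        let τ := nfPoly (redTri p T) k (c * t + q * a₀)
        henselLoop T k p f a₀ b₀ s t B m (i + 1)
          (u + ((p ^ i : ℕ) : (IterPoly ℤ k)[X]) * mapPoly (liftInt p) k τ)
          (v + ((p ^ i : ℕ) : (IterPoly ℤ k)[X]) * mapPoly (liftInt p) k σ)
    match ratReconPoly (p ^ i) k u with
    | none => next
    | some a => if Divides T k a f then some (a, nfPoly T k (f /ₘ a)) else next

/-- The possible answers of HenselLift. -/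
inductive HenselResult (p k : ℕ) where
  | zeroDivisor (w : ZeroDiv (ZMod p))
  | fail
  | factors (u v : (IterPoly ℚ k)[X])

/-- HenselLift over `R_k` for `f ≡ a₀ * b₀` modulo `p` with the bound `B`. Since `i < p ^ i`,
the loop stops after at most `2 * B + 1` turns. The algorithm presupposes `gcd(a₀, b₀) = 1`. -/
def henselLift (T : TriSet ℚ) (k p : ℕ) [Fact p.Prime] (f : (IterPoly ℚ k)[X])
    (a₀ b₀ : (IterPoly (ZMod p) k)[X]) (B : ℕ) : HenselResult p k :=
  match monicExtGcd (redTri p T) k a₀ b₀ with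
  | .error w => .zeroDivisor w
  | .ok e =>
    if e.g = 1 then
      match henselLoop T k p f a₀ b₀ e.s e.t B (2 * B + 1) 1
        (mapPoly (liftInt p) k a₀) (mapPoly (liftInt p) k b₀) with
      | none => .fail
      | some uv => .factors uv.1 uv.2
    else .fail

/-- The update of the global bound: `2 ^ 60` if it is unassigned, `B ^ 2` otherwise. -/
def nextBound : Option ℕ → ℕ
  | none => 2 ^ 60
  | some B => B ^ 2

/-! ### ModularC-GCD -/

/-- The polynomials `t₀, …, t_{m-1}` after `t_k` has been replaced by `w` and the `tᵢ`, `i > k`,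
have been reduced accordingly. -/
def replaceAt {F : Type} [CommRing F] (T : TriSet F) (k : ℕ) (w : (IterPoly F k)[X]) :
    ℕ → TriSet F
  | 0 => Function.update T k w
  | m + 1 =>
    let S := replaceAt T k w m
    if k < m then Function.update S m (nfPoly S m (S m)) else S

/-- The input of a call of ModularC-GCD: a triangular set `{t₀, …, t_{n-1}}` over `ℚ` and two
polynomials over `R = R_n`. -/
structure Input (n : ℕ) where
  T : TriSet ℚ
  a : (IterPoly ℚ n)[X]
  b : (IterPoly ℚ n)[X]

/-- The input with `t_k` replaced by `w`. -/
def Input.split {n : ℕ} (I : Input n) (k : ℕ) (w : (IterPoly ℚ k)[X]) : Input n :=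
  let S := replaceAt I.T k w n
  ⟨S, nfPoly S n I.a, nfPoly S n I.b⟩

/-- `p` is a bad prime for the input: it divides a denominator in `T`, `a` or `b`, or makes the
leading coefficient of `a` or of `b` vanish (a zero polynomial has no leading coefficient). -/
def Input.IsBad {n : ℕ} (I : Input n) (p : ℕ) [Fact p.Prime] : Prop :=
  (∃ i < n, ¬ AllPoly (fun q : ℚ => ¬ p ∣ q.den) i (I.T i)) ∨
  ¬ AllPoly (fun q : ℚ => ¬ p ∣ q.den) n I.a ∨
  ¬ AllPoly (fun q : ℚ => ¬ p ∣ q.den) n I.b ∨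
  (I.a ≠ 0 ∧ mapBase (redRat p) n I.a.leadingCoeff = 0) ∨
  (I.b ≠ 0 ∧ mapBase (redRat p) n I.b.leadingCoeff = 0)

/-- The local variables of a call of ModularC-GCD: its input, the primes picked so far, `dg`,
and the combined gcd `G` modulo `M`. -/
structure Call (n : ℕ) where
  inp : Input n
  used : Finset ℕ
  dg : WithBot ℕ
  G : (IterPoly ℤ n)[X]
  M : ℕ

/-- The start of a call: `dg := deg(b)`, `M := 1`, no prime picked, nothing combined. If `b = 0`,
which can happen in a component even if the original `b` is nonzero, then
`gcd(a, b) = a` and `dg := deg(a)`. -/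
def Call.start {n : ℕ} (I : Input n) : Call n :=
  ⟨I, ∅, if I.b = 0 then I.a.degree else I.b.degree, 0, 1⟩

/-- A state of the computation. `todo` holds the calls that are still to be made, `out` the
components returned so far, and `B` the global bound of the Hensel lifting.
* `mainLoop`: the current call is at the start of its main loop;
* `zeroDivisor`: a zero-divisor `w` modulo `p` has been encountered, and
  HandleZeroDivisorHensel(`w`) is about to be run;
* `done`: the computation has ended. -/
inductive State (n : ℕ) where
  | mainLoop (c : Call n) (todo : List (Input n))
      (out : List (TriSet ℚ × (IterPoly ℚ n)[X])) (B : Option ℕ)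
  | zeroDivisor (p : ℕ) (w : ZeroDiv (ZMod p)) (c : Call n) (todo : List (Input n))
      (out : List (TriSet ℚ × (IterPoly ℚ n)[X])) (B : Option ℕ)
  | done (out : List (TriSet ℚ × (IterPoly ℚ n)[X]))

/-- A zero-divisor has just been encountered. -/
def State.IsZeroDivisor {n : ℕ} : State n → Prop
  | .zeroDivisor .. => True
  | _ => False

/-- The computation has ended. -/
def State.IsDone {n : ℕ} : State n → Prop
  | .done _ => True
  | _ => False

/-- Start the next call, if there is one. -/
def nextCall {n : ℕ} (todo : List (Input n)) (out : List (TriSet ℚ × (IterPoly ℚ n)[X]))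
    (B : Option ℕ) : State n :=
  match todo with
  | [] => .done out
  | I :: rest => .mainLoop (Call.start I) rest out B

/-- Chinese remaindering of `G` modulo `M` with `g` modulo `p`. -/
def crt {n : ℕ} (M p : ℕ) [Fact p.Prime] (G : (IterPoly ℤ n)[X])
    (g : (IterPoly (ZMod p) n)[X]) : (IterPoly ℤ n)[X] :=
  G + ((M : ℕ) : (IterPoly ℤ n)[X]) *
    mapPoly (fun x : ZMod p => liftInt p ((M : ZMod p)⁻¹ * x)) n
      (g - mapPoly (fun x : ℤ => (x : ZMod p)) n G)

/-- The part of the main loop after `G` has been updated: rational reconstruction and trial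
division. -/
def finishTurn {n : ℕ} (c : Call n) (todo : List (Input n))
    (out : List (TriSet ℚ × (IterPoly ℚ n)[X])) (B : Option ℕ) : State n :=
  match ratReconPoly c.M n c.G with
  | none => .mainLoop c todo out B
  | some h =>
    if Divides c.inp.T n h c.inp.a ∧ Divides c.inp.T n h c.inp.b
    then nextCall todo (out ++ [(c.inp.T, h)]) B
    else .mainLoop c todo out B

/-- One turn of the main loop with the prime `p`. -/
def mainTurn {n : ℕ} (p : ℕ) [Fact p.Prime] (c₀ : Call n) (todo : List (Input n))
    (out : List (TriSet ℚ × (IterPoly ℚ n)[X])) (B : Option ℕ) : State n :=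
  let c : Call n := { c₀ with used := insert p c₀.used }
  let Tp := redTri p c.inp.T
  match isRadical Tp n with
  | .error w => .zeroDivisor p w c todo out B
  | .ok false => .mainLoop c todo out B
  | .ok true =>
    match monicExtGcd Tp n (mapPoly (redRat p) n c.inp.a) (mapPoly (redRat p) n c.inp.b) with
    | .error w => .zeroDivisor p w c todo out B
    | .ok e =>
      if e.g.degree = c.dg then
        finishTurn { c with G := crt c.M p c.G e.g, M := c.M * p } todo out B
      else if c.dg < e.g.degree then .mainLoop c todo out B
      else
        finishTurn { c with dg := e.g.degree, G := mapPoly (liftInt p) n e.g, M := p }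
          todo out B

/-- HandleZeroDivisorHensel(`w`), up to a recursive call, together with what ModularC-GCD does
with its answer. The zero-divisor `w` is monic, so that the quotient of `t_k` by `w` meets no
zero-divisor. -/
def handleZeroDivisor {n : ℕ} (p : ℕ) [Fact p.Prime] (w : ZeroDiv (ZMod p)) (c : Call n)
    (todo : List (Input n)) (out : List (TriSet ℚ × (IterPoly ℚ n)[X])) (B : Option ℕ) : State n :=
  let T := c.inp.T
  let k := w.level
  let v₀ := nfPoly (redTri p T) k (redTri p T k /ₘ w.poly)
  let B' := nextBound B
  match henselLift T k p (T k) w.poly v₀ B' with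
  | .zeroDivisor w' => .zeroDivisor p w' c todo out (some B')
  | .fail => .mainLoop c todo out (some B')
  | .factors u v =>
    .mainLoop (Call.start (c.inp.split k u)) (c.inp.split k v :: todo) out (some B')

/-- A step of the computation. At the start of its main loop a call may pick any prime that it
has not picked before and that is not bad. -/
inductive Step {n : ℕ} : State n → State n → Prop
  | pickPrime (p : ℕ) [Fact p.Prime] (c : Call n) (todo : List (Input n))
      (out : List (TriSet ℚ × (IterPoly ℚ n)[X])) (B : Option ℕ)
      (hbad : ¬ c.inp.IsBad p) (hnew : p ∉ c.used) :
      Step (.mainLoop c todo out B) (mainTurn p c todo out B)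
  | handle (p : ℕ) [Fact p.Prime] (w : ZeroDiv (ZMod p)) (c : Call n) (todo : List (Input n))
      (out : List (TriSet ℚ × (IterPoly ℚ n)[X])) (B : Option ℕ) :
      Step (.zeroDivisor p w c todo out B) (handleZeroDivisor p w c todo out B)

/-- Recursive representation of a triangular set. -/
def triOf {n : ℕ} (T : Fin n → MvPolynomial (Fin n) ℚ) : TriSet ℚ :=
  fun i => if h : i < n then toIter ℚ n (i + 1) (T ⟨i, h⟩) else (0 : (IterPoly ℚ i)[X])

/-- The reduced representative of an element of `R = ℚ[z₀, …, z_{n-1}] / ⟨T⟩`. -/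
def repr {n : ℕ} (T : Fin n → MvPolynomial (Fin n) ℚ)
    (c : MvPolynomial (Fin n) ℚ ⧸ Ideal.span (Set.range T)) : IterPoly ℚ n :=
  nf (triOf T) n (toIter ℚ n n
    (Function.surjInv (Ideal.Quotient.mk_surjective (I := Ideal.span (Set.range T))) c))

/-- The initial state of ModularC-GCD(`a`, `b`) modulo `T`, with the global bound unassigned. -/
def initialState {n : ℕ} (T : Fin n → MvPolynomial (Fin n) ℚ)
    (a b : (MvPolynomial (Fin n) ℚ ⧸ Ideal.span (Set.range T))[X]) : State n :=
  .mainLoop (Call.start ⟨triOf T, mapCoeffs (repr T) a, mapCoeffs (repr T) b⟩) [] [] none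

/-- A run of ModularC-GCD(`a`, `b`) modulo `T`, for some choice of primes. It stays in its last
state after the computation has ended. -/
structure IsRun {n : ℕ} (T : Fin n → MvPolynomial (Fin n) ℚ)
    (a b : (MvPolynomial (Fin n) ℚ ⧸ Ideal.span (Set.range T))[X]) (r : ℕ → State n) : Prop where
  init : r 0 = initialState T a b
  step : ∀ i, Step (r i) (r (i + 1)) ∨ ((r i).IsDone ∧ r (i + 1) = r i)

end

end ModularCGcd

namespace ModularCGcd

noncomputable section

open scoped Classical
open Polynomial Filter

/-! The core is that the initial state is accessible for the reversed step relation. Every run then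
reaches `done`, and its zero-divisors occur only before that point. That a run never gets stuck is
independent of this: only finitely many primes are bad or already used.

Splittings are finite in number because dimensions add up. If `t_k = w v`, the dimensions over `ℚ`
of the two component rings sum to that of `R`, so the total of `2 dim - 1` over the current and the
pending calls drops at every split and at every return (`triDim_split`, `acc_start`). Here a
successful lifting counts at any prime, however unlucky: its factor keeps the degree of `u₀` and has
passed trial division over `ℚ` (`henselLift_factors`). It remains to see that a call cannot go on
forever without splitting or returning.

For this, run the radicality test and the gcd over `ℚ` itself. That run consists of finitely many
operations and tests, so modulo all primes outside a finite set `E` the modular run is its reduction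
(`eventually_isRadical`, `eventually_monicExtGcd`). A call picks each prime of `E` at most once.

Suppose the run over `ℚ` returns a gcd `g`. Outside `E` the modular gcd is `g mod p`. Inside `E` its
degree may be too large but never too small, and if the degree is right, so is the gcd
(`gcd_mod_prime`). The reason is Nakayama's lemma: `R` over the local ring of `p`-integral rationals
is integral, so `p` lies in its Jacobson radical, and the degree found modulo `p` is attained by a
monic element of `⟨a, b⟩` over that ring. So `G ≡ g` modulo `M` whenever `d = deg g`, and once `M`
is large, rational reconstruction returns `g`, which passes the trial division.

Suppose the run over `ℚ` meets a zero-divisor. Outside `E` its reduction is what is met modulo `p`.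
As `⟨T⟩` is radical, every `t_k` is separable over the ring below it (`separable_of_isReduced`), so
complementary factors of `t_k` are coprime. Either the coprimality computation meets a zero-divisor
of smaller level, again the reduction of one over `ℚ`, or the lifting follows the factorization over
`ℚ` and finds it once the bound `B` exceeds a constant independent of `p` (`exists_goodZeroDiv`).
Since `B` increases with every zero-divisor, there are finitely many failures. Separability is
inherited by both components of a split, which closes the induction. `acc_inCall` turns both cases
into one lexicographic rank. -/

/-! ### Coefficients of recursive polynomials -/

/-- The base coefficient of the monomial `∏ zⱼ ^ e j`. -/
def baseCoeff {A : Type} [CommRing A] : (k : ℕ) → IterPoly A k → (ℕ → ℕ) → A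
  | 0 => fun a _ => a
  | k + 1 => fun (a : (IterPoly A k)[X]) e => baseCoeff k (a.coeff (e k)) e

section coefficients

variable {A B D : Type} [CommRing A] [CommRing B] [CommRing D]

theorem baseCoeff_succ (k : ℕ) (a : (IterPoly A k)[X]) (e : ℕ → ℕ) :
    baseCoeff (k + 1) a e = baseCoeff k (a.coeff (e k)) e := rfl

theorem baseCoeff_congr (k : ℕ) (a : IterPoly A k) (e e' : ℕ → ℕ) (h : ∀ j < k, e j = e' j) :
    baseCoeff k a e = baseCoeff k a e' := by
  induction k with
  | zero => rfl
  | succ k ih =>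
    change (IterPoly A k)[X] at a
    rw [baseCoeff_succ, baseCoeff_succ, h k (Nat.lt_succ_self k)]
    exact ih _ fun j hj => h j (by omega)

theorem baseCoeff_update (k : ℕ) (a : (IterPoly A k)[X]) (e : ℕ → ℕ) (i : ℕ) :
    baseCoeff (k + 1) a (Function.update e k i) = baseCoeff k (a.coeff i) e := by
  rw [baseCoeff_succ, Function.update_self]
  exact baseCoeff_congr k _ _ _ fun j hj => Function.update_of_ne (by omega) _ _

/-- `baseCoeff` as an additive homomorphism. -/
def baseCoeffHom (k : ℕ) (e : ℕ → ℕ) : IterPoly A k →+ A :=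
  match k with
  | 0 => AddMonoidHom.id A
  | k + 1 => (baseCoeffHom k e).comp
      ((Polynomial.lcoeff (IterPoly A k) (e k)).toAddMonoidHom : (IterPoly A k)[X] →+ IterPoly A k)

theorem baseCoeffHom_apply (k : ℕ) (e : ℕ → ℕ) (a : IterPoly A k) :
    baseCoeffHom k e a = baseCoeff k a e := by
  induction k with
  | zero => rfl
  | succ k ih => exact ih _

theorem baseCoeff_zero (k : ℕ) (e : ℕ → ℕ) : baseCoeff k (0 : IterPoly A k) e = 0 := by
  rw [← baseCoeffHom_apply, map_zero]

theorem baseCoeff_add (k : ℕ) (a b : IterPoly A k) (e : ℕ → ℕ) :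
    baseCoeff k (a + b) e = baseCoeff k a e + baseCoeff k b e := by
  simp only [← baseCoeffHom_apply, map_add]

theorem baseCoeff_sub (k : ℕ) (a b : IterPoly A k) (e : ℕ → ℕ) :
    baseCoeff k (a - b) e = baseCoeff k a e - baseCoeff k b e := by
  simp only [← baseCoeffHom_apply, map_sub]

/-- Lets identities between recursive polynomials be checked on scalars, without unfolding the tower
of polynomial rings. -/
theorem baseCoeff_ext (k : ℕ) (a b : IterPoly A k) (h : ∀ e, baseCoeff k a e = baseCoeff k b e) :
    a = b := by
  induction k with
  | zero => exact h 0
  | succ k ih =>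
    change (IterPoly A k)[X] at a b
    refine Polynomial.ext fun i => ih _ _ fun e => ?_
    rw [← baseCoeff_update, ← baseCoeff_update]
    exact h _

theorem baseCoeff_one (k : ℕ) (e : ℕ → ℕ) :
    baseCoeff k (1 : IterPoly A k) e = if ∀ j < k, e j = 0 then 1 else 0 := by
  induction k with
  | zero => simp only [not_lt_zero, IsEmpty.forall_iff, implies_true, if_true]; rfl
  | succ k ih =>
    have h : baseCoeff (k + 1) (1 : IterPoly A (k + 1)) e =
      baseCoeff k ((1 : (IterPoly A k)[X]).coeff (e k)) e := rfl
    rw [h, coeff_one]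
    by_cases h0 : e k = 0
    · rw [if_pos h0, ih]
      congr 1
      simp only [eq_iff_iff]
      exact ⟨fun h j hj => (Nat.lt_succ_iff_lt_or_eq.1 hj).elim (h j) (fun hh => hh ▸ h0),
        fun h j hj => h j (by omega)⟩
    · rw [if_neg h0, baseCoeff_zero, if_neg]
      exact fun h => h0 (h k (Nat.lt_succ_self k))

theorem mapCoeffs_coeff {R S : Type} [Semiring R] [Semiring S] (f : R → S) (hf : f 0 = 0)
    (a : R[X]) (i : ℕ) : (mapCoeffs f a).coeff i = f (a.coeff i) := by
  unfold mapCoeffs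
  rw [Polynomial.sum_def, Polynomial.finsetSum_coeff]
  simp only [coeff_monomial]
  rw [Finset.sum_ite_eq' a.support i (fun n => f (a.coeff n))]
  split_ifs with h
  · rfl
  · rw [Polynomial.notMem_support_iff.1 h, hf]

theorem mapBase_succ_coeff (f : A → B) (k : ℕ) (h0 : mapBase f k 0 = 0)
    (a : (IterPoly A k)[X]) (i : ℕ) :
    Polynomial.coeff (R := IterPoly B k) (mapBase f (k + 1) a) i = mapBase f k (a.coeff i) :=
  mapCoeffs_coeff _ h0 _ _

theorem mapBase_zero (f : A → B) (hf : f 0 = 0) (k : ℕ) : mapBase f k 0 = 0 := by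
  induction k with
  | zero => exact hf
  | succ k ih =>
    refine Polynomial.ext (R := IterPoly B k) fun i => ?_
    exact (mapBase_succ_coeff f k ih (0 : (IterPoly A k)[X]) i).trans
      ((congrArg _ (coeff_zero i)).trans (ih.trans (coeff_zero i).symm))

theorem mapPoly_coeff (f : A → B) (hf : f 0 = 0) (k : ℕ) (a : (IterPoly A k)[X]) (i : ℕ) :
    (mapPoly f k a).coeff i = mapBase f k (a.coeff i) :=
  mapCoeffs_coeff _ (mapBase_zero f hf k) a i

/-- Only `f 0 = 0` is assumed because `liftInt`, `toPInt` and rational reconstruction are not ring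
homomorphisms. -/
theorem baseCoeff_mapBase (f : A → B) (hf : f 0 = 0) (k : ℕ) (a : IterPoly A k) (e : ℕ → ℕ) :
    baseCoeff k (mapBase f k a) e = f (baseCoeff k a e) := by
  induction k with
  | zero => rfl
  | succ k ih =>
    exact (congrArg (baseCoeff k · e) (mapBase_succ_coeff f k (mapBase_zero f hf k) a (e k))).trans
      (ih _)

theorem mapBase_one (f : A → B) (hf : f 0 = 0) (h1 : f 1 = 1) (k : ℕ) : mapBase f k 1 = 1 := by
  refine baseCoeff_ext k _ _ fun e => ?_
  rw [baseCoeff_mapBase f hf, baseCoeff_one, baseCoeff_one]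
  split_ifs <;> assumption

theorem allBase_iff (Q : A → Prop) (k : ℕ) (a : IterPoly A k) :
    AllBase Q k a ↔ ∀ e, Q (baseCoeff k a e) := by
  induction k with
  | zero => exact ⟨fun h _ => h, fun h => h 0⟩
  | succ k ih =>
    change (IterPoly A k)[X] at a
    refine ⟨fun h e => (ih _).1 (h (e k)) e, fun h i => (ih _).2 fun e => ?_⟩
    rw [← baseCoeff_update]
    exact h _

/-- The ring homomorphism of recursive polynomials induced by a ring homomorphism. -/
def mapHom (f : A →+* B) : (k : ℕ) → IterPoly A k →+* IterPoly B k
  | 0 => f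
  | k + 1 => (Polynomial.mapRingHom (mapHom f k) : (IterPoly A k)[X] →+* (IterPoly B k)[X])

theorem mapBase_ringHom (f : A →+* B) (k : ℕ) (a : IterPoly A k) :
    mapBase f k a = mapHom f k a := by
  induction k with
  | zero => rfl
  | succ k ih =>
    refine Polynomial.ext (R := IterPoly B k) fun i => ?_
    refine (mapBase_succ_coeff f k (mapBase_zero f (map_zero f) k) a i).trans ?_
    rw [ih]
    exact (Polynomial.coeff_map (mapHom f k) i).symm

theorem mapPoly_ringHom (f : A →+* B) (k : ℕ) (a : (IterPoly A k)[X]) :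
    mapPoly f k a = a.map (mapHom f k) := by
  ext i
  rw [mapPoly_coeff _ (map_zero f), mapBase_ringHom, coeff_map]

theorem mapBase_mapBase (f : A → B) (g : B → D) (hf : f 0 = 0) (hg : g 0 = 0) (k : ℕ)
    (a : IterPoly A k) : mapBase g k (mapBase f k a) = mapBase (g ∘ f) k a := by
  refine baseCoeff_ext k _ _ fun e => ?_
  rw [baseCoeff_mapBase g hg, baseCoeff_mapBase f hf, baseCoeff_mapBase]
  · rfl
  · simp [hf, hg]

theorem mapPoly_mapPoly (f : A → B) (g : B → D) (hf : f 0 = 0) (hg : g 0 = 0) (k : ℕ)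
    (a : (IterPoly A k)[X]) : mapPoly g k (mapPoly f k a) = mapPoly (g ∘ f) k a := by
  ext i
  rw [mapPoly_coeff g hg, mapPoly_coeff f hf, mapBase_mapBase f g hf hg, mapPoly_coeff]
  simp [hf, hg]

theorem baseCoeff_mapHom (f : A →+* B) (k : ℕ) (a : IterPoly A k) (e : ℕ → ℕ) :
    baseCoeff k (mapHom f k a) e = f (baseCoeff k a e) := by
  rw [← mapBase_ringHom, baseCoeff_mapBase _ (map_zero f)]

theorem mapHom_injective (f : A →+* B) (hf : Function.Injective f) (k : ℕ) :
    Function.Injective (mapHom f k) := fun a b h => baseCoeff_ext k _ _ fun e => hf <| by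
  rw [← baseCoeff_mapHom, ← baseCoeff_mapHom, h]

theorem baseCoeff_natCast_mul (k m : ℕ) (a : IterPoly A k) (e : ℕ → ℕ) :
    baseCoeff k ((m : IterPoly A k) * a) e = m * baseCoeff k a e := by
  rw [← nsmul_eq_mul, ← baseCoeffHom_apply, map_nsmul, baseCoeffHom_apply, nsmul_eq_mul]

instance instNontrivialIterPoly [Nontrivial A] (k : ℕ) : Nontrivial (IterPoly A k) := by
  refine ⟨1, 0, fun h => one_ne_zero (α := A) ?_⟩
  have := congrArg (fun a => baseCoeff k a 0) h
  simp [baseCoeff_one, baseCoeff_zero] at this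

theorem mapPoly_monic [Nontrivial B] (f : A → B) (hf : f 0 = 0) (h1 : f 1 = 1) (k : ℕ)
    {a : (IterPoly A k)[X]} (ha : a.Monic) :
    (mapPoly f k a).Monic ∧ (mapPoly f k a).natDegree = a.natDegree := by
  have h : (mapPoly f k a).coeff a.natDegree = 1 := by
    rw [mapPoly_coeff f hf, ha.coeff_natDegree, mapBase_one f hf h1]
  have hle : (mapPoly f k a).natDegree ≤ a.natDegree := by
    rw [natDegree_le_iff_coeff_eq_zero]
    intro N hN
    rw [mapPoly_coeff f hf, coeff_eq_zero_of_natDegree_lt hN, mapBase_zero f hf]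
  have heq : (mapPoly f k a).natDegree = a.natDegree :=
    le_antisymm hle (le_natDegree_of_ne_zero (by rw [h]; exact one_ne_zero))
  exact ⟨by rw [Monic, leadingCoeff, heq, h], heq⟩

theorem degree_mapPoly_le (f : A → B) (hf : f 0 = 0) (k : ℕ) (a : (IterPoly A k)[X]) :
    (mapPoly f k a).degree ≤ a.degree := by
  rw [degree_le_iff_coeff_zero]
  intro m hm
  rw [mapPoly_coeff f hf, coeff_eq_zero_of_degree_lt hm, mapBase_zero f hf]

/-! ### Reduced recursive polynomials -/

/-- The degree in `zⱼ` is smaller than `d j`, for all `j < k`. -/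
def IsReduced (d : ℕ → ℕ) (k : ℕ) (a : IterPoly A k) : Prop :=
  ∀ e, baseCoeff k a e ≠ 0 → ∀ j < k, e j < d j

/-- All coefficients are reduced. -/
def IsReducedPoly (d : ℕ → ℕ) (k : ℕ) (a : (IterPoly A k)[X]) : Prop :=
  ∀ i, IsReduced d k (a.coeff i)

variable {d : ℕ → ℕ} {k : ℕ}

theorem isReduced_zero : IsReduced d k (0 : IterPoly A k) :=
  fun e he => absurd (baseCoeff_zero k e) he

theorem isReduced_one (hd : ∀ j < k, 0 < d j) : IsReduced d k (1 : IterPoly A k) := by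
  intro e he j hj
  rw [baseCoeff_one] at he
  split_ifs at he with h
  · rw [h j hj]; exact hd j hj
  · exact absurd rfl he

theorem isReduced_succ_iff (a : (IterPoly A k)[X]) :
    IsReduced (A := A) d (k + 1) a ↔ a.degree < d k ∧ IsReducedPoly d k a := by
  constructor
  · intro h
    refine ⟨?_, fun i e he j hj => ?_⟩
    · rw [degree_lt_iff_coeff_zero]
      intro m hm
      by_contra hne
      have : ∃ e, baseCoeff k (a.coeff m) e ≠ 0 := by
        by_contra! hall
        exact hne (baseCoeff_ext k _ _ fun e => by rw [hall, baseCoeff_zero])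
      obtain ⟨e, he⟩ := this
      rw [← baseCoeff_update] at he
      have := h _ he k (Nat.lt_succ_self k)
      rw [Function.update_self] at this
      omega
    · rw [← baseCoeff_update] at he
      have := h _ he j (by omega)
      rwa [Function.update_of_ne (by omega)] at this
  · rintro ⟨h1, h2⟩ e he j hj
    rcases Nat.lt_succ_iff_lt_or_eq.1 hj with hj | rfl
    · exact h2 (e k) e he j hj
    · by_contra hge
      rw [baseCoeff_succ, coeff_eq_zero_of_degree_lt, baseCoeff_zero] at he
      · exact he rfl
      · exact lt_of_lt_of_le h1 (by exact_mod_cast not_lt.1 hge)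

theorem IsReduced.sub {a b : IterPoly A k} (ha : IsReduced d k a) (hb : IsReduced d k b) :
    IsReduced d k (a - b) := by
  intro e he
  rw [baseCoeff_sub] at he
  by_cases h : baseCoeff k a e = 0
  · exact hb e fun hb => he (by rw [h, hb, sub_zero])
  · exact ha e h

theorem IsReduced.add {a b : IterPoly A k} (ha : IsReduced d k a) (hb : IsReduced d k b) :
    IsReduced d k (a + b) := by
  intro e he
  rw [baseCoeff_add] at he
  by_cases h : baseCoeff k a e = 0
  · exact hb e fun hb => he (by rw [h, hb, add_zero])
  · exact ha e h

theorem IsReduced.mapBase (f : A → B) (hf : f 0 = 0) {a : IterPoly A k} (ha : IsReduced d k a) :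
    IsReduced d k (mapBase f k a) := by
  intro e he
  rw [baseCoeff_mapBase f hf] at he
  exact ha e fun h => he (by rw [h, hf])

theorem isReducedPoly_zero : IsReducedPoly d k (0 : (IterPoly A k)[X]) :=
  fun _ => isReduced_zero

theorem IsReducedPoly.sub {a b : (IterPoly A k)[X]} (ha : IsReducedPoly d k a)
    (hb : IsReducedPoly d k b) : IsReducedPoly d k (a - b) :=
  fun i => by rw [coeff_sub]; exact (ha i).sub (hb i)

theorem IsReducedPoly.add {a b : (IterPoly A k)[X]} (ha : IsReducedPoly d k a)
    (hb : IsReducedPoly d k b) : IsReducedPoly d k (a + b) :=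
  fun i => by rw [coeff_add]; exact (ha i).add (hb i)

theorem IsReducedPoly.mapPoly (f : A → B) (hf : f 0 = 0) {a : (IterPoly A k)[X]}
    (ha : IsReducedPoly d k a) : IsReducedPoly d k (mapPoly f k a) :=
  fun i => by rw [mapPoly_coeff f hf]; exact (ha i).mapBase f hf

theorem IsReducedPoly.natCast_mul (m : ℕ) {a : (IterPoly A k)[X]}
    (ha : IsReducedPoly d k a) : IsReducedPoly d k ((m : (IterPoly A k)[X]) * a) := by
  intro i e he
  rw [← nsmul_eq_mul, coeff_smul, nsmul_eq_mul, baseCoeff_natCast_mul] at he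
  exact ha i e (right_ne_zero_of_mul he)

end coefficients

/-! ### The quotient by a triangular set -/

section quotient

variable {F : Type} [CommRing F]

/-- The ideal `⟨t₀, …, t_{k-1}⟩`. -/
def triIdeal (T : TriSet F) : (k : ℕ) → Ideal (IterPoly F k)
  | 0 => ⊥
  | k + 1 => ((triIdeal T k).map C ⊔ Ideal.span {T k} : Ideal (IterPoly F k)[X])

/-- The ring `R_k = F[z₀, …, z_{k-1}] / ⟨t₀, …, t_{k-1}⟩`. -/
abbrev TriQuot (T : TriSet F) (k : ℕ) : Type := IterPoly F k ⧸ triIdeal T k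

/-- The projection to `R_k`. -/
abbrev quo (T : TriSet F) (k : ℕ) : IterPoly F k →+* TriQuot T k := Ideal.Quotient.mk _

/-- The projection to `R_k[X]`. -/
def quoPoly (T : TriSet F) (k : ℕ) : (IterPoly F k)[X] →+* (TriQuot T k)[X] := mapRingHom (quo T k)

/-- The main degrees. -/
abbrev mainDeg (T : TriSet F) : ℕ → ℕ := fun j => (T j).natDegree

/-- `t₀, …, t_{n-1}` is a triangular set: monic of positive degree, with reduced coefficients. -/
def IsTri (T : TriSet F) (n : ℕ) : Prop :=
  ∀ i < n, (T i).Monic ∧ 0 < (T i).natDegree ∧ IsReducedPoly (mainDeg T) i (T i)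

theorem quoPoly_surjective (T : TriSet F) (k : ℕ) : Function.Surjective (quoPoly T k) :=
  Polynomial.map_surjective _ Ideal.Quotient.mk_surjective

theorem coeff_quoPoly (T : TriSet F) (k : ℕ) (a : (IterPoly F k)[X]) (i : ℕ) :
    (quoPoly T k a).coeff i = quo T k (a.coeff i) := coeff_map _ _

/-- This is `R_{k+1} = R_k[z_k] / ⟨t_k⟩`: the kernel of the coefficientwise projection is the
extension of the ideal below, so membership one level up is divisibility over `R_k`. -/
theorem mem_triIdeal_succ (T : TriSet F) (k : ℕ) (a : (IterPoly F k)[X]) :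
    (show IterPoly F (k + 1) from a) ∈ triIdeal T (k + 1) ↔ quoPoly T k (T k) ∣ quoPoly T k a := by
  change a ∈ (triIdeal T k).map C ⊔ Ideal.span {T k} ↔ _
  constructor
  · intro h
    obtain ⟨x, hx, y, hy, rfl⟩ := Submodule.mem_sup.1 h
    obtain ⟨q, rfl⟩ := Ideal.mem_span_singleton.1 hy
    have : quoPoly T k x = 0 := by
      ext i
      rw [coeff_quoPoly, coeff_zero, Ideal.Quotient.eq_zero_iff_mem]
      exact Ideal.mem_map_C_iff.1 hx i
    rw [map_add, this, zero_add, map_mul]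
    exact dvd_mul_right _ _
  · rintro ⟨q, hq⟩
    obtain ⟨q, rfl⟩ := quoPoly_surjective T k q
    have : a = (a - T k * q) + T k * q := by ring
    rw [this]
    refine Submodule.add_mem_sup (Ideal.mem_map_C_iff.2 fun i => ?_)
      (Ideal.mem_span_singleton.2 (dvd_mul_right _ _))
    rw [← Ideal.Quotient.eq_zero_iff_mem]
    change quo T k _ = 0
    rw [← coeff_quoPoly, map_sub, map_mul, hq, sub_self, coeff_zero]

/-- A monic polynomial divides no nonzero polynomial of smaller degree, so the element vanishes in
`R_k[z_k]`, and induction applies to its coefficients. Reduced polynomials are thus faithful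
representatives: equalities of stored data can be proved in the quotient. -/
theorem eq_zero_of_isReduced_of_mem {T : TriSet F} {n k : ℕ} (hT : IsTri T n) (hk : k ≤ n)
    {a : IterPoly F k} (ha : IsReduced (mainDeg T) k a) (hI : a ∈ triIdeal T k) : a = 0 := by
  induction k with
  | zero => exact hI
  | succ k ih =>
    change (IterPoly F k)[X] at a
    have hd := (mem_triIdeal_succ T k a).1 hI
    rw [isReduced_succ_iff] at ha
    obtain ⟨hm, hpos, -⟩ := hT k (by omega)
    have h0 : quoPoly T k a = 0 := by
      by_contra hne
      have : Nontrivial (TriQuot T k) := Polynomial.nontrivial_iff.1 ⟨_, _, hne⟩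
      refine (hm.map (quo T k)).not_dvd_of_degree_lt hne ?_ hd
      rw [hm.degree_map]
      refine lt_of_le_of_lt degree_map_le (lt_of_lt_of_le ha.1 ?_)
      rw [degree_eq_natDegree fun h0 => by rw [h0, natDegree_zero] at hpos; omega]
    refine Polynomial.ext fun i => ih (by omega) (ha.2 i) ?_
    rw [← Ideal.Quotient.eq_zero_iff_mem]
    change quo T k _ = 0
    rw [← coeff_quoPoly, h0, coeff_zero]

variable {T : TriSet F} {n k : ℕ}

theorem eq_of_quo_eq (hT : IsTri T n) (hk : k ≤ n) {a b : IterPoly F k}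
    (ha : IsReduced (mainDeg T) k a) (hb : IsReduced (mainDeg T) k b) (h : quo T k a = quo T k b) :
    a = b :=
  sub_eq_zero.1 (eq_zero_of_isReduced_of_mem hT hk (ha.sub hb) (Ideal.Quotient.eq.1 h))

theorem eq_of_quoPoly_eq (hT : IsTri T n) (hk : k ≤ n) {a b : (IterPoly F k)[X]}
    (ha : IsReducedPoly (mainDeg T) k a) (hb : IsReducedPoly (mainDeg T) k b)
    (h : quoPoly T k a = quoPoly T k b) : a = b := by
  ext i
  exact eq_of_quo_eq hT hk (ha i) (hb i) (by rw [← coeff_quoPoly, h, coeff_quoPoly])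

theorem degree_quoPoly (hT : IsTri T n) (hk : k ≤ n) {a : (IterPoly F k)[X]}
    (ha : IsReducedPoly (mainDeg T) k a) : (quoPoly T k a).degree = a.degree := by
  refine le_antisymm degree_map_le ?_
  rw [degree_le_iff_coeff_zero]
  intro m hm
  refine eq_of_quo_eq hT hk (ha m) isReduced_zero ?_
  rw [← coeff_quoPoly, coeff_eq_zero_of_degree_lt hm, map_zero]

theorem natDegree_quoPoly (hT : IsTri T n) (hk : k ≤ n) {a : (IterPoly F k)[X]}
    (ha : IsReducedPoly (mainDeg T) k a) : (quoPoly T k a).natDegree = a.natDegree :=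
  natDegree_eq_natDegree (degree_quoPoly hT hk ha)

theorem leadingCoeff_quoPoly (hT : IsTri T n) (hk : k ≤ n) {a : (IterPoly F k)[X]}
    (ha : IsReducedPoly (mainDeg T) k a) :
    (quoPoly T k a).leadingCoeff = quo T k a.leadingCoeff := by
  rw [leadingCoeff, natDegree_quoPoly hT hk ha, coeff_quoPoly, leadingCoeff]

theorem IsTri.isReduced_one (hT : IsTri T n) (hk : k ≤ n) :
    IsReduced (mainDeg T) k (1 : IterPoly F k) :=
  ModularCGcd.isReduced_one fun j hj => (hT j (by omega)).2.1

theorem IsTri.isReducedPoly_one (hT : IsTri T n) (hk : k ≤ n) :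
    IsReducedPoly (mainDeg T) k (1 : (IterPoly F k)[X]) := fun i => by
  rw [coeff_one]
  split_ifs
  · exact hT.isReduced_one hk
  · exact isReduced_zero

theorem monic_of_monic_quoPoly (hT : IsTri T n) (hk : k ≤ n) {a : (IterPoly F k)[X]}
    (ha : IsReducedPoly (mainDeg T) k a) (h : (quoPoly T k a).Monic) : a.Monic :=
  eq_of_quo_eq hT hk (ha _) (hT.isReduced_one hk) (by
    rw [← leadingCoeff_quoPoly hT hk ha, h.leadingCoeff, map_one])

variable [Nontrivial F]

theorem isReduced_nf (hT : IsTri T n) (hk : k ≤ n) (a : IterPoly F k) :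
    IsReduced (mainDeg T) k (nf T k a) ∧ quo T k (nf T k a) = quo T k a := by
  induction k with
  | zero => exact ⟨fun e he j hj => absurd hj (by omega), rfl⟩
  | succ k ih =>
    have ih := ih (by omega)
    change (IterPoly F k)[X] at a
    have h0 : nf T k 0 = 0 :=
      eq_of_quo_eq hT (by omega) (ih 0).1 isReduced_zero (ih 0).2
    obtain ⟨hm, hpos, -⟩ := hT k (by omega)
    have hc : ∀ i, (mapCoeffs (nf T k) (a %ₘ T k)).coeff i = nf T k ((a %ₘ T k).coeff i) :=
      mapCoeffs_coeff _ h0 _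
    -- Only the coefficients of the normal form matter; an abstract `b` keeps the type `IterPoly F
    -- (k + 1)` apart from the polynomial ring it unfolds to.
    suffices h : ∀ b : (IterPoly F k)[X], (∀ i, b.coeff i = nf T k ((a %ₘ T k).coeff i)) →
        IsReduced (A := F) (mainDeg T) (k + 1) b ∧ quo T (k + 1) b = quo T (k + 1) a from h _ hc
    intro b hb
    constructor
    · refine (isReduced_succ_iff _).2 ⟨?_, fun i => by rw [hb]; exact (ih _).1⟩
      refine lt_of_le_of_lt ?_ ((degree_modByMonic_lt a hm).trans_le degree_le_natDegree)
      rw [degree_le_iff_coeff_zero]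
      intro m hm'
      rw [hb, coeff_eq_zero_of_degree_lt hm', h0]
    · refine Ideal.Quotient.eq.2 ((mem_triIdeal_succ T k (b - a)).2 ?_)
      have : quoPoly T k b = quoPoly T k (a %ₘ T k) := by
        ext i
        rw [coeff_quoPoly, coeff_quoPoly, hb, (ih _).2]
      rw [map_sub, this, ← map_sub]
      refine _root_.map_dvd _ ⟨-(a /ₘ T k), ?_⟩
      conv_lhs => rw [modByMonic_eq_sub_mul_div]
      ring

theorem quo_nf (hT : IsTri T n) (hk : k ≤ n) (a : IterPoly F k) :
    quo T k (nf T k a) = quo T k a := (isReduced_nf hT hk a).2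

theorem nf_eq_self (hT : IsTri T n) (hk : k ≤ n) {a : IterPoly F k}
    (ha : IsReduced (mainDeg T) k a) : nf T k a = a :=
  eq_of_quo_eq hT hk (isReduced_nf hT hk a).1 ha (quo_nf hT hk a)

theorem nf_zero (hT : IsTri T n) (hk : k ≤ n) : nf T k 0 = 0 :=
  nf_eq_self hT hk isReduced_zero

theorem coeff_nfPoly (hT : IsTri T n) (hk : k ≤ n) (a : (IterPoly F k)[X]) (i : ℕ) :
    (nfPoly T k a).coeff i = nf T k (a.coeff i) :=
  mapCoeffs_coeff _ (nf_zero hT hk) a i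

theorem isReducedPoly_nfPoly (hT : IsTri T n) (hk : k ≤ n) (a : (IterPoly F k)[X]) :
    IsReducedPoly (mainDeg T) k (nfPoly T k a) := fun i => by
  rw [coeff_nfPoly hT hk]; exact (isReduced_nf hT hk _).1

theorem quoPoly_nfPoly (hT : IsTri T n) (hk : k ≤ n) (a : (IterPoly F k)[X]) :
    quoPoly T k (nfPoly T k a) = quoPoly T k a := by
  ext i
  rw [coeff_quoPoly, coeff_quoPoly, coeff_nfPoly hT hk, quo_nf hT hk]

theorem nfPoly_eq_zero_iff (hT : IsTri T n) (hk : k ≤ n) (a : (IterPoly F k)[X]) :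
    nfPoly T k a = 0 ↔ quoPoly T k a = 0 := by
  constructor
  · intro h
    rw [← quoPoly_nfPoly hT hk, h, map_zero]
  · intro h
    refine eq_of_quoPoly_eq hT hk (isReducedPoly_nfPoly hT hk a) isReducedPoly_zero ?_
    rw [quoPoly_nfPoly hT hk, h, map_zero]

theorem degree_nfPoly_le (hT : IsTri T n) (hk : k ≤ n) (a : (IterPoly F k)[X]) :
    (nfPoly T k a).degree ≤ a.degree := by
  rw [degree_le_iff_coeff_zero]
  intro m hm
  rw [coeff_nfPoly hT hk, coeff_eq_zero_of_degree_lt hm, nf_zero hT hk]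

theorem divides_iff (hT : IsTri T n) (hk : k ≤ n) (h a : (IterPoly F k)[X]) :
    Divides T k h a ↔ quoPoly T k h ∣ quoPoly T k a := by
  constructor
  · rintro ⟨q, hq⟩
    rw [nfPoly_eq_zero_iff hT hk, map_sub, map_mul, sub_eq_zero] at hq
    exact ⟨_, hq⟩
  · rintro ⟨q, hq⟩
    obtain ⟨q, rfl⟩ := quoPoly_surjective T k q
    exact ⟨q, by rw [nfPoly_eq_zero_iff hT hk, map_sub, map_mul, hq, sub_self]⟩

theorem IsTri.nontrivial (hT : IsTri T n) (hk : k ≤ n) : Nontrivial (TriQuot T k) :=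
  ⟨quo T k 1, quo T k 0, fun h => one_ne_zero
    (eq_of_quo_eq hT hk (hT.isReduced_one hk) isReduced_zero h)⟩

end quotient

/-! ### Correctness of the monic Euclidean algorithm -/

/-- `e` is a Bézout relation for the monic generator `e.g` of `⟨a, b⟩` in `R_k[X]`. -/
structure IsBezout {F : Type} [CommRing F] (T : TriSet F) (k : ℕ) (a b : (IterPoly F k)[X])
    (e : Bezout F k) : Prop where
  comb : quoPoly T k e.g = quoPoly T k e.s * quoPoly T k a + quoPoly T k e.t * quoPoly T k b
  span : Ideal.span {quoPoly T k e.g} = Ideal.span {quoPoly T k a, quoPoly T k b}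
  monic : e.g.Monic
  reduced : IsReducedPoly (mainDeg T) k e.g

/-- `z` is a proper monic factor of some `tᵢ`, `i < N`, over `R_i`. -/
structure ZeroDiv.IsValid {F : Type} [CommRing F] (T : TriSet F) (N : ℕ) (z : ZeroDiv F) :
    Prop where
  level_lt : z.level < N
  monic : z.poly.Monic
  reduced : IsReducedPoly (mainDeg T) z.level z.poly
  pos : 0 < z.poly.natDegree
  lt : z.poly.natDegree < (T z.level).natDegree
  dvd : quoPoly T z.level z.poly ∣ quoPoly T z.level (T z.level)

theorem ZeroDiv.IsValid.mono {F : Type} [CommRing F] {T : TriSet F} {N N' : ℕ} {z : ZeroDiv F}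
    (h : z.IsValid T N) (hN : N ≤ N') : z.IsValid T N' :=
  ⟨h.level_lt.trans_le hN, h.monic, h.reduced, h.pos, h.lt, h.dvd⟩

section loop

variable {F : Type} [CommRing F] {T : TriSet F} {k : ℕ}

theorem IsBezout.dvd_left {a b : (IterPoly F k)[X]} {e : Bezout F k} (h : IsBezout T k a b e) :
    quoPoly T k e.g ∣ quoPoly T k a := by
  rw [← Ideal.mem_span_singleton, h.span]
  exact Ideal.subset_span (by simp)

theorem IsBezout.dvd_right {a b : (IterPoly F k)[X]} {e : Bezout F k} (h : IsBezout T k a b e) :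
    quoPoly T k e.g ∣ quoPoly T k b := by
  rw [← Ideal.mem_span_singleton, h.span]
  exact Ideal.subset_span (by simp)

theorem isReducedPoly_derivative {d : ℕ → ℕ} {a : (IterPoly F k)[X]}
    (ha : IsReducedPoly d k a) : IsReducedPoly d k (derivative a) := fun i => by
  have : (derivative a).coeff i = ((i + 1 : ℕ) : IterPoly F k) * a.coeff (i + 1) := by
    rw [coeff_derivative, mul_comm]; push_cast; rfl
  rw [this]
  intro e he
  rw [baseCoeff_natCast_mul] at he
  exact ha _ e (right_ne_zero_of_mul he)

variable {n : ℕ} {inv : IterPoly F k → Except (ZeroDiv F) (IterPoly F k)}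

/-- If the algorithm succeeds, it has inverted the leading coefficient of the divisor. -/
theorem monicEuclid_isUnit
    (hinv : ∀ u c, IsReduced (mainDeg T) k u → u ≠ 0 → inv u = .ok c → quo T k c * quo T k u = 1)
    (a b : (IterPoly F k)[X]) (e : Bezout F k) (ha : IsReducedPoly (mainDeg T) k a)
    (hb : IsReducedPoly (mainDeg T) k b) (hab : ¬ (a = 0 ∧ b = 0))
    (he : monicEuclid T k inv a b = .ok e) :
    IsUnit (quo T k (if b = 0 then a else b).leadingCoeff) := by
  rw [monicEuclid] at he
  split_ifs at he ⊢ with h h'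
  · exact absurd ⟨h', h⟩ hab
  · cases hc : inv a.leadingCoeff with
    | error z => simp [hc] at he
    | ok c => exact IsUnit.of_mul_eq_one_right _ (hinv _ c (ha _) (leadingCoeff_ne_zero.2 h') hc)
  · rw [euclidLoop, if_neg h] at he
    cases hc : inv b.leadingCoeff with
    | error z => simp [hc] at he
    | ok c => exact IsUnit.of_mul_eq_one_right _ (hinv _ c (hb _) (leadingCoeff_ne_zero.2 h) hc)

variable [Nontrivial F]

theorem normalize_spec (hT : IsTri T n) (hk : k ≤ n) {r : (IterPoly F k)[X]} {c : IterPoly F k}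
    (hr : IsReducedPoly (mainDeg T) k r) (hc : quo T k c * quo T k r.leadingCoeff = 1) :
    (nfPoly T k (C c * r)).Monic ∧ IsReducedPoly (mainDeg T) k (nfPoly T k (C c * r)) ∧
      quoPoly T k (nfPoly T k (C c * r)) = C (quo T k c) * quoPoly T k r ∧
      (nfPoly T k (C c * r)).degree = r.degree := by
  have := hT.nontrivial hk
  have hQ : quoPoly T k (nfPoly T k (C c * r)) = C (quo T k c) * quoPoly T k r := by
    rw [quoPoly_nfPoly hT hk, map_mul]
    congr 1
    exact map_C _
  have hm : (C (quo T k c) * quoPoly T k r).Monic := by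
    refine monic_C_mul_of_mul_leadingCoeff_eq_one ?_
    rw [leadingCoeff_quoPoly hT hk hr, hc]
  have hred := isReducedPoly_nfPoly hT hk (C c * r)
  refine ⟨monic_of_monic_quoPoly hT hk hred (hQ ▸ hm), hred, hQ, ?_⟩
  rw [← degree_quoPoly hT hk hred, hQ, ← degree_quoPoly hT hk hr,
    degree_C_mul_of_isUnit (IsUnit.of_mul_eq_one _ hc)]

/-- Each turn preserves both Bézout relations and the ideal spanned by the two remainders, since a
unit multiple and a subtracted multiple do not change it. The last remainder is monic because it was
normalized in the preceding turn, which is what `hr₀` records. -/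
theorem euclidLoop_spec (hT : IsTri T n) (hk : k ≤ n)
    (hinv : ∀ u c, IsReduced (mainDeg T) k u → u ≠ 0 → inv u = .ok c → quo T k c * quo T k u = 1)
    (a b : (IterPoly F k)[X]) (m : ℕ) (r₀ s₀ t₀ r₁ s₁ t₁ : (IterPoly F k)[X]) (e : Bezout F k)
    (h₀ : quoPoly T k r₀ = quoPoly T k s₀ * quoPoly T k a + quoPoly T k t₀ * quoPoly T k b)
    (h₁ : quoPoly T k r₁ = quoPoly T k s₁ * quoPoly T k a + quoPoly T k t₁ * quoPoly T k b)
    (hs : Ideal.span {quoPoly T k r₀, quoPoly T k r₁} = Ideal.span {quoPoly T k a, quoPoly T k b})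
    (hr : IsReducedPoly (mainDeg T) k r₁) (hm : r₁.degree < m)
    (hr₀ : r₁ = 0 → r₀.Monic ∧ IsReducedPoly (mainDeg T) k r₀)
    (he : euclidLoop T k inv m r₀ s₀ t₀ r₁ s₁ t₁ = .ok e) : IsBezout T k a b e := by
  -- Both exits of the loop end here: by `hm` the counter can run out only when `r₁ = 0`.
  have hend : r₁ = 0 → e = ⟨r₀, s₀, t₀⟩ → IsBezout T k a b e := by
    rintro rfl rfl
    refine ⟨h₀, ?_, (hr₀ rfl).1, (hr₀ rfl).2⟩
    rw [← hs, map_zero, Ideal.span_pair_zero]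
  induction m generalizing r₀ s₀ t₀ r₁ s₁ t₁ with
  | zero =>
    refine hend ?_ ?_
    · by_contra hne
      rw [degree_eq_natDegree hne] at hm
      exact absurd hm (by simp)
    · exact (Except.ok.inj he).symm
  | succ m ih =>
    rw [euclidLoop] at he
    split_ifs at he with h
    · exact hend h (Except.ok.inj he).symm
    cases hc : inv r₁.leadingCoeff with
    | error z => simp [hc] at he
    | ok c =>
      simp only [hc] at he
      have hc' : quo T k c * quo T k r₁.leadingCoeff = 1 :=
        hinv _ c (hr _) (leadingCoeff_ne_zero.2 h) hc
      obtain ⟨n1, n2, n3, n4⟩ := normalize_spec hT hk hr hc'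
      set r := nfPoly T k (C c * r₁) with hrdef
      have hC : ∀ x, quoPoly T k (C c * x) = C (quo T k c) * quoPoly T k x := fun x => by
        rw [map_mul]; congr 1; exact map_C _
      have hQr : (quoPoly T k r).Monic := n1.map _
      have hmod : quoPoly T k (nfPoly T k (r₀ %ₘ r)) =
          quoPoly T k r₀ - quoPoly T k (nfPoly T k (r₀ /ₘ r)) * quoPoly T k r := by
        rw [quoPoly_nfPoly hT hk, quoPoly_nfPoly hT hk, modByMonic_eq_sub_mul_div, map_sub, map_mul,
          mul_comm]
      refine ih _ _ _ _ _ _ ?_ ?_ ?_ (isReducedPoly_nfPoly hT hk _) ?_ (fun _ => ⟨n1, n2⟩) he ?_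
      · rw [n3, h₁, quoPoly_nfPoly hT hk, quoPoly_nfPoly hT hk, hC, hC]; ring
      · rw [hmod, quoPoly_nfPoly hT hk (s₀ - _), quoPoly_nfPoly hT hk (t₀ - _), map_sub, map_sub,
          map_mul, map_mul, quoPoly_nfPoly hT hk (C c * s₁), quoPoly_nfPoly hT hk (C c * t₁), hC, hC,
          n3, h₀, h₁]
        ring
      · rw [hmod, ← hs, n3]
        -- The leading coefficient of `r₁` undoes the normalization, so `r₁` is recovered from `r`.
        have hcc : C (quo T k c) * C (quo T k r₁.leadingCoeff) = 1 := by rw [← C_mul, hc', C_1]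
        apply le_antisymm <;> rw [Ideal.span_le] <;> rintro x (rfl | rfl) <;>
          refine Ideal.mem_span_pair.2 ?_
        · exact ⟨0, C (quo T k c), by ring⟩
        · exact ⟨1, -(quoPoly T k (nfPoly T k (r₀ /ₘ r)) * C (quo T k c)), by ring⟩
        · exact ⟨quoPoly T k (nfPoly T k (r₀ /ₘ r)), 1, by ring⟩
        · exact ⟨C (quo T k r₁.leadingCoeff), 0, by linear_combination (quoPoly T k r₁) * hcc⟩
      · refine (degree_nfPoly_le hT hk _).trans_lt ?_
        have h1 := (degree_modByMonic_lt r₀ n1)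
        rw [n4, degree_eq_natDegree h] at h1
        rw [degree_eq_natDegree h] at hm
        refine h1.trans_le ?_
        have : r₁.natDegree < m + 1 := by exact_mod_cast hm
        exact_mod_cast Nat.lt_succ_iff.1 this
      · intro h0 hh
        refine ⟨?_, ?_, by rw [hh]; exact n1, by rw [hh]; exact n2⟩
        · rw [hh, n3, h₁, quoPoly_nfPoly hT hk, quoPoly_nfPoly hT hk, hC, hC]; ring
        · rw [h0, map_zero] at hmod
          rw [hh, ← hs, n3]
          have hcc : C (quo T k c) * C (quo T k r₁.leadingCoeff) = 1 := by rw [← C_mul, hc', C_1]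
          apply le_antisymm <;> rw [Ideal.span_le]
          · rintro x rfl
            exact Ideal.mem_span_pair.2 ⟨0, C (quo T k c), by ring⟩
          · rintro x (rfl | rfl) <;> refine Ideal.mem_span_singleton.2 ?_
            · exact ⟨quoPoly T k (nfPoly T k (r₀ /ₘ r)), by linear_combination -hmod + quoPoly T k (nfPoly T k (r₀ /ₘ r)) * n3⟩
            · exact ⟨C (quo T k r₁.leadingCoeff), by linear_combination -(quoPoly T k r₁) * hcc⟩

/-- An error can only come from inverting the leading coefficient of a nonzero reduced remainder, so
any property of the errors of `inv` on such elements is inherited. -/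
theorem euclidLoop_error (hT : IsTri T n) (hk : k ≤ n) {V : ZeroDiv F → Prop}
    (hinv : ∀ u z, IsReduced (mainDeg T) k u → u ≠ 0 → inv u = .error z → V z)
    (m : ℕ) (r₀ s₀ t₀ r₁ s₁ t₁ : (IterPoly F k)[X]) (z : ZeroDiv F)
    (hr : IsReducedPoly (mainDeg T) k r₁)
    (he : euclidLoop T k inv m r₀ s₀ t₀ r₁ s₁ t₁ = .error z) : V z := by
  induction m generalizing r₀ s₀ t₀ r₁ s₁ t₁ with
  | zero => cases he
  | succ m ih =>
    rw [euclidLoop] at he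
    split_ifs at he with h
    cases hc : inv r₁.leadingCoeff with
    | error z' =>
      simp only [hc, Except.error.injEq] at he
      exact he ▸ hinv _ z' (hr _) (leadingCoeff_ne_zero.2 h) hc
    | ok c =>
      simp only [hc] at he
      exact ih _ _ _ _ _ _ (isReducedPoly_nfPoly hT hk _) he

theorem monicEuclid_spec (hT : IsTri T n) (hk : k ≤ n)
    (hinv : ∀ u c, IsReduced (mainDeg T) k u → u ≠ 0 → inv u = .ok c → quo T k c * quo T k u = 1)
    (a b : (IterPoly F k)[X]) (e : Bezout F k) (ha : IsReducedPoly (mainDeg T) k a)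
    (hb : IsReducedPoly (mainDeg T) k b) (hab : ¬ (a = 0 ∧ b = 0))
    (he : monicEuclid T k inv a b = .ok e) : IsBezout T k a b e := by
  rw [monicEuclid] at he
  split_ifs at he with h h'
  · exact absurd ⟨h', h⟩ hab
  · cases hc : inv a.leadingCoeff with
    | error z => simp [hc] at he
    | ok c =>
      simp only [hc, Except.ok.injEq] at he
      have hc' := hinv _ c (ha _) (leadingCoeff_ne_zero.2 h') hc
      obtain ⟨n1, n2, n3, n4⟩ := normalize_spec hT hk ha hc'
      subst he
      subst h
      refine ⟨?_, ?_, n1, n2⟩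
      · change quoPoly T k (nfPoly T k (C c * a)) = quoPoly T k (C c) * _ + _
        rw [n3, map_zero, mul_zero, add_zero]
        congr 1
        exact (map_C _).symm
      · change Ideal.span {quoPoly T k (nfPoly T k (C c * a))} = _
        rw [n3, map_zero, Ideal.span_pair_zero, mul_comm]
        refine Ideal.span_singleton_mul_right_unit ?_ _
        exact (IsUnit.of_mul_eq_one _ hc').map C
  · refine euclidLoop_spec hT hk hinv a b _ _ _ _ _ _ _ e ?_ ?_ rfl hb ?_ (fun hh => absurd hh h) he
    · simp
    · simp
    · rw [degree_eq_natDegree h]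
      exact_mod_cast Nat.lt_succ_self _

theorem monicEuclid_error (hT : IsTri T n) (hk : k ≤ n) {V : ZeroDiv F → Prop}
    (hinv : ∀ u z, IsReduced (mainDeg T) k u → u ≠ 0 → inv u = .error z → V z)
    (a b : (IterPoly F k)[X]) (z : ZeroDiv F) (ha : IsReducedPoly (mainDeg T) k a)
    (hb : IsReducedPoly (mainDeg T) k b)
    (he : monicEuclid T k inv a b = .error z) : V z := by
  rw [monicEuclid] at he
  split_ifs at he with h h'
  · cases hc : inv a.leadingCoeff with
    | error z' =>
      simp only [hc, Except.error.injEq] at he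
      exact he ▸ hinv _ z' (ha _) (leadingCoeff_ne_zero.2 h') hc
    | ok c => simp [hc] at he
  · exact euclidLoop_error hT hk hinv _ _ _ _ _ _ _ z hb he

end loop

/-! ### Inversion, gcd and radicality test over a field -/

section field

variable {F : Type} [Field F] {T : TriSet F} {n k : ℕ}

theorem inverse_succ (T : TriSet F) (k : ℕ) (u : (IterPoly F k)[X]) :
    inverse T (k + 1) u = match monicEuclid T k (inverse T k) (T k) u with
      | .error z => .error z
      | .ok e => if e.g = 1 then .ok e.t else .error ⟨k, e.g⟩ := rfl

/-- Success and failure are treated in one induction, as the gcd one level up needs both below. If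
`g = 1`, the Bézout relation modulo `t_k` gives the inverse. If not, the monic `g` has positive
degree, and it divides the nonzero `u`, whose degree is below that of `t_k`; hence it is a proper
factor. -/
theorem inverse_spec (hT : IsTri T n) (hk : k ≤ n) (u : IterPoly F k)
    (hu : IsReduced (mainDeg T) k u) (h0 : u ≠ 0) :
    (∀ c, inverse T k u = .ok c → quo T k c * quo T k u = 1) ∧
      ∀ z, inverse T k u = .error z → z.IsValid T k := by
  induction k with
  | zero =>
    change F at u
    refine ⟨fun c hc => ?_, fun z hz => by cases hz⟩
    have hc : (u⁻¹ : F) = c := Except.ok.inj hc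
    subst hc
    exact (congrArg (quo T 0) (inv_mul_cancel₀ (G₀ := F) h0)).trans (map_one (quo T 0))
  | succ k ih =>
    change (IterPoly F k)[X] at u
    have ih := ih (by omega)
    obtain ⟨hm, hpos, hred⟩ := hT k (by omega)
    obtain ⟨hdeg, hu⟩ := (isReduced_succ_iff u).1 hu
    have hk' : k ≤ n := by omega
    have hne : T k ≠ 0 := hm.ne_zero
    rw [inverse_succ]
    cases he : monicEuclid T k (inverse T k) (T k) u with
    | error z =>
      refine ⟨fun c hc => by simp at hc, fun z' hz => ?_⟩
      simp only [Except.error.injEq] at hz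
      subst hz
      exact (monicEuclid_error (V := fun z => z.IsValid T k) hT hk'
        (fun u z h1 h2 => (ih u h1 h2).2 z) _ _ _ hred hu he).mono (by omega)
    | ok e =>
      have hB := monicEuclid_spec hT hk' (fun u c h1 h2 => (ih u h1 h2).1 c) _ _ e hred hu
        (fun h => hne h.1) he
      dsimp only
      split_ifs with hg
      · refine ⟨fun c hc => ?_, fun z hz => by cases hz⟩
        have hc : e.t = c := Except.ok.inj hc
        subst hc
        refine (Ideal.Quotient.eq (I := triIdeal T (k + 1)) (x := e.t * u)
          (y := (1 : (IterPoly F k)[X]))).2 ((mem_triIdeal_succ T k (e.t * u - 1)).2 ?_)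
        have := hB.comb
        rw [hg, map_one] at this
        exact ⟨- quoPoly T k e.s, by rw [map_sub, map_mul, map_one, this]; ring⟩
      · refine ⟨fun c hc => (by cases hc), fun z hz => ?_⟩
        have hz : (⟨k, e.g⟩ : ZeroDiv F) = z := Except.error.inj hz
        subst hz
        refine ⟨Nat.lt_succ_self k, hB.monic, hB.reduced, ?_, ?_, hB.dvd_left⟩
        · by_contra h
          exact hg (hB.monic.natDegree_eq_zero.1 (by simpa using h))
        · have hmon : (quoPoly T k e.g).Monic := hB.monic.map _
          by_contra hlt
          have hQu : quoPoly T k u ≠ 0 := fun h => h0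
            (eq_of_quoPoly_eq hT hk' hu isReducedPoly_zero (h.trans (map_zero _).symm))
          refine hmon.not_dvd_of_degree_lt hQu ?_ hB.dvd_right
          rw [degree_quoPoly hT hk' hu, degree_quoPoly hT hk' hB.reduced]
          refine hdeg.trans_le ?_
          rw [degree_eq_natDegree hB.monic.ne_zero]
          exact_mod_cast not_lt.1 hlt

theorem monicExtGcd_spec (hT : IsTri T n) (hk : k ≤ n) {a b : (IterPoly F k)[X]} {e : Bezout F k}
    (ha : IsReducedPoly (mainDeg T) k a) (hb : IsReducedPoly (mainDeg T) k b)
    (hab : ¬ (a = 0 ∧ b = 0)) (he : monicExtGcd T k a b = .ok e) : IsBezout T k a b e :=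
  monicEuclid_spec hT hk (fun u c h1 h2 => (inverse_spec hT hk u h1 h2).1 c) a b e ha hb hab he

theorem monicExtGcd_isUnit (hT : IsTri T n) (hk : k ≤ n) {a b : (IterPoly F k)[X]}
    {e : Bezout F k}
    (ha : IsReducedPoly (mainDeg T) k a) (hb : IsReducedPoly (mainDeg T) k b)
    (hab : ¬ (a = 0 ∧ b = 0)) (he : monicExtGcd T k a b = .ok e) :
    IsUnit (quo T k (if b = 0 then a else b).leadingCoeff) :=
  monicEuclid_isUnit (fun u c h1 h2 => (inverse_spec hT hk u h1 h2).1 c) a b e ha hb hab he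

theorem monicExtGcd_error (hT : IsTri T n) (hk : k ≤ n) {a b : (IterPoly F k)[X]} {z : ZeroDiv F}
    (ha : IsReducedPoly (mainDeg T) k a) (hb : IsReducedPoly (mainDeg T) k b)
    (he : monicExtGcd T k a b = .error z) : z.IsValid T k :=
  monicEuclid_error (V := fun z => z.IsValid T k) hT hk
    (fun u z h1 h2 => (inverse_spec hT hk u h1 h2).2 z) a b z ha hb he

theorem isRadical_error (hT : IsTri T n) {m : ℕ} (hm : m ≤ n) {z : ZeroDiv F}
    (he : isRadical T m = .error z) : z.IsValid T m := by
  induction m generalizing z with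
  | zero => cases he
  | succ m ih =>
    rw [isRadical] at he
    cases h : isRadical T m with
    | error z' =>
      simp only [h, Except.error.injEq] at he
      exact he ▸ (ih (by omega) h).mono (by omega)
    | ok b =>
      cases b
      · simp [h] at he
      · simp only [h] at he
        cases hg : monicExtGcd T m (T m) (derivative (T m)) with
        | error z' =>
          simp only [hg, Except.error.injEq] at he
          have hr := (hT m (by omega)).2.2
          exact he ▸ (monicExtGcd_error hT (by omega) hr (isReducedPoly_derivative hr) hg).mono
            (by omega)
        | ok e => simp [hg] at he

/-- A monic generator of the unit ideal is `1`. -/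
theorem IsBezout.eq_one (hT : IsTri T n) (hk : k ≤ n) {a b : (IterPoly F k)[X]} {e : Bezout F k}
    (h : IsBezout T k a b e) (hco : IsCoprime (quoPoly T k a) (quoPoly T k b)) : e.g = 1 := by
  refine eq_of_quoPoly_eq hT hk h.reduced (hT.isReducedPoly_one hk) ?_
  rw [map_one]
  have hmon : (quoPoly T k e.g).Monic := h.monic.map _
  refine hmon.eq_one_of_isUnit ?_
  rw [← Ideal.span_singleton_eq_top, h.span, Ideal.eq_top_iff_one]
  exact Ideal.mem_span_pair.2 hco

/-- Separability of `t_m` over `R_m` is coprimality with its derivative, so each gcd that is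
computed is `1`. Applied over `ℚ`, this leaves only success or a zero-divisor. -/
theorem isRadical_eq_true (hT : IsTri T n) (hsep : ∀ i < n, (quoPoly T i (T i)).Separable)
    {m : ℕ} (hm : m ≤ n) {b : Bool} (he : isRadical T m = .ok b) : b = true := by
  induction m generalizing b with
  | zero => exact (Except.ok.inj he).symm
  | succ m ih =>
    rw [isRadical] at he
    cases h : isRadical T m with
    | error z' => simp [h] at he
    | ok b' =>
      obtain rfl := ih (by omega) h
      simp only [h] at he
      cases hg : monicExtGcd T m (T m) (derivative (T m)) with
      | error z' => simp [hg] at he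
      | ok e =>
        simp only [hg, Except.ok.injEq] at he
        have hr := (hT m (by omega)).2.2
        rw [← he, decide_eq_true_iff]
        refine (monicExtGcd_spec hT (by omega) hr (isReducedPoly_derivative hr)
          (fun h => (hT m (by omega)).1.ne_zero h.1) hg).eq_one hT (by omega) ?_
        have := hsep m (by omega)
        rw [separable_def] at this
        have hd : derivative (quoPoly T m (T m)) = quoPoly T m (derivative (T m)) :=
          derivative_map _ _
        rwa [hd] at this

end field

/-! ### Functoriality -/

section functoriality

variable {A B : Type} [CommRing A] [CommRing B]

theorem nf_zero' (T : TriSet A) (k : ℕ) : nf T k 0 = 0 := by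
  cases k with
  | zero => rfl
  | succ k =>
    change mapCoeffs (nf T k) ((0 : (IterPoly A k)[X]) %ₘ T k) = 0
    rw [zero_modByMonic, mapCoeffs, sum_zero_index]

/-- Division by a monic polynomial commutes with ring homomorphisms. It is applied to `pInt p → ℚ`
and to `pInt p → ZMod p`: reduction modulo `p` is not a map on `ℚ`, so every comparison passes
through `pInt p`. -/
theorem mapHom_nf (φ : A →+* B) (T : TriSet A) (S : TriSet B) (k : ℕ)
    (hT : ∀ i < k, (T i).Monic) (hS : ∀ i < k, S i = (T i).map (mapHom φ i)) (a : IterPoly A k) :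
    mapHom φ k (nf T k a) = nf S k (mapHom φ k a) := by
  induction k with
  | zero => rfl
  | succ k ih =>
    change (IterPoly A k)[X] at a
    have ih := ih (fun i hi => hT i (by omega)) (fun i hi => hS i (by omega))
    change (mapCoeffs (nf T k) (a %ₘ T k)).map (mapHom φ k) =
      mapCoeffs (nf S k) (a.map (mapHom φ k) %ₘ S k)
    ext i
    rw [coeff_map, mapCoeffs_coeff _ (nf_zero' T k), mapCoeffs_coeff _ (nf_zero' S k), ih,
      hS k (Nat.lt_succ_self k), ← map_modByMonic _ (hT k (Nat.lt_succ_self k)), coeff_map]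

theorem map_nfPoly (φ : A →+* B) (T : TriSet A) (S : TriSet B) (k : ℕ)
    (hT : ∀ i < k, (T i).Monic) (hS : ∀ i < k, S i = (T i).map (mapHom φ i))
    (a : (IterPoly A k)[X]) :
    (nfPoly T k a).map (mapHom φ k) = nfPoly S k (a.map (mapHom φ k)) := by
  ext i
  rw [coeff_map, nfPoly, nfPoly, mapCoeffs_coeff _ (nf_zero' T k), mapCoeffs_coeff _ (nf_zero' S k),
    mapHom_nf φ T S k hT hS, coeff_map]

/-- Apply a function to every base coefficient of a triangular set. -/
def mapTri (f : A → B) (T : TriSet A) : TriSet B := fun i => mapPoly f i (T i)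

theorem IsReduced.congr {d d' : ℕ → ℕ} {k : ℕ} (h : ∀ j < k, d j = d' j) {a : IterPoly A k}
    (ha : IsReduced d k a) : IsReduced d' k a :=
  fun e he j hj => h j hj ▸ ha e he j hj

theorem IsReducedPoly.congr {d d' : ℕ → ℕ} {k : ℕ} (h : ∀ j < k, d j = d' j)
    {a : (IterPoly A k)[X]} (ha : IsReducedPoly d k a) : IsReducedPoly d' k a :=
  fun i => (ha i).congr h

variable [Nontrivial B] {f : A → B} {T : TriSet A} {n : ℕ}

theorem mainDeg_mapTri (hf : f 0 = 0) (h1 : f 1 = 1) (hT : IsTri T n) {i : ℕ} (hi : i < n) :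
    mainDeg (mapTri f T) i = mainDeg T i := (mapPoly_monic f hf h1 i (hT i hi).1).2

theorem IsTri.map (hf : f 0 = 0) (h1 : f 1 = 1) (hT : IsTri T n) : IsTri (mapTri f T) n := by
  intro i hi
  obtain ⟨a, b, c⟩ := hT i hi
  refine ⟨(mapPoly_monic f hf h1 i a).1, ?_, (c.mapPoly f hf).congr fun j hj => ?_⟩
  · exact lt_of_lt_of_eq b (mainDeg_mapTri hf h1 hT hi).symm
  · exact (mainDeg_mapTri hf h1 hT (by omega)).symm

theorem IsReducedPoly.mapTri (hf : f 0 = 0) (h1 : f 1 = 1) (hT : IsTri T n) {k : ℕ} (hk : k ≤ n)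
    {a : (IterPoly A k)[X]} (ha : IsReducedPoly (mainDeg T) k a) :
    IsReducedPoly (mainDeg (mapTri f T)) k (ModularCGcd.mapPoly f k a) :=
  (ha.mapPoly f hf).congr fun _ hj => (mainDeg_mapTri hf h1 hT (by omega)).symm

end functoriality

/-! ### Rational numbers that are integral at a prime -/

section integral

/-- The ring of rational numbers whose denominator is prime to `p`. -/
def pInt (p : ℕ) [hp : Fact p.Prime] : Subring ℚ where
  carrier := {q | ¬ p ∣ q.den}
  mul_mem' {a b} ha hb h := by
    rcases (hp.1.dvd_mul).1 (h.trans (Rat.mul_den_dvd a b)) with h | h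
    exacts [ha h, hb h]
  one_mem' h := hp.1.one_lt.ne' (Nat.dvd_one.1 (by simpa using h))
  add_mem' {a b} ha hb h := by
    rcases (hp.1.dvd_mul).1 (h.trans (Rat.add_den_dvd a b)) with h | h
    exacts [ha h, hb h]
  zero_mem' h := hp.1.one_lt.ne' (Nat.dvd_one.1 (by simpa using h))
  neg_mem' {a} ha h := ha (by simpa using h)

variable (p : ℕ) [hp : Fact p.Prime]

theorem mem_pInt (q : ℚ) : q ∈ pInt p ↔ ¬ p ∣ q.den := Iff.rfl

theorem redRat_eq_cast (q : ℚ) : redRat p q = (q : ZMod p) := (Rat.cast_def q).symm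

theorem redRat_zero : redRat p 0 = 0 := by simp [redRat]

theorem redRat_one : redRat p 1 = 1 := by simp [redRat]

/-- Reduction modulo `p` as a ring homomorphism. -/
def redHom : pInt p →+* ZMod p where
  toFun q := redRat p q
  map_one' := redRat_one p
  map_zero' := redRat_zero p
  map_mul' a b := by
    have ha : ((a : ℚ).den : ZMod p) ≠ 0 := fun h => a.2 ((ZMod.natCast_eq_zero_iff _ _).1 h)
    have hb : ((b : ℚ).den : ZMod p) ≠ 0 := fun h => b.2 ((ZMod.natCast_eq_zero_iff _ _).1 h)
    simp only [redRat_eq_cast, Subring.coe_mul]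
    exact Rat.cast_mul_of_ne_zero ha hb
  map_add' a b := by
    have ha : ((a : ℚ).den : ZMod p) ≠ 0 := fun h => a.2 ((ZMod.natCast_eq_zero_iff _ _).1 h)
    have hb : ((b : ℚ).den : ZMod p) ≠ 0 := fun h => b.2 ((ZMod.natCast_eq_zero_iff _ _).1 h)
    simp only [redRat_eq_cast, Subring.coe_add]
    exact Rat.cast_add_of_ne_zero ha hb

theorem redHom_apply (q : pInt p) : redHom p q = redRat p q := rfl

/-- The inverse of the inclusion, with junk value `0`. -/
def toPInt (q : ℚ) : pInt p := if h : q ∈ pInt p then ⟨q, h⟩ else 0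

theorem toPInt_zero : toPInt p 0 = 0 := by rw [toPInt, dif_pos (pInt p).zero_mem]; rfl

theorem toPInt_one : toPInt p 1 = 1 := by rw [toPInt, dif_pos (pInt p).one_mem]; rfl

theorem coe_toPInt {q : ℚ} (h : ¬ p ∣ q.den) : ((toPInt p q : pInt p) : ℚ) = q := by
  rw [toPInt, dif_pos ((mem_pInt p q).2 h)]

/-- The inclusion of `p`-integral recursive polynomials. -/
abbrev incl (k : ℕ) : IterPoly (pInt p) k →+* IterPoly ℚ k := mapHom (pInt p).subtype k

/-- Reduction modulo `p` of `p`-integral recursive polynomials. -/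
abbrev redI (k : ℕ) : IterPoly (pInt p) k →+* IterPoly (ZMod p) k := mapHom (redHom p) k

/-- All base coefficients are integral at `p`. -/
abbrev IsInt (k : ℕ) (a : (IterPoly ℚ k)[X]) : Prop := AllPoly (fun q : ℚ => ¬ p ∣ q.den) k a

variable {k : ℕ}

theorem mapBase_incl (a : IterPoly (pInt p) k) :
    mapBase (redRat p) k (incl p k a) = redI p k a := by
  rw [← mapBase_ringHom, ← mapBase_ringHom, mapBase_mapBase _ _ (map_zero _) (redRat_zero p)]
  rfl

theorem mapPoly_incl (a : (IterPoly (pInt p) k)[X]) :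
    mapPoly (redRat p) k (a.map (incl p k)) = a.map (redI p k) := by
  ext i
  rw [mapPoly_coeff _ (redRat_zero p), coeff_map, coeff_map, mapBase_incl]

theorem incl_toPInt {a : IterPoly ℚ k} (ha : AllBase (fun q : ℚ => ¬ p ∣ q.den) k a) :
    incl p k (mapBase (toPInt p) k a) = a := by
  refine baseCoeff_ext k _ _ fun e => ?_
  rw [baseCoeff_mapHom, baseCoeff_mapBase _ (toPInt_zero p)]
  exact coe_toPInt p ((allBase_iff _ k a).1 ha e)

theorem map_incl_toPInt {a : (IterPoly ℚ k)[X]} (ha : IsInt p k a) :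
    (mapPoly (toPInt p) k a).map (incl p k) = a := by
  ext i
  rw [coeff_map, mapPoly_coeff _ (toPInt_zero p), incl_toPInt p (ha i)]

theorem isInt_map_incl (a : (IterPoly (pInt p) k)[X]) : IsInt p k (a.map (incl p k)) := fun i => by
  rw [coeff_map, allBase_iff]
  intro e
  rw [baseCoeff_mapHom]
  exact (baseCoeff k (a.coeff i) e).2

/-- The triangular set over the `p`-integral rational numbers. -/
abbrev intTri (T : TriSet ℚ) : TriSet (pInt p) := mapTri (toPInt p) T

variable {T : TriSet ℚ} {n : ℕ}

theorem IsTri.intTri (hT : IsTri T n) : IsTri (intTri p T) n :=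
  hT.map (toPInt_zero p) (toPInt_one p)

theorem IsTri.redTri (hT : IsTri T n) : IsTri (redTri p T) n :=
  hT.map (redRat_zero p) (redRat_one p)

theorem map_incl_intTri (hint : ∀ i < n, IsInt p i (T i)) (i : ℕ) (hi : i < n) :
    T i = (intTri p T i).map (incl p i) := (map_incl_toPInt p (hint i hi)).symm

theorem map_redI_intTri (hint : ∀ i < n, IsInt p i (T i)) (i : ℕ) (hi : i < n) :
    redTri p T i = (intTri p T i).map (redI p i) := by
  rw [← mapPoly_incl, ← map_incl_intTri p hint i hi]
  rfl

theorem nfPoly_map_incl (hT : IsTri T n) (hint : ∀ i < n, IsInt p i (T i)) (hk : k ≤ n)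
    (a : (IterPoly (pInt p) k)[X]) :
    nfPoly T k (a.map (incl p k)) = (nfPoly (intTri p T) k a).map (incl p k) :=
  (map_nfPoly _ _ _ k (fun i hi => (hT.intTri p i (by omega)).1)
    (fun i hi => map_incl_intTri p hint i (by omega)) a).symm

theorem nfPoly_map_redI (hT : IsTri T n) (hint : ∀ i < n, IsInt p i (T i)) (hk : k ≤ n)
    (a : (IterPoly (pInt p) k)[X]) :
    nfPoly (redTri p T) k (a.map (redI p k)) = (nfPoly (intTri p T) k a).map (redI p k) :=
  (map_nfPoly _ _ _ k (fun i hi => (hT.intTri p i (by omega)).1)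
    (fun i hi => map_redI_intTri p hint i (by omega)) a).symm

end integral

/-! ### Reduction modulo all but finitely many primes -/

instance instFactPrimes (p : Nat.Primes) : Fact (p : ℕ).Prime := ⟨p.2⟩

section cofinite

/-- Reduction modulo `p` of the base coefficients. -/
abbrev red (p : ℕ) [Fact p.Prime] (k : ℕ) : IterPoly ℚ k → IterPoly (ZMod p) k := mapBase (redRat p) k

/-- Reduction modulo `p` of the base coefficients. -/
abbrev redPoly (p : ℕ) [Fact p.Prime] (k : ℕ) : (IterPoly ℚ k)[X] → (IterPoly (ZMod p) k)[X] :=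
  mapPoly (redRat p) k

theorem redPoly_map_incl (p : ℕ) [Fact p.Prime] {k : ℕ} (a : (IterPoly (pInt p) k)[X]) :
    redPoly p k (a.map (incl p k)) = a.map (redI p k) := mapPoly_incl p a

theorem eventually_not_dvd {m : ℕ} (hm : m ≠ 0) : ∀ᶠ p : Nat.Primes in cofinite, ¬ (p : ℕ) ∣ m := by
  rw [eventually_cofinite]
  refine ((Set.finite_Iic m).preimage (f := fun p : Nat.Primes => (p : ℕ))
    Subtype.val_injective.injOn).subset fun p hp => ?_
  exact Nat.le_of_dvd (Nat.pos_of_ne_zero hm) (by simpa using hp)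

/-- A polynomial has finitely many nonzero base coefficients. The filter is arbitrary because the
lemma serves both for almost all primes and for all large moduli. -/
theorem eventually_allBase {ι A : Type} [CommRing A] {l : Filter ι} {Q : ι → A → Prop}
    (h0 : ∀ i, Q i 0) (hQ : ∀ x, ∀ᶠ i in l, Q i x) (k : ℕ) (a : IterPoly A k) :
    ∀ᶠ i in l, AllBase (Q i) k a := by
  induction k with
  | zero => exact hQ a
  | succ k ih =>
    change (IterPoly A k)[X] at a
    have := (Filter.eventually_all_finset (l := l) (p := fun j i => AllBase (Q i) k (a.coeff j))
      a.support).2 fun j _ => ih _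
    filter_upwards [this] with i hi j
    by_cases hj : j ∈ a.support
    · exact hi j hj
    · rw [notMem_support_iff.1 hj, allBase_iff]
      intro e
      rw [baseCoeff_zero]
      exact h0 i

theorem eventually_isInt {k : ℕ} (a : (IterPoly ℚ k)[X]) :
    ∀ᶠ p : Nat.Primes in cofinite, IsInt p k a :=
  eventually_allBase (Q := fun (p : Nat.Primes) (q : ℚ) => ¬ (p : ℕ) ∣ q.den)
    (fun p => (pInt p).zero_mem) (fun q => eventually_not_dvd q.den_ne_zero) (k + 1) a

theorem eventually_isInt_tri (T : TriSet ℚ) (n : ℕ) :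
    ∀ᶠ p : Nat.Primes in cofinite, ∀ i < n, IsInt p i (T i) := by
  have := (Filter.eventually_all_finset (l := cofinite)
    (p := fun i (p : Nat.Primes) => IsInt p i (T i)) (Finset.range n)).2
    fun i _ => eventually_isInt (T i)
  filter_upwards [this] with p hp i hi using hp i (Finset.mem_range.2 hi)

/-- It is enough to avoid the denominators and the numerator of `x - y`. This is why every nonzero
test over `ℚ` has the same answer modulo almost all primes. -/
theorem eventually_redRat_ne {x y : ℚ} (h : x ≠ y) :
    ∀ᶠ p : Nat.Primes in cofinite, redRat p x ≠ redRat p y := by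
  filter_upwards [eventually_not_dvd x.den_ne_zero, eventually_not_dvd y.den_ne_zero,
    eventually_not_dvd (Int.natAbs_ne_zero.2 (Rat.num_ne_zero.2 (sub_ne_zero.2 h))),
    eventually_not_dvd (x - y).den_ne_zero] with p hx hy hn hd he
  have h1 : redHom p (⟨x, hx⟩ - ⟨y, hy⟩ : pInt p) = 0 := by
    rw [map_sub]; exact sub_eq_zero.2 he
  have h2 : redRat p (x - y) = 0 := h1
  rw [redRat, div_eq_zero_iff, ZMod.intCast_zmod_eq_zero_iff_dvd, ZMod.natCast_eq_zero_iff] at h2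
  exact h2.elim (fun h => hn (Int.natCast_dvd.1 h)) hd

theorem eventually_red_ne {k : ℕ} {x y : IterPoly ℚ k} (h : x ≠ y) :
    ∀ᶠ p : Nat.Primes in cofinite, red p k x ≠ red p k y := by
  have : ∃ e, baseCoeff k x e ≠ baseCoeff k y e := by
    by_contra! hall
    exact h (baseCoeff_ext k _ _ hall)
  obtain ⟨e, he⟩ := this
  filter_upwards [eventually_redRat_ne he] with p hp heq
  refine hp ?_
  rw [← baseCoeff_mapBase _ (redRat_zero p), ← baseCoeff_mapBase _ (redRat_zero p)]
  exact congrArg (baseCoeff k · e) heq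

theorem red_zero (p : ℕ) [Fact p.Prime] (k : ℕ) : red p k 0 = 0 := mapBase_zero _ (redRat_zero p) k

theorem red_one (p : ℕ) [Fact p.Prime] (k : ℕ) : red p k 1 = 1 :=
  mapBase_one _ (redRat_zero p) (redRat_one p) k

theorem coeff_redPoly (p : ℕ) [Fact p.Prime] {k : ℕ} (a : (IterPoly ℚ k)[X]) (i : ℕ) :
    (redPoly p k a).coeff i = red p k (a.coeff i) := mapPoly_coeff _ (redRat_zero p) k a i

theorem redPoly_C (p : ℕ) [Fact p.Prime] {k : ℕ} (c : IterPoly ℚ k) :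
    redPoly p k (C c) = C (red p k c) := by
  ext i
  rw [coeff_redPoly, coeff_C, coeff_C]
  split_ifs
  · rfl
  · exact red_zero p k

theorem redPoly_zero (p : ℕ) [Fact p.Prime] (k : ℕ) : redPoly p k 0 = 0 := by
  ext i
  rw [coeff_redPoly, coeff_zero, coeff_zero, red_zero]

theorem redPoly_one (p : ℕ) [Fact p.Prime] (k : ℕ) : redPoly p k 1 = 1 := by
  rw [← C_1, redPoly_C, red_one, C_1]

theorem natDegree_redPoly {p : ℕ} [Fact p.Prime] {k : ℕ} {a : (IterPoly ℚ k)[X]}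
    (h : red p k a.leadingCoeff ≠ 0) : (redPoly p k a).degree = a.degree ∧
      (redPoly p k a).natDegree = a.natDegree ∧
      (redPoly p k a).leadingCoeff = red p k a.leadingCoeff := by
  have hd : (redPoly p k a).degree = a.degree := by
    refine le_antisymm (degree_mapPoly_le _ (redRat_zero p) k a) ?_
    by_cases ha : a = 0
    · subst ha; rw [degree_zero]; exact bot_le
    · rw [degree_eq_natDegree ha]
      exact le_degree_of_ne_zero (by rwa [coeff_redPoly])
  have hn := natDegree_eq_natDegree hd
  exact ⟨hd, hn, by rw [leadingCoeff, hn, coeff_redPoly, leadingCoeff]⟩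

theorem eventually_natDegree_redPoly {k : ℕ} (a : (IterPoly ℚ k)[X]) :
    ∀ᶠ p : Nat.Primes in cofinite, (redPoly p k a).degree = a.degree ∧
      (redPoly p k a).natDegree = a.natDegree ∧
      (redPoly p k a).leadingCoeff = red p k a.leadingCoeff := by
  by_cases ha : a = 0
  · refine Eventually.of_forall fun p => ?_
    subst ha
    rw [redPoly_zero, leadingCoeff_zero, leadingCoeff_zero, red_zero]
    exact ⟨rfl, rfl, rfl⟩
  · filter_upwards [eventually_red_ne (leadingCoeff_ne_zero.2 ha)] with p hp
    exact natDegree_redPoly (by rwa [red_zero] at hp)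

theorem redPoly_eq_zero {p : ℕ} [Fact p.Prime] {k : ℕ} {a : (IterPoly ℚ k)[X]}
    (h : (redPoly p k a).degree = a.degree) : redPoly p k a = 0 ↔ a = 0 := by
  rw [← degree_eq_bot, h, degree_eq_bot]

theorem eventually_redPoly_mul {k : ℕ} (a b : (IterPoly ℚ k)[X]) :
    ∀ᶠ p : Nat.Primes in cofinite, redPoly p k (a * b) = redPoly p k a * redPoly p k b := by
  filter_upwards [eventually_isInt a, eventually_isInt b] with p ha hb
  rw [← map_incl_toPInt p ha, ← map_incl_toPInt p hb, ← Polynomial.map_mul,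
    redPoly_map_incl, redPoly_map_incl, redPoly_map_incl, Polynomial.map_mul]

theorem eventually_redPoly_sub {k : ℕ} (a b : (IterPoly ℚ k)[X]) :
    ∀ᶠ p : Nat.Primes in cofinite, redPoly p k (a - b) = redPoly p k a - redPoly p k b := by
  filter_upwards [eventually_isInt a, eventually_isInt b] with p ha hb
  rw [← map_incl_toPInt p ha, ← map_incl_toPInt p hb, ← Polynomial.map_sub,
    redPoly_map_incl, redPoly_map_incl, redPoly_map_incl, Polynomial.map_sub]

/-- No monicity is assumed, so the comparison of runs needs no correctness statement for the
algorithm. -/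
theorem eventually_redPoly_divModByMonic {k : ℕ} (a b : (IterPoly ℚ k)[X]) :
    ∀ᶠ p : Nat.Primes in cofinite, redPoly p k (a /ₘ b) = redPoly p k a /ₘ redPoly p k b ∧
      redPoly p k (a %ₘ b) = redPoly p k a %ₘ redPoly p k b := by
  by_cases hm : b.Monic
  · filter_upwards [eventually_isInt a, eventually_isInt b] with p ha hb
    have hm' : (mapPoly (toPInt p) k b).Monic :=
      (mapPoly_monic _ (toPInt_zero p) (toPInt_one p) k hm).1
    conv_lhs => rw [← map_incl_toPInt p ha, ← map_incl_toPInt p hb, ← map_divByMonic _ hm']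
    conv_rhs => rw [← map_incl_toPInt p ha, ← map_incl_toPInt p hb, ← map_modByMonic _ hm']
    simp only [mapPoly_incl]
    rw [map_divByMonic _ hm', map_modByMonic _ hm', ← mapPoly_incl, ← mapPoly_incl,
      map_incl_toPInt p ha, map_incl_toPInt p hb]
    exact ⟨rfl, rfl⟩
  -- By convention a divisor that is not monic gives quotient `0` and remainder `a`; almost all
  -- reductions of `b` are not monic either.
  · filter_upwards [eventually_natDegree_redPoly b, eventually_red_ne hm] with p h1 h2
    have h3 : ¬ (redPoly p k b).Monic := by
      rw [Monic, h1.2.2]; rwa [red_one] at h2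
    rw [divByMonic_eq_of_not_monic _ hm, divByMonic_eq_of_not_monic _ h3,
      modByMonic_eq_of_not_monic _ hm, modByMonic_eq_of_not_monic _ h3, redPoly_zero]
    exact ⟨rfl, rfl⟩

theorem eventually_redPoly_nfPoly {T : TriSet ℚ} {n k : ℕ} (hT : IsTri T n) (hk : k ≤ n)
    (a : (IterPoly ℚ k)[X]) : ∀ᶠ p : Nat.Primes in cofinite,
      redPoly p k (nfPoly T k a) = nfPoly (redTri p T) k (redPoly p k a) := by
  filter_upwards [eventually_isInt a, eventually_isInt_tri T n] with p ha hint
  conv_lhs => rw [← map_incl_toPInt p ha, nfPoly_map_incl p hT hint hk, redPoly_map_incl]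
  conv_rhs => rw [← map_incl_toPInt p ha, redPoly_map_incl, nfPoly_map_redI p hT hint hk]

end cofinite

/-! ### Modular simulation of the Euclidean algorithm -/

section simulation

/-- Reduction modulo `p` of a reported zero-divisor. -/
def ZeroDiv.red (p : ℕ) [Fact p.Prime] (z : ZeroDiv ℚ) : ZeroDiv (ZMod p) :=
  ⟨z.level, redPoly p z.level z.poly⟩

/-- Reduction modulo `p` of a Bézout relation. -/
def Bezout.red (p : ℕ) [Fact p.Prime] {k : ℕ} (e : Bezout ℚ k) : Bezout (ZMod p) k :=
  ⟨redPoly p k e.g, redPoly p k e.s, redPoly p k e.t⟩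

/-- Reduction modulo `p` of a result. -/
def redExcept (p : ℕ) [Fact p.Prime] {α β : Type} (f : α → β) :
    Except (ZeroDiv ℚ) α → Except (ZeroDiv (ZMod p)) β
  | .error z => .error (z.red p)
  | .ok x => .ok (f x)

variable {T : TriSet ℚ} {n k : ℕ}

theorem eventually_redPoly_nfPoly_C_mul (hT : IsTri T n) (hk : k ≤ n) (c : IterPoly ℚ k)
    (a : (IterPoly ℚ k)[X]) : ∀ᶠ p : Nat.Primes in cofinite,
      redPoly p k (nfPoly T k (C c * a)) = nfPoly (redTri p T) k (C (red p k c) * redPoly p k a) := by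
  filter_upwards [eventually_redPoly_nfPoly hT hk (C c * a), eventually_redPoly_mul (C c) a]
    with p h1 h2
  rw [h1, h2, redPoly_C]

/-- One run over `ℚ` performs finitely many operations, each compatible with reduction modulo almost
all primes, and so is their conjunction. It suffices that `inv` is compatible for each fixed
argument, because each turn of that run inverts one element. -/
theorem eventually_euclidLoop (hT : IsTri T n) (hk : k ≤ n)
    {inv : IterPoly ℚ k → Except (ZeroDiv ℚ) (IterPoly ℚ k)}
    {inv' : (p : Nat.Primes) → IterPoly (ZMod p) k →
      Except (ZeroDiv (ZMod p)) (IterPoly (ZMod p) k)}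
    (hinv : ∀ u, ∀ᶠ p : Nat.Primes in cofinite,
      inv' p (red p k u) = redExcept p (red p k) (inv u))
    (m : ℕ) (r₀ s₀ t₀ r₁ s₁ t₁ : (IterPoly ℚ k)[X]) : ∀ᶠ p : Nat.Primes in cofinite,
      euclidLoop (redTri p T) k (inv' p) m (redPoly p k r₀) (redPoly p k s₀) (redPoly p k t₀)
        (redPoly p k r₁) (redPoly p k s₁) (redPoly p k t₁) =
      redExcept p (Bezout.red p) (euclidLoop T k inv m r₀ s₀ t₀ r₁ s₁ t₁) := by
  induction m generalizing r₀ s₀ t₀ r₁ s₁ t₁ with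
  | zero => exact Eventually.of_forall fun p => rfl
  | succ m ih =>
    by_cases h : r₁ = 0
    · refine Eventually.of_forall fun p => ?_
      rw [euclidLoop, euclidLoop, if_pos h, if_pos (by rw [h, redPoly_zero])]
      rfl
    cases hc : inv r₁.leadingCoeff with
    | error z =>
      filter_upwards [eventually_natDegree_redPoly r₁, hinv r₁.leadingCoeff] with p h1 h2
      have h3 := (redPoly_eq_zero h1.1).not.2 h
      rw [euclidLoop, euclidLoop, if_neg h, if_neg h3, h1.2.2, h2, hc]
      rfl
    | ok c =>
      set r := nfPoly T k (C c * r₁) with hr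
      set s := nfPoly T k (C c * s₁) with hs
      set t := nfPoly T k (C c * t₁) with ht
      set q := nfPoly T k (r₀ /ₘ r) with hq
      filter_upwards [eventually_natDegree_redPoly r₁, hinv r₁.leadingCoeff,
        eventually_redPoly_nfPoly_C_mul hT hk c r₁, eventually_redPoly_nfPoly_C_mul hT hk c s₁,
        eventually_redPoly_nfPoly_C_mul hT hk c t₁, eventually_redPoly_nfPoly hT hk (r₀ /ₘ r),
        eventually_redPoly_nfPoly hT hk (r₀ %ₘ r), eventually_redPoly_divModByMonic r₀ r,
        eventually_redPoly_nfPoly hT hk (s₀ - q * s), eventually_redPoly_nfPoly hT hk (t₀ - q * t),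
        eventually_redPoly_sub s₀ (q * s), eventually_redPoly_sub t₀ (q * t),
        eventually_redPoly_mul q s, eventually_redPoly_mul q t,
        ih r s t (nfPoly T k (r₀ %ₘ r)) (nfPoly T k (s₀ - q * s)) (nfPoly T k (t₀ - q * t))]
        with p h1 h2 e1 e2 e3 e4 e5 e6 e7 e8 e9 e10 e11 e12 h4
      have h3 := (redPoly_eq_zero h1.1).not.2 h
      rw [euclidLoop, euclidLoop, if_neg h, if_neg h3, h1.2.2, h2, hc]
      dsimp only [redExcept]
      rw [← hr, ← hs, ← ht, ← hq] at *
      rw [← e1, ← e2, ← e3, ← e6.1, ← e6.2, ← e4, ← e5, ← e11, ← e12, ← e9, ← e10, ← e7, ← e8]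
      exact h4

/-- The number of turns allowed depends on `natDegree b`, so that degree too must survive the
reduction. -/
theorem eventually_monicEuclid (hT : IsTri T n) (hk : k ≤ n)
    {inv : IterPoly ℚ k → Except (ZeroDiv ℚ) (IterPoly ℚ k)}
    {inv' : (p : Nat.Primes) → IterPoly (ZMod p) k →
      Except (ZeroDiv (ZMod p)) (IterPoly (ZMod p) k)}
    (hinv : ∀ u, ∀ᶠ p : Nat.Primes in cofinite,
      inv' p (red p k u) = redExcept p (red p k) (inv u))
    (a b : (IterPoly ℚ k)[X]) : ∀ᶠ p : Nat.Primes in cofinite,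
      monicEuclid (redTri p T) k (inv' p) (redPoly p k a) (redPoly p k b) =
      redExcept p (Bezout.red p) (monicEuclid T k inv a b) := by
  by_cases hb : b = 0
  · by_cases ha : a = 0
    · refine Eventually.of_forall fun p => ?_
      simp only [monicEuclid, hb, ha, redPoly_zero, if_true, redExcept, Bezout.red]
    · cases hc : inv a.leadingCoeff with
      | error z =>
        filter_upwards [eventually_natDegree_redPoly a, hinv a.leadingCoeff] with p h1 h2
        have h3 := (redPoly_eq_zero h1.1).not.2 ha
        rw [monicEuclid, monicEuclid, if_pos hb, if_neg ha, if_pos (by rw [hb, redPoly_zero]),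
          if_neg h3, h1.2.2, h2, hc]
        rfl
      | ok c =>
        filter_upwards [eventually_natDegree_redPoly a, hinv a.leadingCoeff,
          eventually_redPoly_nfPoly_C_mul hT hk c a] with p h1 h2 h4
        have h3 := (redPoly_eq_zero h1.1).not.2 ha
        rw [monicEuclid, monicEuclid, if_pos hb, if_neg ha, if_pos (by rw [hb, redPoly_zero]),
          if_neg h3, h1.2.2, h2, hc]
        simp only [redExcept, Bezout.red, h4, redPoly_C, redPoly_zero]
  · filter_upwards [eventually_natDegree_redPoly b,
      eventually_euclidLoop hT hk hinv (b.natDegree + 1) a 1 0 b 0 1] with p h1 h2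
    rw [monicEuclid, monicEuclid, if_neg hb, if_neg ((redPoly_eq_zero h1.1).not.2 hb), h1.2.1, ← h2,
      redPoly_one, redPoly_zero]

theorem eventually_redRat_inv (u : ℚ) :
    ∀ᶠ p : Nat.Primes in cofinite, redRat p u⁻¹ = (redRat p u)⁻¹ := by
  by_cases h : u = 0
  · exact Eventually.of_forall fun p => by rw [h, inv_zero, redRat_zero, inv_zero]
  · filter_upwards [eventually_not_dvd u.den_ne_zero, eventually_not_dvd u⁻¹.den_ne_zero]
      with p h1 h2
    refine eq_inv_of_mul_eq_one_left ?_
    have : redHom p ((⟨u⁻¹, h2⟩ : pInt p) * ⟨u, h1⟩) = redHom p 1 :=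
      congrArg _ (Subtype.ext (inv_mul_cancel₀ h))
    rwa [map_mul, map_one] at this

/-- The only new test is `e.g = 1`, stable for almost all primes; reported zero-divisors correspond
under reduction as well. -/
theorem eventually_inverse (hT : IsTri T n) (hk : k ≤ n) (u : IterPoly ℚ k) :
    ∀ᶠ p : Nat.Primes in cofinite,
      inverse (redTri p T) k (red p k u) = redExcept p (red p k) (inverse T k u) := by
  induction k with
  | zero =>
    filter_upwards [eventually_redRat_inv u] with p hp
    exact congrArg _ hp.symm
  | succ k ih =>
    change (IterPoly ℚ k)[X] at u
    have hE := eventually_monicEuclid hT (by omega : k ≤ n)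
      (inv := inverse T k) (inv' := fun p => inverse (redTri p T) k) (ih (by omega)) (T k) u
    have hinv := inverse_succ T k u
    have hinv' : ∀ p : Nat.Primes, inverse (redTri p T) (k + 1) (red p (k + 1) u) = _ :=
      fun p => inverse_succ (redTri p T) k (redPoly p k u)
    have hT' : ∀ p : Nat.Primes, redTri p T k = redPoly p k (T k) := fun p => rfl
    simp only [hinv', hinv, hT']
    cases he : monicEuclid T k (inverse T k) (T k) u with
    | error z =>
      filter_upwards [hE] with p hp
      rw [hp, he]
      rfl
    | ok e =>
      by_cases hg : e.g = 1
      · filter_upwards [hE] with p hp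
        rw [hp, he]
        dsimp only [redExcept]
        rw [if_pos hg, if_pos (by rw [Bezout.red, hg, redPoly_one])]
        rfl
      · have hne : ∀ᶠ p : Nat.Primes in cofinite, redPoly p k e.g ≠ redPoly p k 1 :=
          eventually_red_ne (k := k + 1) hg
        filter_upwards [hE, hne] with p hp hp'
        rw [hp, he]
        dsimp only [redExcept]
        rw [if_neg hg, if_neg (by rwa [redPoly_one] at hp')]
        rfl

theorem eventually_monicExtGcd (hT : IsTri T n) (hk : k ≤ n) (a b : (IterPoly ℚ k)[X]) :
    ∀ᶠ p : Nat.Primes in cofinite,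
      monicExtGcd (redTri p T) k (redPoly p k a) (redPoly p k b) =
      redExcept p (Bezout.red p) (monicExtGcd T k a b) :=
  eventually_monicEuclid hT hk (inv := inverse T k) (inv' := fun p => inverse (redTri p T) k)
    (eventually_inverse hT hk) a b

theorem eventually_redPoly_derivative (a : (IterPoly ℚ k)[X]) :
    ∀ᶠ p : Nat.Primes in cofinite, redPoly p k (derivative a) = derivative (redPoly p k a) := by
  filter_upwards [eventually_isInt a] with p ha
  conv_lhs => rw [← map_incl_toPInt p ha, derivative_map, redPoly_map_incl, ← derivative_map,
    ← redPoly_map_incl, map_incl_toPInt p ha]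

theorem eventually_isRadical (hT : IsTri T n) {m : ℕ} (hm : m ≤ n) :
    ∀ᶠ p : Nat.Primes in cofinite,
      isRadical (redTri p T) m = redExcept p id (isRadical T m) := by
  induction m with
  | zero => exact Eventually.of_forall fun p => rfl
  | succ m ih =>
    have hg := eventually_monicExtGcd hT (by omega : m ≤ n) (T m) (derivative (T m))
    have hd := eventually_redPoly_derivative (T m)
    have hne : ∀ e : Bezout ℚ m,
        ∀ᶠ p : Nat.Primes in cofinite, (redPoly p m e.g = 1 ↔ e.g = 1) := fun e => by
      by_cases he : e.g = 1
      · exact Eventually.of_forall fun p => by rw [he, redPoly_one]; exact iff_of_true rfl rfl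
      · have : ∀ᶠ p : Nat.Primes in cofinite, redPoly p m e.g ≠ redPoly p m 1 :=
          eventually_red_ne (k := m + 1) he
        filter_upwards [this] with p hp
        rw [redPoly_one] at hp
        exact iff_of_false hp he
    cases h : isRadical T m with
    | error z =>
      filter_upwards [ih (by omega)] with p h1
      rw [isRadical, isRadical, h1, h]
      rfl
    | ok b =>
      cases b with
      | false =>
        filter_upwards [ih (by omega)] with p h1
        rw [isRadical, isRadical, h1, h]
        rfl
      | true =>
        cases h' : monicExtGcd T m (T m) (derivative (T m)) with
        | error z =>
          filter_upwards [ih (by omega), hg, hd] with p h1 h2 h3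
          rw [h3, h'] at h2
          rw [isRadical, isRadical, h1, h]
          dsimp only [redExcept, id]
          rw [h']
          erw [h2]
          rfl
        | ok e =>
          filter_upwards [ih (by omega), hg, hd, hne e] with p h1 h2 h3 h4
          rw [h3, h'] at h2
          rw [isRadical, isRadical, h1, h]
          dsimp only [redExcept, id]
          rw [h']
          erw [h2]
          dsimp only [redExcept, Bezout.red]
          simp only [h4]

end simulation

/-! ### Integrality of the quotient -/

section integrality

variable {A : Type} [CommRing A]

/-- The map `R_k → R_{k+1}`. -/
def quoSucc (T : TriSet A) (k : ℕ) : TriQuot T k →+* TriQuot T (k + 1) :=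
  Ideal.Quotient.lift _ ((quo T (k + 1)).comp (C : IterPoly A k →+* (IterPoly A k)[X]))
    fun _ ha => Ideal.Quotient.eq_zero_iff_mem.2
      (Ideal.mem_sup_left (Ideal.mem_map_of_mem (C : IterPoly A k →+* (IterPoly A k)[X]) ha))

theorem quoSucc_comp (T : TriSet A) (k : ℕ) : (quoSucc T k).comp (quo T k) =
    (quo T (k + 1)).comp (C : IterPoly A k →+* (IterPoly A k)[X]) := by
  ext x
  rfl

/-- `R_{k+1}` is generated over `R_k` by the class of `z_k`, a root of the monic `t_k`. -/
theorem isIntegral_quoSucc (T : TriSet A) (k : ℕ) (hT : (T k).Monic) :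
    (quoSucc T k).IsIntegral := by
  intro x
  let π : (IterPoly A k)[X] →+* TriQuot T (k + 1) := quo T (k + 1)
  obtain ⟨q, hq⟩ : ∃ q : IterPoly A (k + 1), quo T (k + 1) q = x := Ideal.Quotient.mk_surjective x
  change (IterPoly A k)[X] at q
  change π q = x at hq
  subst hq
  have hX : (quoSucc T k).IsIntegralElem (π X) := by
    refine ⟨(T k).map (quo T k), hT.map _, ?_⟩
    rw [eval₂_map, quoSucc_comp]
    change eval₂ (π.comp C) (π X) (T k) = 0
    rw [← hom_eval₂, eval₂_C_X]
    exact (Ideal.Quotient.eq_zero_iff_mem (R := IterPoly A (k + 1)) (I := triIdeal T (k + 1))).2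
      (Ideal.mem_sup_right (Ideal.subset_span (Set.mem_singleton (T k))))
  have hC : ∀ c, (quoSucc T k).IsIntegralElem (π (C c)) := fun c => by
    have : π (C c) = quoSucc T k (quo T k c) := rfl
    rw [this]
    exact RingHom.isIntegralElem_map _
  induction q using Polynomial.induction_on with
  | C c => exact hC c
  | add q r hq hr => rw [map_add]; exact hq.add _ hr
  | monomial m c h =>
    rw [pow_succ, ← mul_assoc, map_mul]
    exact h.mul _ hX

/-- The map `F → R_k`. -/
def quoConst (T : TriSet A) (k : ℕ) : A →+* TriQuot T k := (quo T k).comp (constHom A k)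

/-- Used twice: over `pInt p` it puts `p` into the Jacobson radical, and over `ℚ` it gives a
univariate polynomial that annihilates `z_k`. -/
theorem isIntegral_quoConst (T : TriSet A) (k : ℕ) (hT : ∀ i < k, (T i).Monic) :
    (quoConst T k).IsIntegral := by
  induction k with
  | zero =>
    intro x
    obtain ⟨y, rfl⟩ := Ideal.Quotient.mk_surjective x
    exact RingHom.isIntegralElem_map (quoConst T 0) (x := y)
  | succ k ih =>
    have : quoConst T (k + 1) = (quoSucc T k).comp (quoConst T k) := rfl
    rw [this]
    exact RingHom.IsIntegral.trans _ _ (ih fun i hi => hT i (by omega))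
      (isIntegral_quoSucc T k (hT k (by omega)))

end integrality

/-! ### The gcd modulo a prime that is not bad -/

section lucky

variable {p : ℕ} [hp : Fact p.Prime]

theorem exists_mul_of_redHom_eq_zero {x : pInt p} (hx : redHom p x = 0) :
    ∃ y : pInt p, x = p * y := by
  obtain ⟨q, hq⟩ := x
  have h : redRat p q = 0 := hx
  rw [redRat, div_eq_zero_iff, ZMod.intCast_zmod_eq_zero_iff_dvd, ZMod.natCast_eq_zero_iff] at h
  obtain ⟨m, hm⟩ := h.resolve_right hq
  have hp0 : (p : ℚ) ≠ 0 := Nat.cast_ne_zero.2 hp.1.ne_zero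
  have hqe : q = p * ((m : ℚ) / (q.den : ℚ)) := by
    conv_lhs => rw [← Rat.num_div_den q, hm]
    push_cast
    ring
  refine ⟨⟨(m : ℚ) / (q.den : ℚ), fun hd => hq ?_⟩, Subtype.ext hqe⟩
  refine hd.trans ?_
  have := Rat.den_dvd m q.den
  rw [Rat.divInt_eq_div] at this
  exact_mod_cast this

/-- With the preceding lemma: `pInt p` is local, with maximal ideal generated by `p`. -/
theorem isUnit_of_redHom_ne_zero {x : pInt p} (hx : redHom p x ≠ 0) : IsUnit x := by
  obtain ⟨q, hq⟩ := x
  have h : redRat p q ≠ 0 := hx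
  rw [redRat, div_ne_zero_iff, Ne, ZMod.intCast_zmod_eq_zero_iff_dvd] at h
  have hq0 : q ≠ 0 := fun h0 => h.1 (by rw [h0]; simp)
  have hinv : ¬ p ∣ q⁻¹.den := fun hd => h.1 (by
    rw [Rat.inv_def] at hd
    exact (Int.natCast_dvd_natCast.2 hd).trans (Rat.den_dvd _ _))
  exact IsUnit.of_mul_eq_one (⟨q⁻¹, hinv⟩ : pInt p) (Subtype.ext (mul_inv_cancel₀ hq0))

theorem exists_mul_of_redI_eq_zero {k : ℕ} {x : IterPoly (pInt p) k} (hx : redI p k x = 0) :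
    ∃ y, x = (p : IterPoly (pInt p) k) * y := by
  -- The chosen quotient must send `0` to `0` in order to be applied coefficientwise by `mapBase`.
  have : ∀ c : pInt p, ∃ y : pInt p, (c = 0 → y = 0) ∧ (redHom p c = 0 → c = p * y) := fun c => by
    by_cases h0 : c = 0
    · exact ⟨0, fun _ => rfl, fun _ => by rw [h0, mul_zero]⟩
    · by_cases hc : redHom p c = 0
      · obtain ⟨y, hy⟩ := exists_mul_of_redHom_eq_zero hc
        exact ⟨y, fun h => absurd h h0, fun _ => hy⟩
      · exact ⟨0, fun _ => rfl, fun h => absurd h hc⟩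
  choose f hf0 hf using this
  refine ⟨mapBase f k x, baseCoeff_ext k _ _ fun e => ?_⟩
  rw [baseCoeff_natCast_mul, baseCoeff_mapBase f (hf0 0 rfl)]
  refine hf _ ?_
  rw [← baseCoeff_mapHom, hx, baseCoeff_zero]

theorem exists_mul_of_map_redI_eq_zero {k : ℕ} {x : (IterPoly (pInt p) k)[X]}
    (hx : x.map (redI p k) = 0) : ∃ y, x = C (p : IterPoly (pInt p) k) * y := by
  obtain ⟨y, hy⟩ := exists_mul_of_redI_eq_zero (k := k + 1) (x := x) hx
  refine ⟨y, hy.trans ?_⟩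
  rw [map_natCast]
  rfl

/-- A section of the reduction modulo `p`. -/
def liftPInt (p : ℕ) [Fact p.Prime] (x : ZMod p) : pInt p := (liftInt p x : pInt p)

theorem liftPInt_zero : liftPInt p 0 = 0 := by simp [liftPInt, liftInt]

theorem redHom_liftPInt (x : ZMod p) : redHom p (liftPInt p x) = x := by
  simp [liftPInt, liftInt]

theorem map_redI_liftPInt {k : ℕ} (a : (IterPoly (ZMod p) k)[X]) :
    (mapPoly (liftPInt p) k a).map (redI p k) = a := by
  ext i
  rw [coeff_map, mapPoly_coeff _ liftPInt_zero]
  refine baseCoeff_ext k _ _ fun e => ?_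
  rw [baseCoeff_mapHom, baseCoeff_mapBase _ liftPInt_zero, redHom_liftPInt]

/-- By integrality a maximal ideal of `R_k` contracts to a maximal ideal of the local ring `pInt p`,
which contains `p`. So `p` lies in every maximal ideal, and `p y + 1` is a unit for every `y`. -/
theorem natCast_mem_jacobson (T : TriSet (pInt p)) (k : ℕ) (hT : ∀ i < k, (T i).Monic) :
    ((p : ℕ) : TriQuot T k) ∈ (⊥ : Ideal (TriQuot T k)).jacobson := by
  rw [Ideal.mem_jacobson_bot]
  intro y
  by_contra hy
  obtain ⟨M, hM, hMy⟩ := exists_max_ideal_of_mem_nonunits hy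
  have hmax := Ideal.isMaximal_comap_of_isIntegral_of_isMaximal' _ (isIntegral_quoConst T k hT) M
  have hpM : ((p : ℕ) : pInt p) ∈ M.comap (quoConst T k) := by
    by_contra hpM
    obtain ⟨c, i, hi, hc⟩ := hmax.exists_inv hpM
    refine hmax.ne_top (Ideal.eq_top_of_isUnit_mem _ hi (isUnit_of_redHom_ne_zero ?_))
    have := congrArg (redHom p) hc
    rw [map_add, map_mul, map_natCast, ZMod.natCast_self, mul_zero, zero_add, map_one] at this
    rw [this]
    exact one_ne_zero
  rw [Ideal.mem_comap, map_natCast] at hpM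
  refine hM.ne_top ((Ideal.eq_top_iff_one _).2 ?_)
  have := M.sub_mem hMy (M.mul_mem_right y hpM)
  rwa [add_sub_cancel_left] at this

/-- Nakayama's lemma for `O[X] / J`: a bound on the degrees modulo `ϖ` lifts. -/
theorem exists_monic_mem_of_mod {O : Type} [CommRing O] [Nontrivial O] {ϖ : O}
    (hϖ : ϖ ∈ (⊥ : Ideal O).jacobson) (J : Ideal O[X]) {f : O[X]} (hf : f.Monic) (hfJ : f ∈ J)
    (m : ℕ) (h : ∀ y : O[X], ∃ j ∈ J, ∃ r : O[X], r.degree < m ∧ ∃ w, y = j + r + C ϖ * w) :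
    ∃ h : O[X], h.Monic ∧ h.degree = m ∧ h ∈ J := by
  set N' := degreeLT O f.natDegree with hN'
  set N := degreeLT O m ⊔ J.restrictScalars O with hN
  have hmod : ∀ y : O[X], y %ₘ f ∈ N' := fun y => by
    rw [hN', mem_degreeLT]
    exact (degree_modByMonic_lt y hf).trans_le degree_le_natDegree
  have hle : N' ≤ N := by
    refine Submodule.le_of_le_smul_of_le_jacobson_bot (I := Ideal.span {ϖ}) ?_ ?_ ?_
    · rw [hN', degreeLT_eq_span_X_pow]
      exact Submodule.fg_span (Finset.finite_toSet _)
    · rw [Ideal.span_le]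
      rintro x rfl
      exact hϖ
    · intro y _
      obtain ⟨j, hj, r, hr, w, rfl⟩ := h y
      -- Dividing `w` by the monic `f ∈ J` moves the error term into the finitely generated module
      -- `N'`, as Nakayama's lemma requires.
      have h1 : C ϖ * w = C ϖ * (w /ₘ f) * f + ϖ • (w %ₘ f) := by
        conv_lhs => rw [← modByMonic_add_div w f]
        rw [smul_eq_C_mul]
        ring
      rw [h1, show j + r + (C ϖ * (w /ₘ f) * f + ϖ • (w %ₘ f)) =
        (r + (j + C ϖ * (w /ₘ f) * f)) + ϖ • (w %ₘ f) by ring]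
      refine Submodule.add_mem_sup (Submodule.add_mem_sup (mem_degreeLT.2 hr) ?_)
        (Submodule.smul_mem_smul (Ideal.subset_span rfl) (hmod w))
      exact J.add_mem hj (J.mul_mem_left _ hfJ)
  -- Writing `X ^ m = r + j` with `deg r < m` and `j ∈ J` makes `j` the monic element sought. The
  -- first reduction modulo `f` is needed because `m` may exceed the degree of `f`.
  have hX : (X ^ m : O[X]) ∈ N := by
    rw [← modByMonic_add_div (X ^ m) f]
    exact N.add_mem (hle (hmod _)) (Submodule.mem_sup_right (J.mul_mem_right _ hfJ))
  obtain ⟨r, hr, j, hj, hrj⟩ := Submodule.mem_sup.1 hX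
  have hr' := mem_degreeLT.1 hr
  refine ⟨X ^ m - r, monic_X_pow_sub hr', ?_, ?_⟩
  · rw [degree_sub_eq_left_of_degree_lt (by rwa [degree_X_pow]), degree_X_pow]
  · rw [← hrj, add_sub_cancel_left]
    exact hj

variable {T : TriSet ℚ} {n : ℕ}

/-- If the algorithm succeeds modulo a prime that is not bad, the degree of the gcd modulo `p` is
not too small, and if it is right, then so is the gcd. -/
theorem gcd_mod_prime (hT : IsTri T n) (hint : ∀ i < n, IsInt p i (T i))
    {a b f : (IterPoly ℚ n)[X]} (ha : IsInt p n a) (hb : IsInt p n b)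
    (hf : f = a ∨ f = b) (hfr : IsReducedPoly (mainDeg T) n f)
    (hu : IsUnit (quo (redTri p T) n (red p n f.leadingCoeff)))
    {e : Bezout ℚ n} (he : IsBezout T n a b e) {e' : Bezout (ZMod p) n}
    (he' : IsBezout (redTri p T) n (redPoly p n a) (redPoly p n b) e') :
    e.g.degree ≤ e'.g.degree ∧
      (e.g.degree = e'.g.degree → IsInt p n e.g ∧ redPoly p n e.g = e'.g) := by
  have hS := hT.intTri p
  have hTp := hT.redTri p
  set S := intTri p T with hSdef
  set a' := mapPoly (toPInt p) n a with ha'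
  set b' := mapPoly (toPInt p) n b with hb'
  set f' := mapPoly (toPInt p) n f with hf'
  have haa : a'.map (incl p n) = a := map_incl_toPInt p ha
  have hbb : b'.map (incl p n) = b := map_incl_toPInt p hb
  have hff : f'.map (incl p n) = f := map_incl_toPInt p (by rcases hf with rfl | rfl <;> assumption)
  have hap : a'.map (redI p n) = redPoly p n a := by rw [← redPoly_map_incl, haa]
  have hbp : b'.map (redI p n) = redPoly p n b := by rw [← redPoly_map_incl, hbb]
  have := hS.nontrivial le_rfl
  have hTpn := hTp.nontrivial le_rfl
  have hTn := hT.nontrivial le_rfl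
  set J : Ideal (TriQuot S n)[X] := Ideal.span {quoPoly S n a', quoPoly S n b'} with hJ
  have hjac := natCast_mem_jacobson S n fun i hi => (hS i hi).1
  -- vanishing modulo `p`
  have hvan : ∀ z : (IterPoly (pInt p) n)[X], quoPoly (redTri p T) n (z.map (redI p n)) = 0 →
      ∃ w, quoPoly S n z = C ((p : ℕ) : TriQuot S n) * w := by
    intro z hz
    rw [← nfPoly_eq_zero_iff hTp le_rfl, nfPoly_map_redI p hT hint le_rfl] at hz
    obtain ⟨w, hw⟩ := exists_mul_of_map_redI_eq_zero hz
    refine ⟨quoPoly S n w, ?_⟩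
    rw [← quoPoly_nfPoly hS le_rfl, hw, map_mul]
    congr 1
    refine (map_C _).trans ?_
    rw [map_natCast]
  have hfr' : IsReducedPoly (mainDeg S) n f' := hfr.mapTri (toPInt_zero p) (toPInt_one p) hT le_rfl
  have hflc : incl p n f'.leadingCoeff = f.leadingCoeff := by
    rw [← hff]
    exact (leadingCoeff_map_of_injective (mapHom_injective _ Subtype.val_injective n) f').symm
  -- An inverse modulo `p` lifts to an element whose product with the leading coefficient is `1 + p
  -- w`, a unit because `p` is in the Jacobson radical. A multiple of `f'` is then the monic element
  -- of `J` that Nakayama's lemma needs.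
  have hunit : IsUnit (quoPoly S n f').leadingCoeff := by
    rw [leadingCoeff_quoPoly hS le_rfl hfr']
    obtain ⟨c, hc⟩ := hu.exists_left_inv
    obtain ⟨c, rfl⟩ := Ideal.Quotient.mk_surjective c
    have h1 := hvan (mapPoly (liftPInt p) n (C c) * C f'.leadingCoeff - 1) (by
      rw [Polynomial.map_sub, Polynomial.map_mul, map_redI_liftPInt, Polynomial.map_one, map_C,
        ← C_mul, ← mapBase_incl, hflc, map_sub, map_one, ← C_1, sub_eq_zero, C_1]
      refine (map_C (quo (redTri p T) n)).trans ?_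
      rw [map_mul, hc, C_1])
    obtain ⟨w, hw⟩ := h1
    have h2 := congrArg (fun x => coeff x 0) hw
    rw [coeff_quoPoly, coeff_sub, coeff_mul_C, coeff_one_zero, map_sub, map_mul, map_one,
      coeff_C_mul] at h2
    have h3 := (Ideal.mem_jacobson_bot.1 hjac) (w.coeff 0)
    rw [← h2, sub_add_cancel] at h3
    exact isUnit_of_mul_isUnit_right h3
  obtain ⟨u, hu'⟩ := hunit.exists_left_inv
  have hfJ : quoPoly S n f' ∈ J := by
    rcases hf with rfl | rfl
    · exact Ideal.subset_span (by simp [ha', hf'])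
    · exact Ideal.subset_span (by simp [hb', hf'])
  -- Modulo `p`, dividing by `e'.g` leaves a remainder of smaller degree, and `e'.g` is a
  -- combination of `a` and `b`; lifting all coefficients costs a multiple of `p`.
  obtain ⟨h, hmon, hdeg, hmem⟩ := exists_monic_mem_of_mod hjac J
    (monic_C_mul_of_mul_leadingCoeff_eq_one hu') (J.mul_mem_left _ hfJ) e'.g.natDegree (by
      intro y
      obtain ⟨y, rfl⟩ := quoPoly_surjective S n y
      set q := y.map (redI p n) /ₘ e'.g with hq
      set r := y.map (redI p n) %ₘ e'.g with hr
      have hqr : r + e'.g * q = y.map (redI p n) := modByMonic_add_div _ _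
      set L := mapPoly (liftPInt p) n with hL
      have hLr : ∀ x, (L x).map (redI p n) = x := fun x => map_redI_liftPInt x
      obtain ⟨w, hw⟩ := hvan (y - (L e'.s * a' + L e'.t * b') * L q - L r) (by
        simp only [Polynomial.map_sub, Polynomial.map_mul, Polynomial.map_add, hLr, hap, hbp,
          map_sub, map_mul, map_add]
        rw [← he'.comb, ← hqr, map_add, map_mul]
        ring)
      refine ⟨quoPoly S n ((L e'.s * a' + L e'.t * b') * L q), ?_, quoPoly S n (L r), ?_, w, ?_⟩
      · rw [map_mul, map_add, map_mul, map_mul]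
        exact J.mul_mem_right _ (Ideal.mem_span_pair.2 ⟨_, _, rfl⟩)
      · refine degree_map_le.trans_lt ((degree_mapPoly_le _ liftPInt_zero n r).trans_lt ?_)
        rw [← degree_eq_natDegree he'.monic.ne_zero]
        exact degree_modByMonic_lt _ he'.monic
      · rw [← hw, map_sub, map_sub]
        ring)
  obtain ⟨s, t, hst⟩ := Ideal.mem_span_pair.1 hmem
  obtain ⟨s, rfl⟩ := quoPoly_surjective S n s
  obtain ⟨t, rfl⟩ := quoPoly_surjective S n t
  obtain ⟨h₀, rfl⟩ := quoPoly_surjective S n h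
  set h' := nfPoly S n h₀ with hh'
  have hQh : quoPoly S n h' = quoPoly S n h₀ := quoPoly_nfPoly hS le_rfl h₀
  have hred : IsReducedPoly (mainDeg S) n h' := isReducedPoly_nfPoly hS le_rfl h₀
  have hmon' : h'.Monic := monic_of_monic_quoPoly hS le_rfl hred (hQh ▸ hmon)
  have hdeg' : h'.natDegree = e'.g.natDegree := by
    rw [← natDegree_quoPoly hS le_rfl hred, hQh]
    exact natDegree_eq_of_degree_eq_some hdeg
  -- The relation `h' = s a' + t b'` is kept as a vanishing normal form over `pInt p`, which can be
  -- mapped both to `ℚ` and to `ZMod p`.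
  have hz : nfPoly S n (h' - (s * a' + t * b')) = 0 := by
    rw [nfPoly_eq_zero_iff hS le_rfl, map_sub, hQh, map_add, map_mul, map_mul, hst, sub_self]
  -- over `ℚ`
  set H := h'.map (incl p n) with hH
  have hHm : H.Monic := hmon'.map _
  have hHd : H.natDegree = e'.g.natDegree := by rw [hH, hmon'.natDegree_map, hdeg']
  -- Over `ℚ` the lifted element lies in `⟨a, b⟩`, so the gcd divides it; comparing degrees of monic
  -- polynomials excludes a modular gcd of too small degree.
  have hdvd : quoPoly T n e.g ∣ quoPoly T n H := by
    have h1 : nfPoly T n ((h' - (s * a' + t * b')).map (incl p n)) = 0 := by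
      rw [nfPoly_map_incl p hT hint le_rfl, hz, Polynomial.map_zero]
    rw [nfPoly_eq_zero_iff hT le_rfl] at h1
    simp only [Polynomial.map_sub, Polynomial.map_mul, Polynomial.map_add, haa, hbb,
      map_sub, map_mul, map_add] at h1
    rw [sub_eq_zero.1 h1]
    exact dvd_add (he.dvd_left.mul_left _) (he.dvd_right.mul_left _)
  have hgm : (quoPoly T n e.g).Monic := he.monic.map _
  have hHm' : (quoPoly T n H).Monic := hHm.map _
  have hgd : (quoPoly T n e.g).natDegree = e.g.natDegree := he.monic.natDegree_map _
  have hHd' : (quoPoly T n H).natDegree = e'.g.natDegree := (hHm.natDegree_map _).trans hHd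
  have hle : e.g.natDegree ≤ e'.g.natDegree := by
    by_contra hlt
    refine hgm.not_dvd_of_natDegree_lt hHm'.ne_zero ?_ hdvd
    rw [hgd, hHd']
    omega
  refine ⟨?_, fun heq => ?_⟩
  · rw [degree_eq_natDegree he.monic.ne_zero, degree_eq_natDegree he'.monic.ne_zero]
    exact_mod_cast hle
  · have heq := natDegree_eq_natDegree heq
    -- At equal degrees the division is an equality of monic polynomials. So the rational gcd is
    -- `p`-integral, and the same argument modulo `p` identifies its reduction with `e'.g`.
    have hHg : H = e.g := by
      refine eq_of_quoPoly_eq hT le_rfl ?_ he.reduced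
        (eq_of_monic_of_dvd_of_natDegree_le hgm hHm' hdvd (by rw [hgd, hHd', heq]))
      have := (hred.mapPoly (pInt p).subtype (map_zero _))
      rw [mapPoly_ringHom] at this
      exact this.congr fun j hj => mainDeg_mapTri (toPInt_zero p) (toPInt_one p) hT hj
    rw [← hHg]
    refine ⟨isInt_map_incl p h', ?_⟩
    rw [hH, redPoly_map_incl]
    have hpm : (h'.map (redI p n)).Monic := hmon'.map _
    have hdvd' : quoPoly (redTri p T) n e'.g ∣ quoPoly (redTri p T) n (h'.map (redI p n)) := by
      have h1 : nfPoly (redTri p T) n ((h' - (s * a' + t * b')).map (redI p n)) = 0 := by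
        rw [nfPoly_map_redI p hT hint le_rfl, hz, Polynomial.map_zero]
      rw [nfPoly_eq_zero_iff hTp le_rfl] at h1
      simp only [Polynomial.map_sub, Polynomial.map_mul, Polynomial.map_add, hap, hbp,
        map_sub, map_mul, map_add] at h1
      rw [sub_eq_zero.1 h1]
      exact dvd_add (he'.dvd_left.mul_left _) (he'.dvd_right.mul_left _)
    refine eq_of_quoPoly_eq hTp le_rfl ?_ he'.reduced
      (eq_of_monic_of_dvd_of_natDegree_le (he'.monic.map _) (hpm.map _) hdvd' ?_)
    · have := (hred.mapPoly (redHom p) (map_zero _))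
      rw [mapPoly_ringHom] at this
      exact this.congr fun j hj => (mainDeg_mapTri (toPInt_zero p) (toPInt_one p) hT hj).trans
        (mainDeg_mapTri (redRat_zero p) (redRat_one p) hT hj).symm
    · exact ((hpm.natDegree_map (quo _ n)).trans ((hmon'.natDegree_map _).trans (hdeg'.trans
        (he'.monic.natDegree_map (quo _ n)).symm))).le

end lucky

/-! ### Separability -/

section separable

/-- A triangular set whose polynomials are separable. -/
structure IsSepTri {F : Type} [CommRing F] (T : TriSet F) (n : ℕ) : Prop where
  tri : IsTri T n
  sep : ∀ i < n, (quoPoly T i (T i)).Separable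

/-- The class of `z_k` is a root of a monic `P ∈ ℚ[X]`, and as `R_{k+1}` is reduced, also of the
radical of `P`. So `t_k` divides, over `R_k`, a squarefree polynomial over the perfect field `ℚ`,
and divisors of separable polynomials are separable. -/
theorem separable_of_isReduced {T : TriSet ℚ} {n k : ℕ} (hT : IsTri T n) (hk : k < n)
    (hred : (triIdeal T (k + 1)).IsRadical) : (quoPoly T k (T k)).Separable := by
  let π : (IterPoly ℚ k)[X] →+* TriQuot T (k + 1) := quo T (k + 1)
  obtain ⟨P, hP, hP0⟩ := isIntegral_quoConst T (k + 1) (fun i hi => (hT i (by omega)).1) (π X)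
  set Q := UniqueFactorizationMonoid.radical P with hQ
  have heval : ∀ R : ℚ[X], eval₂ (quoConst T (k + 1)) (π X) R = π (R.map (constHom ℚ k)) := by
    intro R
    change eval₂ ((π.comp C).comp (constHom ℚ k)) (π X) R = _
    rw [← eval₂_map, ← hom_eval₂, eval₂_C_X]
  obtain ⟨m, hm⟩ := UniqueFactorizationMonoid.exists_dvd_radical_self_pow hP.ne_zero
  have hQm : (eval₂ (quoConst T (k + 1)) (π X) Q) ^ m = 0 := by
    rw [← eval₂_pow]
    obtain ⟨R, hR⟩ := hm
    rw [hR, eval₂_mul, hP0, zero_mul]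
  have hQ0 : π (Q.map (constHom ℚ k)) = 0 := by
    rw [heval, ← map_pow] at hQm
    exact (Ideal.Quotient.eq_zero_iff_mem (R := IterPoly ℚ (k + 1)) (I := triIdeal T (k + 1))).2
      (hred ⟨m, (Ideal.Quotient.eq_zero_iff_mem (R := IterPoly ℚ (k + 1))
        (I := triIdeal T (k + 1))).1 hQm⟩)
  have hdvd := (mem_triIdeal_succ T k (Q.map (constHom ℚ k))).1
    ((Ideal.Quotient.eq_zero_iff_mem (R := IterPoly ℚ (k + 1)) (I := triIdeal T (k + 1))).1 hQ0)
  have hsep : Q.Separable :=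
    PerfectField.separable_iff_squarefree.2 UniqueFactorizationMonoid.squarefree_radical
  exact (hsep.map.map).of_dvd hdvd

/-- `R_k` embeds into `R_{k+1}`: a constant divisible by a monic polynomial of positive degree is
zero. Hence reducedness descends through the tower. -/
theorem isRadical_triIdeal_of_succ {T : TriSet ℚ} {n k : ℕ} (hT : IsTri T n) (hk : k < n)
    (hred : (triIdeal T (k + 1)).IsRadical) : (triIdeal T k).IsRadical := by
  rintro x ⟨m, hm⟩
  have h1 : (show IterPoly ℚ (k + 1) from (C x : (IterPoly ℚ k)[X])) ∈ triIdeal T (k + 1) := by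
    refine hred ⟨m, ?_⟩
    change (C x : (IterPoly ℚ k)[X]) ^ m ∈ (triIdeal T k).map C ⊔ Ideal.span {T k}
    rw [← C_pow]
    exact Ideal.mem_sup_left (Ideal.mem_map_of_mem C hm)
  obtain ⟨hmon, hpos, -⟩ := hT k hk
  have := hT.nontrivial hk.le
  have h2 := (mem_triIdeal_succ T k (C x)).1 h1
  have h3 : quoPoly T k (C x) = C (quo T k x) := map_C _
  rw [h3] at h2
  refine Ideal.Quotient.eq_zero_iff_mem.1 ?_
  by_contra hne
  refine (hmon.map (quo T k)).not_dvd_of_natDegree_lt (C_ne_zero.2 hne) ?_ h2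
  rw [natDegree_C, hmon.natDegree_map]
  exact hpos

theorem isSepTri_of_isRadical {T : TriSet ℚ} {n : ℕ} (hT : IsTri T n)
    (hred : (triIdeal T n).IsRadical) : IsSepTri T n := by
  have : ∀ m ≤ n, (triIdeal T (n - m)).IsRadical := by
    intro m hm
    induction m with
    | zero => exact hred
    | succ m ih =>
      refine isRadical_triIdeal_of_succ hT (by omega) ?_
      have h : n - (m + 1) + 1 = n - m := by omega
      rw [h]
      exact ih (by omega)
  refine ⟨hT, fun i hi => separable_of_isReduced hT hi ?_⟩
  have h := this (n - (i + 1)) (by omega)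
  rwa [show n - (n - (i + 1)) = i + 1 by omega] at h

end separable

/-! ### The recursive representation -/

section recursive

variable {F : Type} [Field F] {n : ℕ}

/-- The exponents of `z₀, …, z_{k-1}` as a finitely supported function. -/
def expo (n k : ℕ) (e : ℕ → ℕ) : Fin n →₀ ℕ :=
  Finsupp.equivFunOnFinite.symm fun j => if (j : ℕ) < k then e j else 0

theorem expo_apply (k : ℕ) (e : ℕ → ℕ) (j : Fin n) :
    expo n k e j = if (j : ℕ) < k then e j else 0 := rfl

theorem baseCoeff_constHom (k : ℕ) (c : F) (e : ℕ → ℕ) :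
    baseCoeff k (constHom F k c) e = if ∀ j < k, e j = 0 then c else 0 := by
  induction k with
  | zero => simp only [not_lt_zero, IsEmpty.forall_iff, implies_true, if_true]; rfl
  | succ k ih =>
    have h : baseCoeff (k + 1) (constHom F (k + 1) c) e =
      baseCoeff k ((C (constHom F k c) : (IterPoly F k)[X]).coeff (e k)) e := rfl
    rw [h, coeff_C]
    by_cases h0 : e k = 0
    · rw [if_pos h0, ih]
      congr 1
      simp only [eq_iff_iff]
      exact ⟨fun h j hj => (Nat.lt_succ_iff_lt_or_eq.1 hj).elim (h j) (fun hh => hh ▸ h0),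
        fun h j hj => h j (by omega)⟩
    · rw [if_neg h0, baseCoeff_zero, if_neg]
      exact fun h => h0 (h k (Nat.lt_succ_self k))

theorem gen_eq_zero {k j : ℕ} (h : k ≤ j) : gen F k j = 0 := by
  induction k with
  | zero => rfl
  | succ k ih =>
    have : gen F (k + 1) j =
      if j = k then (X : (IterPoly F k)[X]) else (C (gen F k j) : (IterPoly F k)[X]) := rfl
    rw [this, if_neg (by omega), ih (by omega), C_0]
    rfl

theorem baseCoeff_mul_gen {k j : ℕ} (h : j < k) (x : IterPoly F k) (e : ℕ → ℕ) :
    baseCoeff k (x * gen F k j) e =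
      if e j = 0 then 0 else baseCoeff k x (Function.update e j (e j - 1)) := by
  induction k with
  | zero => omega
  | succ k ih =>
    change (IterPoly F k)[X] at x
    have hg : gen F (k + 1) j =
      if j = k then (X : (IterPoly F k)[X]) else (C (gen F k j) : (IterPoly F k)[X]) := rfl
    rw [hg]
    by_cases hj : j = k
    · rw [if_pos hj]
      subst hj
      change baseCoeff j ((x * X).coeff (e j)) e = _
      rw [baseCoeff_update]
      cases he : e j with
      | zero => rw [coeff_mul_X_zero, baseCoeff_zero, if_pos rfl]
      | succ m => rw [coeff_mul_X, if_neg (by omega)]; rfl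
    · rw [if_neg hj]
      change baseCoeff k ((x * C (gen F k j)).coeff (e k)) e = _
      rw [coeff_mul_C, ih (by omega), baseCoeff_succ, Function.update_of_ne (by omega)]

/-- For `k < n` the map is a truncation: `gen` sends the later variables to `0`, so only monomials
in the first `k` variables survive. `expo` therefore sets the later exponents to `0`. -/
theorem baseCoeff_toIter {k : ℕ} (hk : k ≤ n) (P : MvPolynomial (Fin n) F) (e : ℕ → ℕ) :
    baseCoeff k (toIter F n k P) e = P.coeff (expo n k e) := by
  induction P using MvPolynomial.induction_on generalizing e with
  | C c =>
    rw [toIter, MvPolynomial.coe_eval₂Hom, MvPolynomial.eval₂_C, baseCoeff_constHom,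
      MvPolynomial.coeff_C]
    congr 1
    simp only [eq_iff_iff]
    constructor
    · intro h
      ext j
      rw [expo_apply]
      split_ifs with hj
      · exact (h _ hj).symm
      · rfl
    · intro h j hj
      have := DFunLike.congr_fun h (⟨j, by omega⟩ : Fin n)
      rw [expo_apply, if_pos hj] at this
      exact this.symm
  | add P Q hP hQ => rw [map_add, baseCoeff_add, hP, hQ, MvPolynomial.coeff_add]
  | mul_X P j hP =>
    have hX : toIter F n k (MvPolynomial.X j) = gen F k j := by
      rw [toIter, MvPolynomial.coe_eval₂Hom, MvPolynomial.eval₂_X]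
    rw [map_mul, hX, MvPolynomial.coeff_mul_X']
    by_cases hj : (j : ℕ) < k
    · have hmem : j ∈ (expo n k e).support ↔ e j ≠ 0 := by
        rw [Finsupp.mem_support_iff, expo_apply, if_pos hj]
      rw [baseCoeff_mul_gen hj, hP]
      by_cases he : e j = 0
      · rw [if_pos he, if_neg fun h => hmem.1 h he]
      · rw [if_neg he, if_pos (hmem.2 he)]
        congr 1
        ext i
        rw [Finsupp.tsub_apply, expo_apply, expo_apply, Finsupp.single_apply]
        by_cases hij : j = i
        · subst hij
          rw [if_pos rfl, if_pos hj, if_pos hj, Function.update_self]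
        · rw [if_neg hij, Function.update_of_ne fun h => hij (Fin.ext h.symm), Nat.sub_zero]
    · rw [gen_eq_zero (by omega), mul_zero, baseCoeff_zero, if_neg]
      rw [Finsupp.notMem_support_iff, expo_apply, if_neg hj]

theorem toIter_injective : Function.Injective (toIter F n n) := by
  intro P Q h
  ext m
  have : m = expo n n fun j => if h : j < n then m ⟨j, h⟩ else 0 := by
    ext j
    rw [expo_apply, if_pos j.2, dif_pos j.2]
  rw [this, ← baseCoeff_toIter le_rfl, ← baseCoeff_toIter le_rfl, h]

theorem toIter_succ_eq_C {k : ℕ} (hk : k < n) {P : MvPolynomial (Fin n) F}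
    (hP : ∀ j : Fin n, k ≤ j → P.degreeOf j = 0) :
    toIter F n (k + 1) P = (C (toIter F n k P) : (IterPoly F k)[X]) := by
  refine baseCoeff_ext (k + 1) _ _ fun e => ?_
  rw [baseCoeff_toIter hk]
  change _ = baseCoeff k ((C (toIter F n k P) : (IterPoly F k)[X]).coeff (e k)) e
  rw [coeff_C]
  by_cases h0 : e k = 0
  · rw [if_pos h0, baseCoeff_toIter hk.le]
    congr 1
    ext j
    rw [expo_apply, expo_apply]
    rcases lt_trichotomy (j : ℕ) k with h | h | h
    · rw [if_pos h, if_pos (by omega)]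
    · rw [if_pos (by omega), if_neg (by omega), h, h0]
    · rw [if_neg (by omega), if_neg (by omega)]
  · rw [if_neg h0, baseCoeff_zero]
    by_contra hne
    have := MvPolynomial.monomial_le_degreeOf (⟨k, hk⟩ : Fin n) (MvPolynomial.mem_support_iff.2 hne)
    rw [hP _ le_rfl, expo_apply, if_pos (Nat.lt_succ_self k)] at this
    exact h0 (Nat.le_zero.1 this)

theorem toIter_surjective : Function.Surjective (toIter F n n) := by
  have key : ∀ k ≤ n, Function.Surjective (toIter F n k) := by
    intro k hk
    induction k with
    | zero =>
      intro c
      exact ⟨MvPolynomial.C (show F from c), MvPolynomial.eval₂_C _ _ _⟩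
    | succ k ih =>
      -- `P` itself need not serve as `Q`: its terms that contain `z_k` are killed at level `k` but
      -- not at level `k + 1`.
      have hC : ∀ P : MvPolynomial (Fin n) F, ∃ Q, toIter F n (k + 1) Q =
          (C (toIter F n k P) : (IterPoly F k)[X]) := by
        intro P
        induction P using MvPolynomial.induction_on with
        | C c =>
          refine ⟨MvPolynomial.C c, ?_⟩
          rw [toIter, toIter, MvPolynomial.coe_eval₂Hom, MvPolynomial.coe_eval₂Hom,
            MvPolynomial.eval₂_C, MvPolynomial.eval₂_C]
          rfl
        | add P Q hP hQ =>
          obtain ⟨P', hP⟩ := hP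
          obtain ⟨Q', hQ⟩ := hQ
          exact ⟨P' + Q', by rw [map_add, hP, hQ, map_add, C_add]; rfl⟩
        | mul_X P j hP =>
          obtain ⟨P', hP⟩ := hP
          have hX : toIter F n k (MvPolynomial.X j) = gen F k j := by
            rw [toIter, MvPolynomial.coe_eval₂Hom, MvPolynomial.eval₂_X]
          have hX' : toIter F n (k + 1) (MvPolynomial.X j) = gen F (k + 1) j := by
            rw [toIter, MvPolynomial.coe_eval₂Hom, MvPolynomial.eval₂_X]
          by_cases hj : (j : ℕ) < k
          · refine ⟨P' * MvPolynomial.X j, ?_⟩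
            have hg : gen F (k + 1) j = (C (gen F k j) : (IterPoly F k)[X]) :=
              if_neg (show ¬ (j : ℕ) = k by omega)
            rw [map_mul, hP, hX', hg, map_mul, hX, C_mul]
            rfl
          · refine ⟨0, ?_⟩
            rw [map_zero, map_mul, hX, gen_eq_zero (by omega), mul_zero, C_0]
            rfl
      intro q
      change (IterPoly F k)[X] at q
      have hX' : toIter F n (k + 1) (MvPolynomial.X ⟨k, hk⟩) = (X : (IterPoly F k)[X]) := by
        rw [toIter, MvPolynomial.coe_eval₂Hom, MvPolynomial.eval₂_X]
        exact if_pos rfl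
      induction q using Polynomial.induction_on with
      | C c =>
        obtain ⟨P, rfl⟩ := ih (by omega) c
        exact hC P
      | add q r hq hr =>
        obtain ⟨P, hP⟩ := hq
        obtain ⟨Q, hQ⟩ := hr
        exact ⟨P + Q, by rw [map_add, hP, hQ]; rfl⟩
      | monomial m c h =>
        obtain ⟨P, hP⟩ := h
        refine ⟨P * MvPolynomial.X ⟨k, hk⟩, ?_⟩
        rw [map_mul, hP, hX', pow_succ, ← mul_assoc]
        rfl
  exact key n le_rfl

theorem triOf_of_lt (T : Fin n → MvPolynomial (Fin n) ℚ) {i : ℕ} (hi : i < n) :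
    triOf T i = toIter ℚ n (i + 1) (T ⟨i, hi⟩) := dif_pos hi

theorem baseCoeff_coeff_triOf (T : Fin n → MvPolynomial (Fin n) ℚ) {i : ℕ} (hi : i < n) (m : ℕ)
    (e : ℕ → ℕ) : baseCoeff i ((triOf T i).coeff m) e =
      (T ⟨i, hi⟩).coeff (expo n (i + 1) (Function.update e i m)) := by
  rw [← baseCoeff_update, triOf_of_lt T hi]
  exact baseCoeff_toIter hi _ _

theorem natDegree_triOf {T : Fin n → MvPolynomial (Fin n) ℚ} (hT : IsTriangularSet T) {i : ℕ}
    (hi : i < n) : (triOf T i).Monic ∧ (triOf T i).natDegree = (T ⟨i, hi⟩).degreeOf ⟨i, hi⟩ := by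
  set j : Fin n := ⟨i, hi⟩ with hj
  set d := (T j).degreeOf j with hd
  have hcoeff : (triOf T i).coeff d = 1 := by
    refine baseCoeff_ext i _ _ fun e => ?_
    rw [baseCoeff_coeff_triOf T hi, baseCoeff_one]
    -- A nonzero coefficient here would have exponent `d` in the main variable, against the monicity
    -- condition. So the leading coefficient of `t_i` is that of a pure power of `z_i`.
    have h1 : (T j - MvPolynomial.X j ^ d).coeff (expo n (i + 1) (Function.update e i d)) = 0 := by
      by_contra hne
      have h2 := MvPolynomial.monomial_le_degreeOf j (MvPolynomial.mem_support_iff.2 hne)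
      have h3 := hT.monic j
      rw [← hd] at h3
      rw [expo_apply, if_pos (by simp [hj])] at h2
      simp only [hj, Function.update_self] at h2
      rw [← hj] at h2
      omega
    rw [MvPolynomial.coeff_sub, sub_eq_zero, MvPolynomial.coeff_X_pow] at h1
    rw [h1]
    congr 1
    simp only [eq_iff_iff]
    constructor
    · intro h l hl
      have := DFunLike.congr_fun h (⟨l, by omega⟩ : Fin n)
      rw [expo_apply, if_pos (show l < i + 1 by omega), Finsupp.single_apply, if_neg (by
        rw [hj, Fin.mk.injEq]; omega)] at this
      rw [this]
      exact (Function.update_of_ne (by simp; omega) _ _).symm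
    · intro h
      ext l
      rw [expo_apply, Finsupp.single_apply]
      rcases lt_trichotomy (l : ℕ) i with hl | hl | hl
      · rw [if_neg (by rw [hj, Fin.ext_iff]; simp; omega), if_pos (by omega),
          Function.update_of_ne (by omega), h _ hl]
      · rw [if_pos (by rw [hj, Fin.ext_iff]; simp; omega), if_pos (by omega), hl,
          Function.update_self]
      · rw [if_neg (by rw [hj, Fin.ext_iff]; simp; omega), if_neg (by omega)]
  have hle : (triOf T i).natDegree ≤ d := by
    rw [natDegree_le_iff_coeff_eq_zero]
    intro m hm
    refine baseCoeff_ext i _ _ fun e => ?_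
    rw [baseCoeff_coeff_triOf T hi, baseCoeff_zero]
    by_contra hne
    have h2 := MvPolynomial.monomial_le_degreeOf j (MvPolynomial.mem_support_iff.2 hne)
    rw [expo_apply, if_pos (by simp [hj])] at h2
    simp only [hj, Function.update_self] at h2
    rw [← hj] at h2
    omega
  have heq : (triOf T i).natDegree = d :=
    le_antisymm hle (le_natDegree_of_ne_zero (by rw [hcoeff]; exact one_ne_zero))
  exact ⟨by rw [Monic, leadingCoeff, heq, hcoeff], heq⟩

theorem isTri_triOf {T : Fin n → MvPolynomial (Fin n) ℚ} (hT : IsTriangularSet T) :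
    IsTri (triOf T) n := by
  intro i hi
  obtain ⟨h1, h2⟩ := natDegree_triOf hT hi
  refine ⟨h1, h2 ▸ hT.mdeg_pos _, fun m e he j hj => ?_⟩
  rw [baseCoeff_coeff_triOf T hi] at he
  have h3 := MvPolynomial.monomial_le_degreeOf (⟨j, by omega⟩ : Fin n)
    (MvPolynomial.mem_support_iff.2 he)
  rw [expo_apply, if_pos (show j < i + 1 by omega), Function.update_of_ne (by simp; omega)] at h3
  refine h3.trans_lt ((hT.reduced ⟨i, hi⟩ ⟨j, by omega⟩ hj).trans_eq ?_)
  exact (natDegree_triOf hT (by omega)).2.symm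

theorem triIdeal_triOf {T : Fin n → MvPolynomial (Fin n) ℚ} (hT : IsTriangularSet T) :
    triIdeal (triOf T) n = (Ideal.span (Set.range T)).map (toIter ℚ n n) := by
  have key : ∀ k ≤ n, triIdeal (triOf T) k =
      Ideal.span (toIter ℚ n k '' (T '' {i | (i : ℕ) < k})) := by
    intro k hk
    induction k with
    | zero =>
      simp only [not_lt_zero, Set.ofPred_false, Set.image_empty, Ideal.span_empty]
      rfl
    | succ k ih =>
      change ((triIdeal (triOf T) k).map C ⊔ Ideal.span {triOf T k} : Ideal (IterPoly ℚ k)[X]) =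
        Ideal.span (toIter ℚ n (k + 1) '' (T '' {i | (i : ℕ) < k + 1}))
      rw [ih (by omega), Ideal.map_span, ← Ideal.span_union]
      congr 1
      have hlt : ∀ i : Fin n, (i : ℕ) < k → toIter ℚ n (k + 1) (T i) =
          (C (toIter ℚ n k (T i)) : (IterPoly ℚ k)[X]) := fun i hi =>
        toIter_succ_eq_C (by omega) fun j hj => hT.main_var i j (by
          rw [Fin.lt_def]; omega)
      ext x
      constructor
      · rintro (⟨_, ⟨_, ⟨i, hi, rfl⟩, rfl⟩, rfl⟩ | rfl)
        · exact ⟨_, ⟨i, Nat.lt_succ_of_lt hi, rfl⟩, hlt i hi⟩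
        · exact ⟨_, ⟨⟨k, by omega⟩, Nat.lt_succ_self k, rfl⟩, (triOf_of_lt T (by omega)).symm⟩
      · rintro ⟨_, ⟨i, hi, rfl⟩, rfl⟩
        rcases Nat.lt_succ_iff_lt_or_eq.1 hi with h | h
        · exact Or.inl ⟨_, ⟨_, ⟨i, h, rfl⟩, rfl⟩, (hlt i h).symm⟩
        · right
          subst h
          exact (triOf_of_lt T i.2).symm
  rw [key n le_rfl, Ideal.map_span]
  congr 2
  ext x
  simp

/-- At the top level `toIter` is bijective, so the radical ideal `⟨T⟩` is carried to a radical
ideal. -/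
theorem isSepTri_triOf {T : Fin n → MvPolynomial (Fin n) ℚ} (hT : IsTriangularSet T)
    (hrad : (Ideal.span (Set.range T)).IsRadical) : IsSepTri (triOf T) n := by
  refine isSepTri_of_isRadical (isTri_triOf hT) ?_
  rw [triIdeal_triOf hT]
  rintro x ⟨m, hm⟩
  obtain ⟨y, rfl⟩ := toIter_surjective x
  rw [← map_pow] at hm
  have hb : Function.Bijective (toIter ℚ n n) := ⟨toIter_injective, toIter_surjective⟩
  refine Ideal.mem_map_of_mem _ (hrad ⟨m, ?_⟩)
  rw [← Ideal.comap_map_of_bijective _ hb (I := Ideal.span (Set.range T))]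
  exact hm

end recursive

/-! ### Rational reconstruction and Chinese remaindering -/

section reconstruction

/-- The fraction `q` is defined modulo `M` and congruent to `x`. -/
def RatCong (M : ℕ) (x : ℤ) (q : ℚ) : Prop := q.den.Coprime M ∧ (M : ℤ) ∣ q.num - (q.den : ℤ) * x

/-- Congruence of all base coefficients. -/
def RatCongPoly (M k : ℕ) (u : (IterPoly ℤ k)[X]) (g : (IterPoly ℚ k)[X]) : Prop :=
  ∀ i e, RatCong M (baseCoeff k (u.coeff i) e) (baseCoeff k (g.coeff i) e)

/-- `ratRecon` chooses some admissible fraction, so uniqueness has to be shown: two admissible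
fractions have cross products congruent modulo `M`, and these are too small to differ. -/
theorem ratRecon_eq_some {M : ℕ} {x : ℤ} {q : ℚ} (hn : 2 * q.num ^ 2 < (M : ℤ))
    (hd : 2 * q.den ^ 2 < M) (h : RatCong M x q) : ratRecon M x = some q := by
  have hex : ∃ q : ℚ, 2 * q.num ^ 2 < (M : ℤ) ∧ 2 * q.den ^ 2 < M ∧ q.den.Coprime M ∧
      (M : ℤ) ∣ q.num - (q.den : ℤ) * x := ⟨q, hn, hd, h⟩
  rw [ratRecon, dif_pos hex]
  obtain ⟨hn', hd', -, h'⟩ := hex.choose_spec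
  set r := hex.choose
  congr 1
  have hdvd : (M : ℤ) ∣ r.num * q.den - q.num * r.den := by
    have hr : r.num * q.den - q.num * r.den =
        (r.num - r.den * x) * q.den - (q.num - q.den * x) * r.den := by ring
    rw [hr]
    exact dvd_sub (h'.mul_right _) (h.2.mul_right _)
  have hd1 : 2 * (q.den : ℤ) ^ 2 < M := by exact_mod_cast hd
  have hd2 : 2 * (r.den : ℤ) ^ 2 < M := by exact_mod_cast hd'
  -- From `2 |x y| ≤ x² + y²` and the size bounds, each product is below `M / 2` in absolute value.
  have h0 : r.num * q.den - q.num * r.den = 0 := by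
    refine Int.eq_zero_of_abs_lt_dvd hdvd (abs_lt.2 ⟨?_, ?_⟩)
    · nlinarith [sq_nonneg (r.num + q.den), sq_nonneg (q.num - r.den)]
    · nlinarith [sq_nonneg (r.num - q.den), sq_nonneg (q.num + r.den)]
  exact Rat.eq_iff_mul_eq_mul.2 (sub_eq_zero.1 h0)

theorem ratCong_zero (M : ℕ) : RatCong M 0 0 := ⟨by simp, by simp⟩

theorem ratRecon_zero {M : ℕ} (hM : 2 < M) : ratRecon M 0 = some 0 :=
  ratRecon_eq_some (by simp; omega) (by simpa using hM) (ratCong_zero M)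

theorem ratRecon_one {M : ℕ} (hM : 2 < M) : ratRecon M 1 = some 1 :=
  ratRecon_eq_some (by simp; omega) (by simpa using hM) ⟨by simp, by simp⟩

theorem two_lt_of_isSome {M : ℕ} {x : ℤ} (h : (ratRecon M x).isSome = true) : 2 < M := by
  rw [ratRecon] at h
  split_ifs at h with hex
  · obtain ⟨q, -, hd, -⟩ := hex
    have := q.den_pos
    nlinarith
  · simp at h

/-- The threshold depends only on `g`; neither the prime nor the representative `u` enters. This
uniformity yields bounds on `M` and `B` valid for almost all primes. -/
theorem exists_ratReconPoly {k : ℕ} (g : (IterPoly ℚ k)[X]) : ∃ M₀ : ℕ, ∀ M ≥ M₀,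
    ∀ u, RatCongPoly M k u g → ratReconPoly M k u = some g := by
  -- The premise `2 < M` makes the condition true of the coefficient `0` for every `M`, as
  -- `eventually_allBase` demands.
  have h1 : ∀ᶠ M : ℕ in atTop, AllPoly
      (fun q : ℚ => 2 < M → 2 * q.num ^ 2 < (M : ℤ) ∧ 2 * q.den ^ 2 < M) k g := by
    refine eventually_allBase
      (Q := fun (M : ℕ) (q : ℚ) => 2 < M → 2 * q.num ^ 2 < (M : ℤ) ∧ 2 * q.den ^ 2 < M)
      (fun M hM => ⟨by simp; omega, by simpa using hM⟩) (fun q => ?_) (k + 1) g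
    filter_upwards [eventually_gt_atTop (2 * q.num ^ 2).natAbs, eventually_gt_atTop (2 * q.den ^ 2)]
      with M hM hM' _
    exact ⟨by omega, hM'⟩
  obtain ⟨M₀, hM₀⟩ := eventually_atTop.1 (h1.and (eventually_gt_atTop 2))
  refine ⟨M₀, fun M hM u hu => ?_⟩
  obtain ⟨h2, h3⟩ := hM₀ M hM
  have h4 : ∀ i e, ratRecon M (baseCoeff k (u.coeff i) e) = some (baseCoeff k (g.coeff i) e) :=
    fun i e => by
      have := (allBase_iff _ k _).1 (h2 i) e h3
      exact ratRecon_eq_some this.1 this.2 (hu i e)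
  rw [ratReconPoly, if_pos]
  · congr 1
    ext i
    set f : ℤ → ℚ := fun c => (ratRecon M c).getD 0 with hf
    have h0 : f 0 = 0 := by simp [hf, ratRecon_zero h3]
    rw [mapPoly_coeff f h0]
    refine baseCoeff_ext k _ _ fun e => ?_
    rw [baseCoeff_mapBase f h0, hf]
    dsimp only
    rw [h4]
    rfl
  · intro i
    rw [allBase_iff]
    intro e
    rw [h4]
    rfl

/-- Any success forces `2 < M`, since a denominator is at least `1`; then `0` and `1` reconstruct to
themselves. So reconstruction preserves monicity and degree of a monic lift, whatever it does to the
other coefficients. -/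
theorem ratReconPoly_spec {M k : ℕ} {u : (IterPoly ℤ k)[X]} {g : (IterPoly ℚ k)[X]}
    (h : ratReconPoly M k u = some g) : ∃ f : ℤ → ℚ, f 0 = 0 ∧ f 1 = 1 ∧ g = mapPoly f k u := by
  rw [ratReconPoly] at h
  split_ifs at h with hall
  have hM := two_lt_of_isSome ((allBase_iff _ k _).1 (hall 0) 0)
  exact ⟨_, by simp [ratRecon_zero hM], by simp [ratRecon_one hM], (Option.some.inj h).symm⟩

theorem RatCong.mul {M p : ℕ} (hM : M.Coprime p) {x : ℤ} {q : ℚ} (h : RatCong M x q)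
    (h' : RatCong p x q) : RatCong (M * p) x q := by
  refine ⟨Nat.Coprime.mul_right h.1 h'.1, ?_⟩
  push_cast
  exact IsCoprime.mul_dvd (Nat.isCoprime_iff_coprime.2 hM) h.2 h'.2

variable {p : ℕ} [hp : Fact p.Prime]

theorem ratCong_of_redRat_eq {x : ℤ} {q : ℚ} (hq : ¬ p ∣ q.den) (h : redRat p q = (x : ZMod p)) :
    RatCong p x q := by
  refine ⟨((Nat.Prime.coprime_iff_not_dvd hp.1).2 hq).symm, ?_⟩
  have hd : (q.den : ZMod p) ≠ 0 := fun h => hq ((ZMod.natCast_eq_zero_iff _ _).1 h)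
  rw [redRat, div_eq_iff hd] at h
  rw [← ZMod.intCast_zmod_eq_zero_iff_dvd]
  push_cast
  rw [h]
  ring

theorem RatCong.add_mul {M : ℕ} {x : ℤ} {q : ℚ} (h : RatCong M x q) (y : ℤ) :
    RatCong M (x + M * y) q := by
  refine ⟨h.1, ?_⟩
  have : q.num - (q.den : ℤ) * (x + M * y) = (q.num - q.den * x) - M * (q.den * y) := by ring
  rw [this]
  exact dvd_sub h.2 (dvd_mul_right _ _)

theorem intCast_liftInt (x : ZMod p) : ((liftInt p x : ℤ) : ZMod p) = x := by
  simp [liftInt]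

theorem liftInt_zero : liftInt p 0 = 0 := by simp [liftInt]

theorem liftInt_one : liftInt p 1 = 1 := by
  have : Fact (1 < p) := ⟨hp.1.one_lt⟩
  simp [liftInt, ZMod.val_one]

theorem redRat_baseCoeff {k : ℕ} (g : (IterPoly ℚ k)[X]) (i : ℕ) (e : ℕ → ℕ) :
    redRat p (baseCoeff k (g.coeff i) e) = baseCoeff k ((redPoly p k g).coeff i) e := by
  rw [coeff_redPoly, baseCoeff_mapBase _ (redRat_zero p)]

theorem ratCongPoly_liftInt {k : ℕ} {g : (IterPoly ℚ k)[X]} (hg : IsInt p k g) :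
    RatCongPoly p k (mapPoly (liftInt p) k (redPoly p k g)) g := by
  intro i e
  refine ratCong_of_redRat_eq ((allBase_iff _ k _).1 (hg i) e) ?_
  rw [mapPoly_coeff _ liftInt_zero, baseCoeff_mapBase _ liftInt_zero, intCast_liftInt,
    redRat_baseCoeff]

theorem ratCongPoly_crt {n M : ℕ} (hM : M.Coprime p) {u : (IterPoly ℤ n)[X]}
    {g : (IterPoly ℚ n)[X]} (hu : RatCongPoly M n u g) (hg : IsInt p n g) :
    RatCongPoly (M * p) n (crt M p u (redPoly p n g)) g := by
  intro i e
  have h0 : (fun x : ZMod p => liftInt p ((M : ZMod p)⁻¹ * x)) 0 = 0 := by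
    simp [liftInt_zero]
  have h0' : (fun x : ℤ => (x : ZMod p)) 0 = 0 := Int.cast_zero
  have hc : baseCoeff n ((crt M p u (redPoly p n g)).coeff i) e =
      baseCoeff n (u.coeff i) e + M * liftInt p ((M : ZMod p)⁻¹ *
        (redRat p (baseCoeff n (g.coeff i) e) - ((baseCoeff n (u.coeff i) e : ℤ) : ZMod p))) := by
    rw [crt, coeff_add, baseCoeff_add, ← nsmul_eq_mul, coeff_smul, nsmul_eq_mul,
      baseCoeff_natCast_mul, mapPoly_coeff _ h0, baseCoeff_mapBase _ h0, coeff_sub, baseCoeff_sub,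
      mapPoly_coeff _ h0', baseCoeff_mapBase _ h0', redRat_baseCoeff]
  rw [hc]
  refine ((hu i e).add_mul _).mul hM
    (ratCong_of_redRat_eq ((allBase_iff _ n _).1 (hg i) e) ?_)
  have hM0 : (M : ZMod p) ≠ 0 := fun h =>
    (Nat.Prime.coprime_iff_not_dvd hp.1).1 hM.symm ((ZMod.natCast_eq_zero_iff _ _).1 h)
  push_cast
  rw [intCast_liftInt, mul_inv_cancel_left₀ hM0]
  ring

end reconstruction

/-! ### Hensel lifting -/

section algebra

variable {R : Type} [CommRing R]

theorem bezout_solve {a b s t c : R[X]} (hst : s * a + t * b = 1) :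
    (c * s) %ₘ b * a + (c * t + (c * s) /ₘ b * a) * b = c := by
  have := modByMonic_add_div (c * s) b
  linear_combination c * hst + a * this

/-- Identifies the corrections computed in a Hensel step with those of a known factorization,
without comparing the cofactors `s` and `t`. -/
theorem bezout_solve_unique {a b s t c x y : R[X]} (hb : b.Monic) (hst : s * a + t * b = 1)
    (hc : c = a * x + y * b) (hx : x.degree < b.degree) :
    (c * s) %ₘ b = x ∧ c * t + (c * s) /ₘ b * a = y := by
  have h1 : (c * s) /ₘ b = y * s - t * x ∧ (c * s) %ₘ b = x :=
    div_modByMonic_unique _ _ hb ⟨by rw [hc]; linear_combination (-x) * hst, hx⟩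
  refine ⟨h1.2, ?_⟩
  rw [h1.1, hc]
  linear_combination y * hst

/-- Division bounds only the correction of one factor. The other bound comes from the equation: its
product with the monic `b` has degree below `deg a + deg b`. So both lifts stay monic. -/
theorem degree_bezout_solve_lt [Nontrivial R] {a b s t c : R[X]} (ha : a.Monic) (hb : b.Monic)
    (hst : s * a + t * b = 1) (hc : c.degree < a.degree + b.degree) :
    (c * t + (c * s) /ₘ b * a).degree < a.degree := by
  have h := bezout_solve (c := c) hst
  set y := c * t + (c * s) /ₘ b * a with hy
  have h1 : y * b = c - (c * s) %ₘ b * a := by linear_combination h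
  have h2 : (y * b).degree < a.degree + b.degree := by
    rw [h1]
    refine (degree_sub_le _ _).trans_lt (max_lt hc ?_)
    rw [ha.degree_mul, add_comm]
    refine WithBot.add_lt_add_left (degree_ne_bot.2 ha.ne_zero) (degree_modByMonic_lt _ hb)
  rw [hb.degree_mul] at h2
  exact lt_of_add_lt_add_right h2

end algebra

theorem degree_sub_lt_of_monic {R : Type} [CommRing R] [Nontrivial R] {a b : R[X]} (ha : a.Monic)
    (hb : b.Monic) (h : b.natDegree = a.natDegree) : (a - b).degree < a.degree :=
  degree_sub_lt_left (by rw [degree_eq_natDegree ha.ne_zero, degree_eq_natDegree hb.ne_zero, h])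
    ha.ne_zero (by rw [ha.leadingCoeff, hb.leadingCoeff])

theorem degree_natCast_mul_le {R : Type} [CommRing R] (m : ℕ) (a : R[X]) :
    ((m : R[X]) * a).degree ≤ a.degree := by
  rw [← nsmul_eq_mul]
  exact degree_smul_le m a

/-! ### The lifting loop -/

section hensel

variable {p : ℕ} [hp : Fact p.Prime] {T : TriSet ℚ} {n k : ℕ}

theorem isReducedPoly_liftInt (hT : IsTri T n) (hk : k ≤ n) {a : (IterPoly (ZMod p) k)[X]}
    (ha : IsReducedPoly (mainDeg (redTri p T)) k a) :
    IsReducedPoly (mainDeg T) k (mapPoly (liftInt p) k a) :=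
  (ha.mapPoly _ liftInt_zero).congr fun _ hj =>
    mainDeg_mapTri (redRat_zero p) (redRat_one p) hT (by omega)

theorem mapPoly_intCast {A : Type} [CommRing A] (u : (IterPoly ℤ k)[X]) :
    mapPoly (fun x : ℤ => (x : A)) k u = u.map (mapHom (Int.castRingHom A) k) :=
  mapPoly_ringHom (Int.castRingHom A) k u

theorem redRat_div_zero (p i : ℕ) [Fact p.Prime] : redRat p (0 / (p : ℚ) ^ i) = 0 := by
  rw [zero_div, redRat_zero]

/-- Every successful lifting yields a proper factor, for every prime. -/
theorem henselLoop_some (hT : IsTri T n) (hk : k < n) {a₀ b₀ s t : (IterPoly (ZMod p) k)[X]}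
    (ha : a₀.Monic) (hb : b₀.Monic)
    (hdeg : a₀.natDegree + b₀.natDegree = (T k).natDegree)
    (hst : quoPoly (redTri p T) k s * quoPoly (redTri p T) k a₀ +
      quoPoly (redTri p T) k t * quoPoly (redTri p T) k b₀ = 1) {B : ℕ} (m i : ℕ)
    {u v : (IterPoly ℤ k)[X]} (hu : u.Monic) (hv : v.Monic) (hud : u.natDegree = a₀.natDegree)
    (hvd : v.natDegree = b₀.natDegree) (hur : IsReducedPoly (mainDeg T) k u)
    {r : (IterPoly ℚ k)[X] × (IterPoly ℚ k)[X]}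
    (hr : henselLoop T k p (T k) a₀ b₀ s t B m i u v = some r) :
    r.1.Monic ∧ r.1.natDegree = a₀.natDegree ∧ IsReducedPoly (mainDeg T) k r.1 ∧
      Divides T k r.1 (T k) ∧ r.2 = nfPoly T k (T k /ₘ r.1) := by
  have hTp := hT.redTri p
  have := hTp.nontrivial hk.le
  induction m generalizing i u v with
  | zero => simp [henselLoop] at hr
  | succ m ih =>
    rw [henselLoop] at hr
    set e := nfPoly T k (T k - mapPoly (fun x : ℤ => (x : ℚ)) k u *
      mapPoly (fun x : ℤ => (x : ℚ)) k v) with he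
    set c := mapPoly (fun x : ℚ => redRat p (x / (p : ℚ) ^ i)) k e with hc
    set q := nfPoly (redTri p T) k ((c * s) /ₘ b₀) with hq
    set σ := nfPoly (redTri p T) k ((c * s) %ₘ b₀) with hσ
    set τ := nfPoly (redTri p T) k (c * t + q * a₀) with hτ
    -- The continuation, reached both when reconstruction fails and when trial division does. Only
    -- monicity, degrees and reducedness are carried along; no congruence `f ≡ u v` is needed.
    have hnext : ∀ {r'}, (if 2 * B < p ^ i then none else
        henselLoop T k p (T k) a₀ b₀ s t B m (i + 1)
          (u + ((p ^ i : ℕ) : (IterPoly ℤ k)[X]) * mapPoly (liftInt p) k τ)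
          (v + ((p ^ i : ℕ) : (IterPoly ℤ k)[X]) * mapPoly (liftInt p) k σ)) = some r' →
        r' = r → r.1.Monic ∧ r.1.natDegree = a₀.natDegree ∧ IsReducedPoly (mainDeg T) k r.1 ∧
          Divides T k r.1 (T k) ∧ r.2 = nfPoly T k (T k /ₘ r.1) := by
      rintro r' hr' rfl
      split_ifs at hr' with hB
      have hσd : σ.degree < b₀.degree :=
        (degree_nfPoly_le hTp hk.le _).trans_lt (degree_modByMonic_lt _ hb)
      have hτr : IsReducedPoly (mainDeg (redTri p T)) k τ := isReducedPoly_nfPoly hTp hk.le _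
      have hed : e.degree < (T k).degree := by
        refine (degree_nfPoly_le hT hk.le _).trans_lt ?_
        obtain ⟨hum, hun⟩ := mapPoly_monic (fun x : ℤ => (x : ℚ)) Int.cast_zero Int.cast_one k hu
        obtain ⟨hvm, hvn⟩ := mapPoly_monic (fun x : ℤ => (x : ℚ)) Int.cast_zero Int.cast_one k hv
        refine degree_sub_lt_of_monic (hT k hk).1 (hum.mul hvm) ?_
        rw [hum.natDegree_mul hvm, hun, hvn, hud, hvd, hdeg]
      have hcd : c.degree < a₀.degree + b₀.degree := by
        refine (degree_mapPoly_le _ (redRat_div_zero p i) k e).trans_lt (hed.trans_eq ?_)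
        rw [degree_eq_natDegree (hT k hk).1.ne_zero, degree_eq_natDegree ha.ne_zero,
          degree_eq_natDegree hb.ne_zero, ← hdeg]
        rfl
      have ham : (quoPoly (redTri p T) k a₀).Monic := ha.map _
      have hbm : (quoPoly (redTri p T) k b₀).Monic := hb.map _
      have had : (quoPoly (redTri p T) k a₀).degree = a₀.degree := ha.degree_map _
      have hbd : (quoPoly (redTri p T) k b₀).degree = b₀.degree := hb.degree_map _
      have hdiv : quoPoly (redTri p T) k ((c * s) /ₘ b₀) =
          (quoPoly (redTri p T) k c * quoPoly (redTri p T) k s) /ₘ quoPoly (redTri p T) k b₀ := by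
        rw [← map_mul]
        exact map_divByMonic _ hb
      have hτd : τ.degree < a₀.degree := by
        rw [← degree_quoPoly hTp hk.le hτr, hτ, quoPoly_nfPoly hTp hk.le, map_add, map_mul, map_mul,
          hq, quoPoly_nfPoly hTp hk.le, hdiv, ← had]
        refine degree_bezout_solve_lt ham hbm hst ?_
        rw [had, hbd]
        exact degree_map_le.trans_lt hcd
      have hτ' : (((p ^ i : ℕ) : (IterPoly ℤ k)[X]) * mapPoly (liftInt p) k τ).degree < u.degree := by
        rw [degree_eq_natDegree hu.ne_zero, hud, ← degree_eq_natDegree ha.ne_zero]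
        exact (degree_natCast_mul_le _ _).trans_lt
          ((degree_mapPoly_le _ liftInt_zero k τ).trans_lt hτd)
      have hσ' : (((p ^ i : ℕ) : (IterPoly ℤ k)[X]) * mapPoly (liftInt p) k σ).degree < v.degree := by
        rw [degree_eq_natDegree hv.ne_zero, hvd, ← degree_eq_natDegree hb.ne_zero]
        exact (degree_natCast_mul_le _ _).trans_lt
          ((degree_mapPoly_le _ liftInt_zero k σ).trans_lt hσd)
      refine ih (i + 1) (hu.add_of_left hτ') (hv.add_of_left hσ') ?_ ?_ ?_ hr'
      · rw [natDegree_add_eq_left_of_degree_lt hτ', hud]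
      · rw [natDegree_add_eq_left_of_degree_lt hσ', hvd]
      · exact hur.add ((isReducedPoly_liftInt hT hk.le hτr).natCast_mul _)
    cases hrec : ratReconPoly (p ^ i) k u with
    | none =>
      simp only [hrec] at hr
      exact hnext hr rfl
    | some a =>
      simp only [hrec] at hr
      by_cases hd : Divides T k a (T k)
      · rw [if_pos hd] at hr
        obtain rfl := Option.some.inj hr
        -- Divisibility has just been tested over `ℚ`, and the degree is that of the modular factor,
        -- so properness does not depend on the prime.
        obtain ⟨f, hf0, hf1, rfl⟩ := ratReconPoly_spec hrec
        obtain ⟨h1, h2⟩ := mapPoly_monic f hf0 hf1 k hu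
        exact ⟨h1, h2.trans hud, hur.mapPoly f hf0, hd, rfl⟩
      · rw [if_neg hd] at hr
        exact hnext hr rfl

theorem intCast_comp_incl (u : (IterPoly ℤ k)[X]) :
    (u.map (mapHom (Int.castRingHom (pInt p)) k)).map (incl p k) =
      u.map (mapHom (Int.castRingHom ℚ) k) := by
  rw [← mapPoly_ringHom, ← mapPoly_ringHom, ← mapPoly_ringHom,
    mapPoly_mapPoly _ _ (map_zero _) (map_zero _)]
  congr 1

theorem map_intCast_liftInt (a : (IterPoly (ZMod p) k)[X]) :
    (mapPoly (liftInt p) k a).map (mapHom (Int.castRingHom (pInt p)) k) =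
      mapPoly (liftPInt p) k a := by
  rw [← mapPoly_ringHom, mapPoly_mapPoly _ _ liftInt_zero (map_zero _)]
  rfl

theorem ratCong_of_eq {M : ℕ} {x : ℤ} {q y : pInt p} {i : ℕ} (hM : M = p ^ i)
    (h : q - (x : pInt p) = (M : pInt p) * y) : RatCong M x q := by
  have hq : Nat.Coprime (q : ℚ).den p :=
    ((Nat.Prime.coprime_iff_not_dvd hp.1).2 q.2).symm
  have hy : Nat.Coprime (y : ℚ).den p :=
    ((Nat.Prime.coprime_iff_not_dvd hp.1).2 y.2).symm
  refine ⟨hM ▸ hq.pow_right i, ?_⟩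
  have h1 : (q : ℚ) - x = M * (y : ℚ) := by
    have := congrArg (fun z : pInt p => (z : ℚ)) h
    push_cast at this
    exact this
  have h2 : ((y : ℚ).den : ℤ) * ((q : ℚ).num - (q : ℚ).den * x) =
      M * ((y : ℚ).num * (q : ℚ).den) := by
    have e1 := Rat.mul_den_eq_num (q : ℚ)
    have e2 := Rat.mul_den_eq_num (y : ℚ)
    have : (((y : ℚ).den : ℤ) * ((q : ℚ).num - (q : ℚ).den * x) : ℚ) =
        M * ((y : ℚ).num * (q : ℚ).den) := by
      rw [← e1, ← e2]
      push_cast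
      linear_combination ((y : ℚ).den * (q : ℚ).den : ℚ) * h1
    exact_mod_cast this
  refine IsCoprime.dvd_of_dvd_mul_left (x := (M : ℤ)) (y := ((y : ℚ).den : ℤ)) ?_ ⟨_, h2⟩
  exact Nat.isCoprime_iff_coprime.2 (hM ▸ (hy.pow_right i).symm)

theorem eq_zero_of_natCast_mul {x : IterPoly (pInt p) k} {m : ℕ} (hm : m ≠ 0)
    (h : (m : IterPoly (pInt p) k) * x = 0) : x = 0 := by
  refine baseCoeff_ext k _ _ fun e => ?_
  have := congrArg (baseCoeff k · e) h
  simp only [baseCoeff_natCast_mul, baseCoeff_zero] at this ⊢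
  exact (mul_eq_zero.1 this).resolve_left (Nat.cast_ne_zero.2 hm)

theorem degree_le_of_natCast_mul {x y : (IterPoly (pInt p) k)[X]} {m : ℕ} (hm : m ≠ 0)
    (h : y = (m : (IterPoly (pInt p) k)[X]) * x) : x.degree ≤ y.degree := by
  rw [degree_le_iff_coeff_zero]
  intro j hj
  refine eq_zero_of_natCast_mul hm ?_
  rw [← nsmul_eq_mul, ← coeff_smul, nsmul_eq_mul, ← h, coeff_eq_zero_of_degree_lt hj]

theorem isReducedPoly_of_natCast_mul {d : ℕ → ℕ} {x y : (IterPoly (pInt p) k)[X]} {m : ℕ}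
    (hm : m ≠ 0) (h : y = (m : (IterPoly (pInt p) k)[X]) * x) (hy : IsReducedPoly d k y) :
    IsReducedPoly d k x := by
  intro i e he
  refine hy i e ?_
  rw [h, ← nsmul_eq_mul, coeff_smul, nsmul_eq_mul, baseCoeff_natCast_mul]
  exact mul_ne_zero (Nat.cast_ne_zero.2 hm) he

theorem mapPoly_redRat_div (i : ℕ) (y : (IterPoly (pInt p) k)[X]) :
    mapPoly (fun x : ℚ => redRat p (x / (p : ℚ) ^ i)) k
      ((((p ^ i : ℕ) : (IterPoly (pInt p) k)[X]) * y).map (incl p k)) = y.map (redI p k) := by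
  have h0 : (fun x : ℚ => redRat p (x / (p : ℚ) ^ i)) 0 = 0 := redRat_div_zero p i
  ext j
  rw [mapPoly_coeff _ h0, coeff_map, coeff_map]
  refine baseCoeff_ext k _ _ fun e => ?_
  rw [baseCoeff_mapBase _ h0, baseCoeff_mapHom, baseCoeff_mapHom, ← nsmul_eq_mul, coeff_smul,
    nsmul_eq_mul, baseCoeff_natCast_mul, redHom_apply]
  congr 1
  have : (p : ℚ) ≠ 0 := Nat.cast_ne_zero.2 hp.1.ne_zero
  simp only [map_mul, map_natCast, Subring.subtype_apply]
  push_cast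
  rw [mul_div_cancel_left₀ _ (pow_ne_zero i this)]

/-- The loop tries reconstruction before it tests the bound, so the first exponent with `p ^ i > 2
B` still gets its chance, and by then the modulus exceeds the threshold of the true factor. -/
theorem henselLoop_ne_none_of_lt {W : (IterPoly (pInt p) k)[X]}
    (hdvd : Divides T k (W.map (incl p k)) (T k)) {a₀ b₀ s t : (IterPoly (ZMod p) k)[X]}
    {M₀ B : ℕ} (hM₀ : ∀ M ≥ M₀, ∀ u, RatCongPoly M k u (W.map (incl p k)) →
      ratReconPoly M k u = some (W.map (incl p k))) (hB : M₀ ≤ 2 * B) (m i : ℕ)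
    (hi : 2 * B < p ^ i) {u v : (IterPoly ℤ k)[X]} {D : (IterPoly (pInt p) k)[X]}
    (hD : W - u.map (mapHom (Int.castRingHom (pInt p)) k) =
      ((p ^ i : ℕ) : (IterPoly (pInt p) k)[X]) * D) :
    henselLoop T k p (T k) a₀ b₀ s t B (m + 1) i u v ≠ none := by
  have hsome : ratReconPoly (p ^ i) k u = some (W.map (incl p k)) := by
    refine hM₀ _ (by omega) _ fun j e => ?_
    rw [coeff_map, baseCoeff_mapHom]
    refine ratCong_of_eq (y := baseCoeff k (D.coeff j) e) rfl ?_
    have := congrArg (fun z => baseCoeff k (coeff z j) e) hD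
    rwa [coeff_sub, baseCoeff_sub, coeff_map, baseCoeff_mapHom, ← nsmul_eq_mul, coeff_smul,
      nsmul_eq_mul, baseCoeff_natCast_mul] at this
  rw [henselLoop]
  simp only [hsome]
  rw [if_pos hdvd]
  simp

/-- At a good prime, the lifting follows the factorization over `ℚ` and finds it if the bound is
large enough. -/
theorem henselLoop_ne_none (hT : IsTri T n) (hk : k < n) (hint : ∀ i < n, IsInt p i (T i))
    {W V : (IterPoly (pInt p) k)[X]} (hV : V.Monic)
    (hWr : IsReducedPoly (mainDeg T) k W) (hVr : IsReducedPoly (mainDeg T) k V)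
    (hWV : quoPoly (intTri p T) k (intTri p T k) =
      quoPoly (intTri p T) k W * quoPoly (intTri p T) k V)
    (hdvd : Divides T k (W.map (incl p k)) (T k))
    {s t : (IterPoly (ZMod p) k)[X]}
    (hst : quoPoly (redTri p T) k s * quoPoly (redTri p T) k (W.map (redI p k)) +
      quoPoly (redTri p T) k t * quoPoly (redTri p T) k (V.map (redI p k)) = 1)
    {M₀ B : ℕ} (hM₀ : ∀ M ≥ M₀, ∀ u, RatCongPoly M k u (W.map (incl p k)) →
      ratReconPoly M k u = some (W.map (incl p k))) (hB : M₀ ≤ 2 * B) (m i : ℕ) (hi : 1 ≤ i)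
    (hmi : 2 * B < p ^ (i + m)) {u v : (IterPoly ℤ k)[X]} {D E : (IterPoly (pInt p) k)[X]}
    (hD : W - u.map (mapHom (Int.castRingHom (pInt p)) k) =
      ((p ^ i : ℕ) : (IterPoly (pInt p) k)[X]) * D)
    (hE : V - v.map (mapHom (Int.castRingHom (pInt p)) k) =
      ((p ^ i : ℕ) : (IterPoly (pInt p) k)[X]) * E)
    (hv : v.Monic) (hvd : v.natDegree = V.natDegree) (hur : IsReducedPoly (mainDeg T) k u)
    (hvr : IsReducedPoly (mainDeg T) k v) :
    henselLoop T k p (T k) (W.map (redI p k)) (V.map (redI p k)) s t B (m + 1) i u v ≠ none := by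
  have hTp := hT.redTri p
  have hS := hT.intTri p
  have := hTp.nontrivial hk.le
  have hpi : ∀ i, p ^ i ≠ 0 := fun i => pow_ne_zero i hp.1.ne_zero
  have hmd : ∀ j < k, mainDeg T j = mainDeg (redTri p T) j := fun j hj =>
    (mainDeg_mapTri (redRat_zero p) (redRat_one p) hT (by omega)).symm
  have hmd' : ∀ j < k, mainDeg T j = mainDeg (intTri p T) j := fun j hj =>
    (mainDeg_mapTri (toPInt_zero p) (toPInt_one p) hT (by omega)).symm
  induction m generalizing i u v D E with
  | zero => exact henselLoop_ne_none_of_lt hdvd hM₀ hB 0 i hmi hD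
  | succ m ih =>
    by_cases h2 : 2 * B < p ^ i
    · exact henselLoop_ne_none_of_lt hdvd hM₀ hB _ i h2 hD
    set a₀ := W.map (redI p k) with ha₀
    set b₀ := V.map (redI p k) with hb₀
    have hb₀m : b₀.Monic := hV.map _
    set uz := u.map (mapHom (Int.castRingHom (pInt p)) k) with huz
    set vz := v.map (mapHom (Int.castRingHom (pInt p)) k) with hvz
    set S := intTri p T with hSd
    set Y := nfPoly S k (W * E + D * vz) with hY
    -- From `W V - u v = (W - u) v + W (V - v)`: the error is exactly `p ^ i` times `W E + D v`, so
    -- `c` below is the reduction of that quotient.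
    have hfac : nfPoly S k (S k - uz * vz) = ((p ^ i : ℕ) : (IterPoly (pInt p) k)[X]) * Y := by
      refine eq_of_quoPoly_eq hS hk.le (isReducedPoly_nfPoly hS hk.le _)
        ((isReducedPoly_nfPoly hS hk.le _).natCast_mul _) ?_
      rw [quoPoly_nfPoly hS hk.le, map_mul, hY, quoPoly_nfPoly hS hk.le, ← map_mul, map_sub, hWV,
        ← map_mul, ← map_sub]
      congr 1
      linear_combination vz * hD + W * hE
    set e := nfPoly T k (T k - mapPoly (fun x : ℤ => (x : ℚ)) k u *
      mapPoly (fun x : ℤ => (x : ℚ)) k v) with he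
    have hee : e = (((p ^ i : ℕ) : (IterPoly (pInt p) k)[X]) * Y).map (incl p k) := by
      rw [← hfac, ← nfPoly_map_incl p hT hint hk.le, Polynomial.map_sub, Polynomial.map_mul,
        intCast_comp_incl, intCast_comp_incl, he, mapPoly_intCast, mapPoly_intCast,
        ← map_incl_intTri p hint k hk]
    set c := mapPoly (fun x : ℚ => redRat p (x / (p : ℚ) ^ i)) k e with hc
    have hcY : c = Y.map (redI p k) := by rw [hc, hee, mapPoly_redRat_div]
    have hpz : ((p ^ i : ℕ) : (IterPoly (ZMod p) k)[X]) = 0 := by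
      have h1 : (p : (IterPoly (ZMod p) k)[X]) = 0 := by
        have : (p : (IterPoly (ZMod p) k)[X]) * 1 = 0 := by
          refine Polynomial.ext fun j => baseCoeff_ext k _ _ fun e => ?_
          rw [← nsmul_eq_mul, coeff_smul, nsmul_eq_mul, baseCoeff_natCast_mul, ZMod.natCast_self,
            zero_mul, coeff_zero, baseCoeff_zero]
        rwa [mul_one] at this
      rw [Nat.cast_pow, h1, zero_pow (by omega)]
    have hvb : vz.map (redI p k) = b₀ := by
      have := congrArg (Polynomial.map (redI p k)) hE
      rw [Polynomial.map_sub, Polynomial.map_mul, Polynomial.map_natCast, hpz, zero_mul,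
        sub_eq_zero] at this
      exact this.symm
    have hQc : quoPoly (redTri p T) k c = quoPoly (redTri p T) k a₀ *
        quoPoly (redTri p T) k (E.map (redI p k)) +
        quoPoly (redTri p T) k (D.map (redI p k)) * quoPoly (redTri p T) k b₀ := by
      rw [hcY, hY, ← nfPoly_map_redI p hT hint hk.le, quoPoly_nfPoly hTp hk.le, Polynomial.map_add,
        Polynomial.map_mul, Polynomial.map_mul, hvb, map_add, map_mul, map_mul]
    have hEd : E.degree < V.degree := by
      refine (degree_le_of_natCast_mul (hpi i) hE).trans_lt
        (degree_sub_lt_of_monic hV (hv.map _) ?_)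
      rw [hv.natDegree_map, hvd]
    have hDr : IsReducedPoly (mainDeg T) k D := by
      refine isReducedPoly_of_natCast_mul (hpi i) hD (hWr.sub ?_)
      rw [huz, ← mapPoly_ringHom]
      exact hur.mapPoly _ (map_zero _)
    have hdb : (quoPoly (redTri p T) k b₀).degree = V.degree := by
      rw [← hV.degree_map (redI p k)]
      exact hb₀m.degree_map _
    have hbQ : (quoPoly (redTri p T) k b₀).Monic := hb₀m.map _
    -- The true discrepancies `E` and `D` solve the congruence for `c` modulo `p`, and `deg E < deg
    -- V` because `V` and `v` are monic of equal degree. By uniqueness they are the computed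
    -- corrections `σ` and `τ`.
    obtain ⟨hx, hy⟩ := bezout_solve_unique hbQ hst hQc (by
      rw [hdb]
      exact degree_map_le.trans_lt (degree_map_le.trans_lt hEd))
    set q := nfPoly (redTri p T) k ((c * s) /ₘ b₀) with hq
    set σ := nfPoly (redTri p T) k ((c * s) %ₘ b₀) with hσ
    set τ := nfPoly (redTri p T) k (c * t + q * a₀) with hτ
    have hdiv : quoPoly (redTri p T) k ((c * s) /ₘ b₀) =
        (quoPoly (redTri p T) k c * quoPoly (redTri p T) k s) /ₘ quoPoly (redTri p T) k b₀ := by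
      rw [← map_mul]
      exact map_divByMonic _ hb₀m
    have hmod : quoPoly (redTri p T) k ((c * s) %ₘ b₀) =
        (quoPoly (redTri p T) k c * quoPoly (redTri p T) k s) %ₘ quoPoly (redTri p T) k b₀ := by
      rw [← map_mul]
      exact map_modByMonic _ hb₀m
    have hτD : τ = D.map (redI p k) := by
      refine eq_of_quoPoly_eq hTp hk.le (isReducedPoly_nfPoly hTp hk.le _) ?_ ?_
      · rw [← mapPoly_ringHom]
        exact (hDr.mapPoly _ (map_zero _)).congr hmd
      · rw [hτ, quoPoly_nfPoly hTp hk.le, map_add, map_mul, map_mul, hq, quoPoly_nfPoly hTp hk.le,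
          hdiv, hy]
    have hEr : IsReducedPoly (mainDeg T) k E := by
      refine isReducedPoly_of_natCast_mul (hpi i) hE (hVr.sub ?_)
      rw [hvz, ← mapPoly_ringHom]
      exact hvr.mapPoly _ (map_zero _)
    have hσE : σ = E.map (redI p k) := by
      refine eq_of_quoPoly_eq hTp hk.le (isReducedPoly_nfPoly hTp hk.le _) ?_ ?_
      · rw [← mapPoly_ringHom]
        exact (hEr.mapPoly _ (map_zero _)).congr hmd
      · rw [hσ, quoPoly_nfPoly hTp hk.le, hmod, hx]
    -- Subtracting a lift of `Z mod p` leaves a multiple of `p`, so the agreement improves from `p ^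
    -- i` to `p ^ (i + 1)`, for `u` and `v` alike.
    have hstep : ∀ {A Z : (IterPoly (pInt p) k)[X]} {z : (IterPoly ℤ k)[X]}
        {ζ : (IterPoly (ZMod p) k)[X]}, ζ = Z.map (redI p k) →
        A - z.map (mapHom (Int.castRingHom (pInt p)) k) =
          ((p ^ i : ℕ) : (IterPoly (pInt p) k)[X]) * Z →
        ∃ Z', A - (z + ((p ^ i : ℕ) : (IterPoly ℤ k)[X]) * mapPoly (liftInt p) k ζ).map
          (mapHom (Int.castRingHom (pInt p)) k) =
            ((p ^ (i + 1) : ℕ) : (IterPoly (pInt p) k)[X]) * Z' := by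
      intro A Z z ζ hζ hA
      obtain ⟨Z', hZ'⟩ := exists_mul_of_map_redI_eq_zero (x := Z - mapPoly (liftPInt p) k ζ) (by
        rw [Polynomial.map_sub, map_redI_liftPInt, hζ, sub_self])
      refine ⟨Z', ?_⟩
      rw [Polynomial.map_add, Polynomial.map_mul, map_intCast_liftInt, Polynomial.map_natCast,
        pow_succ, Nat.cast_mul]
      rw [map_natCast] at hZ'
      linear_combination hA + ((p ^ i : ℕ) : (IterPoly (pInt p) k)[X]) * hZ'
    obtain ⟨D', hD'⟩ := hstep hτD hD
    obtain ⟨E', hE'⟩ := hstep hσE hE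
    have hσ' : (((p ^ i : ℕ) : (IterPoly ℤ k)[X]) * mapPoly (liftInt p) k σ).degree < v.degree := by
      refine (degree_natCast_mul_le _ _).trans_lt
        ((degree_mapPoly_le _ liftInt_zero k σ).trans_lt ?_)
      rw [hσE, degree_eq_natDegree hv.ne_zero, hvd, ← degree_eq_natDegree hV.ne_zero]
      exact degree_map_le.trans_lt hEd
    have hne := ih (i + 1) (by omega) (by rwa [add_right_comm, add_assoc]) hD' hE'
      (hv.add_of_left hσ') (by rw [natDegree_add_eq_left_of_degree_lt hσ', hvd])
      (hur.add ((isReducedPoly_liftInt hT hk.le (isReducedPoly_nfPoly hTp hk.le _)).natCast_mul _))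
      (hvr.add ((isReducedPoly_liftInt hT hk.le (isReducedPoly_nfPoly hTp hk.le _)).natCast_mul _))
    rw [henselLoop]
    cases hrec : ratReconPoly (p ^ i) k u with
    | none =>
      simp only
      rw [if_neg h2]
      exact hne
    | some a =>
      simp only
      by_cases hd : Divides T k a (T k)
      · rw [if_pos hd]
        simp
      · rw [if_neg hd, if_neg h2]
        exact hne

end hensel

/-! ### Complementary factors -/

section cofactor

variable {F : Type} [CommRing F] [Nontrivial F] {T : TriSet F} {n k : ℕ}

/-- The complementary factor of a monic factor of `t_k`. -/
theorem cofactor_spec (hT : IsTri T n) (hk : k < n) {u : (IterPoly F k)[X]} (hu : u.Monic)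
    (hd : quoPoly T k u ∣ quoPoly T k (T k)) :
    (nfPoly T k (T k /ₘ u)).Monic ∧
      u.natDegree + (nfPoly T k (T k /ₘ u)).natDegree = (T k).natDegree ∧
      IsReducedPoly (mainDeg T) k (nfPoly T k (T k /ₘ u)) ∧
      quoPoly T k (T k) = quoPoly T k u * quoPoly T k (nfPoly T k (T k /ₘ u)) := by
  have := hT.nontrivial hk.le
  have hum : (quoPoly T k u).Monic := hu.map _
  have hTm : (quoPoly T k (T k)).Monic := (hT k hk).1.map _
  have hr := isReducedPoly_nfPoly hT hk.le (T k /ₘ u)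
  have hq : quoPoly T k (nfPoly T k (T k /ₘ u)) = quoPoly T k (T k) /ₘ quoPoly T k u := by
    rw [quoPoly_nfPoly hT hk.le]
    exact map_divByMonic _ hu
  have hmul : quoPoly T k (T k) = quoPoly T k u * quoPoly T k (nfPoly T k (T k /ₘ u)) := by
    have h := modByMonic_add_div (quoPoly T k (T k)) (quoPoly T k u)
    rw [(modByMonic_eq_zero_iff_dvd hum).2 hd, zero_add] at h
    rw [hq, h]
  have hvm : (quoPoly T k (nfPoly T k (T k /ₘ u))).Monic :=
    hum.of_mul_monic_left (hmul ▸ hTm)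
  refine ⟨monic_of_monic_quoPoly hT hk.le hr hvm, ?_, hr, hmul⟩
  have h := congrArg natDegree hmul
  rw [hum.natDegree_mul hvm, natDegree_quoPoly hT hk.le hr] at h
  rw [← hu.natDegree_map (quo T k), ← (hT k hk).1.natDegree_map (quo T k)]
  exact h.symm

end cofactor

/-! ### The answers of the Hensel lifting -/

section henselLift

variable {p : ℕ} [hp : Fact p.Prime] {T : TriSet ℚ} {n : ℕ}

theorem IsBezout.comb_one {F : Type} [CommRing F] {T : TriSet F} {k : ℕ}
    {a b : (IterPoly F k)[X]} {e : Bezout F k} (h : IsBezout T k a b e) (h1 : e.g = 1) :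
    quoPoly T k e.s * quoPoly T k a + quoPoly T k e.t * quoPoly T k b = 1 := by
  rw [← h.comb, h1, map_one]

theorem ZeroDiv.IsValid.ne_zero {F : Type} [CommRing F] [Nontrivial F] {T : TriSet F} {N : ℕ}
    {z : ZeroDiv F} (h : z.IsValid T N) : z.poly ≠ 0 := h.monic.ne_zero

/-- The zero-divisors met by the extended Euclidean algorithm have a smaller level. -/
theorem henselLift_zeroDivisor (hT : IsTri T n) {w : ZeroDiv (ZMod p)}
    (hw : w.IsValid (redTri p T) n) {B : ℕ} {w' : ZeroDiv (ZMod p)}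
    (h : henselLift T w.level p (T w.level) w.poly
      (nfPoly (redTri p T) w.level (redTri p T w.level /ₘ w.poly)) B = .zeroDivisor w') :
    w'.IsValid (redTri p T) w.level := by
  have hTp := hT.redTri p
  obtain ⟨-, -, hvr, -⟩ := cofactor_spec hTp hw.level_lt hw.monic hw.dvd
  rw [henselLift] at h
  cases he : monicExtGcd (redTri p T) w.level w.poly
      (nfPoly (redTri p T) w.level (redTri p T w.level /ₘ w.poly)) with
  | error z =>
    simp only [he, HenselResult.zeroDivisor.injEq] at h
    subst h
    exact monicExtGcd_error hTp hw.level_lt.le hw.reduced hvr he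
  | ok e =>
    simp only [he] at h
    split_ifs at h
    split at h <;> cases h

/-- A successful lifting yields a proper factorization. -/
theorem henselLift_factors (hT : IsTri T n) {w : ZeroDiv (ZMod p)}
    (hw : w.IsValid (redTri p T) n) {B : ℕ} {u v : (IterPoly ℚ w.level)[X]}
    (h : henselLift T w.level p (T w.level) w.poly
      (nfPoly (redTri p T) w.level (redTri p T w.level /ₘ w.poly)) B = .factors u v) :
    (ZeroDiv.mk w.level u).IsValid T n ∧ v = nfPoly T w.level (T w.level /ₘ u) := by
  have hTp := hT.redTri p
  have hk := hw.level_lt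
  obtain ⟨hvm, hvd, hvr, -⟩ := cofactor_spec hTp hk hw.monic hw.dvd
  have hmd : (redTri p T w.level).natDegree = (T w.level).natDegree :=
    mainDeg_mapTri (redRat_zero p) (redRat_one p) hT hk
  rw [henselLift] at h
  cases he : monicExtGcd (redTri p T) w.level w.poly
      (nfPoly (redTri p T) w.level (redTri p T w.level /ₘ w.poly)) with
  | error z => simp [he] at h
  | ok e =>
    simp only [he] at h
    have hb := monicExtGcd_spec hTp hk.le hw.reduced hvr (fun h0 => hw.ne_zero h0.1) he
    split_ifs at h with h1
    split at h
    · cases h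
    · next uv hr =>
      obtain ⟨rfl, rfl⟩ := HenselResult.factors.inj h
      obtain ⟨hum, hun⟩ := mapPoly_monic (liftInt p) liftInt_zero liftInt_one _ hw.monic
      obtain ⟨hvm', hvn⟩ := mapPoly_monic (liftInt p) liftInt_zero liftInt_one _ hvm
      obtain ⟨r1, r2, r3, r4, r5⟩ := henselLoop_some hT hk hw.monic hvm (hvd.trans hmd)
        (hb.comb_one h1) _ _ hum hvm' hun hvn (isReducedPoly_liftInt hT hk.le hw.reduced) hr
      refine ⟨⟨hk, r1, r3, ?_, ?_, (divides_iff hT hk.le _ _).1 r4⟩, r5⟩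
      · rw [r2]; exact hw.pos
      · rw [r2]; exact hw.lt.trans_eq hmd

theorem sub_map_liftInt {k : ℕ} (W : (IterPoly (pInt p) k)[X]) :
    ∃ D, W - (mapPoly (liftInt p) k (W.map (redI p k))).map
      (mapHom (Int.castRingHom (pInt p)) k) = ((p ^ 1 : ℕ) : (IterPoly (pInt p) k)[X]) * D := by
  rw [map_intCast_liftInt]
  obtain ⟨y, hy⟩ := exists_mul_of_map_redI_eq_zero
    (x := W - mapPoly (liftPInt p) k (W.map (redI p k))) (by
      rw [Polynomial.map_sub, map_redI_liftPInt, sub_self])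
  exact ⟨y, by rw [hy, pow_one, map_natCast]⟩

/-- Normal forms over `pInt p` embed into those over `ℚ`, so a relation over `ℚ` between integral
polynomials already holds over `pInt p`. -/
theorem map_toPInt_eq (hT : IsTri T n) (hint : ∀ i < n, IsInt p i (T i)) {k : ℕ} (hk : k ≤ n)
    {a b : (IterPoly (pInt p) k)[X]}
    (h : quoPoly T k (a.map (incl p k)) = quoPoly T k (b.map (incl p k))) :
    quoPoly (intTri p T) k a = quoPoly (intTri p T) k b := by
  have hS := hT.intTri p
  rw [← sub_eq_zero, ← map_sub, ← nfPoly_eq_zero_iff hS hk]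
  refine Polynomial.map_injective (incl p k) (mapHom_injective _ Subtype.val_injective k) ?_
  rw [← nfPoly_map_incl p hT hint hk, Polynomial.map_zero, nfPoly_eq_zero_iff hT hk,
    Polynomial.map_sub, map_sub, h, sub_self]

/-- Over almost all primes, the reduction of a coprime factorization over `ℚ` is lifted as soon as
the bound is large enough. -/
theorem eventually_henselLift_factors (hT : IsTri T n) {w : ZeroDiv ℚ} (hw : w.IsValid T n)
    {e : Bezout ℚ w.level}
    (he : monicExtGcd T w.level w.poly (nfPoly T w.level (T w.level /ₘ w.poly)) = .ok e)
    (h1 : e.g = 1) : ∃ B₀, ∀ᶠ p : Nat.Primes in cofinite, ∀ B ≥ B₀, ∃ u v,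
      henselLift T w.level p (T w.level) (redPoly p w.level w.poly)
        (nfPoly (redTri p T) w.level (redTri p T w.level /ₘ redPoly p w.level w.poly)) B =
        .factors u v := by
  obtain ⟨k, f⟩ := w
  have hk : k < n := hw.level_lt
  obtain ⟨hvm, hvd, hvr, hmul⟩ := cofactor_spec hT hk hw.monic hw.dvd
  dsimp only at *
  set v := nfPoly T k (T k /ₘ f) with hv
  obtain ⟨M₀, hM₀⟩ := exists_ratReconPoly f
  refine ⟨M₀, ?_⟩
  filter_upwards [eventually_isInt_tri T n, eventually_isInt f, eventually_isInt v,
    eventually_monicExtGcd hT hk.le f v, eventually_redPoly_nfPoly hT hk.le (T k /ₘ f),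
    eventually_redPoly_divModByMonic (T k) f] with p hint hf hvi hgcd hnf hdiv B hB
  have hTp := hT.redTri p
  have hv' : nfPoly (redTri p T) k (redTri p T k /ₘ redPoly p k f) = redPoly p k v := by
    rw [hv, hnf, hdiv.1]
    rfl
  rw [hv', henselLift, hgcd, he]
  dsimp only [redExcept, Bezout.red]
  rw [if_pos (by rw [h1, redPoly_one])]
  set W := mapPoly (toPInt p) k f with hW
  set V := mapPoly (toPInt p) k v with hV
  have hWf : W.map (incl p k) = f := map_incl_toPInt p hf
  have hVv : V.map (incl p k) = v := map_incl_toPInt p hvi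
  have hVm := mapPoly_monic _ (toPInt_zero p) (toPInt_one p) k hvm
  have hfr : redPoly p k f = W.map (redI p k) := by rw [← redPoly_map_incl, hWf]
  have hvr' : redPoly p k v = V.map (redI p k) := by rw [← redPoly_map_incl, hVv]
  have hredr : ∀ {a : (IterPoly ℚ k)[X]}, IsReducedPoly (mainDeg T) k a →
      IsReducedPoly (mainDeg (redTri p T)) k (redPoly p k a) := fun ha =>
    ha.mapTri (redRat_zero p) (redRat_one p) hT hk.le
  have hb := monicExtGcd_spec hTp hk.le (hredr hw.reduced) (hredr hvr)
    (fun h0 => ((mapPoly_monic _ (redRat_zero p) (redRat_one p) k hw.monic).1).ne_zero h0.1)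
    (hgcd.trans (by rw [he]; rfl))
  have hst := hb.comb_one (show redPoly p k e.g = 1 by rw [h1, redPoly_one])
  obtain ⟨D, hD⟩ := sub_map_liftInt (p := p) W
  obtain ⟨E, hE⟩ := sub_map_liftInt (p := p) V
  have hVlift := mapPoly_monic (liftInt p) liftInt_zero liftInt_one k
    (hVm.1.map (redI p k))
  have hne := henselLoop_ne_none hT hk hint hVm.1 (hw.reduced.mapPoly _ (toPInt_zero p))
    (hvr.mapPoly _ (toPInt_zero p))
    (by
      rw [← map_mul]
      refine map_toPInt_eq hT hint hk.le ?_
      rw [Polynomial.map_mul, hWf, hVv, ← map_incl_intTri p hint k hk, map_mul]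
      exact hmul)
    (by rw [hWf]; exact (divides_iff hT hk.le _ _).2 hw.dvd)
    (by rw [← hfr, ← hvr']; exact hst) (by rw [hWf]; exact hM₀) (show M₀ ≤ 2 * B by omega)
    -- The counter `2 * B + 1` suffices when starting at exponent `1`, because `2 B < p ^ (2 B) < p
    -- ^ (1 + 2 B)`.
    (2 * B) 1 le_rfl ((Nat.lt_pow_self p.2.one_lt).trans
      (Nat.pow_lt_pow_right p.2.one_lt (by omega))) hD hE hVlift.1
    (by rw [hVlift.2, hVm.1.natDegree_map])
    (isReducedPoly_liftInt hT hk.le (hfr ▸ hredr hw.reduced))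
    (isReducedPoly_liftInt hT hk.le (hvr' ▸ hredr hvr))
  rw [← hfr, ← hvr'] at hne
  dsimp only [Bezout.red] at hne
  split
  · next h => exact absurd h hne
  · exact ⟨_, _, rfl⟩

/-- A zero-divisor modulo `p` that leads to a factorization if the bound is at least `B₀`. -/
inductive GoodZeroDiv (T : TriSet ℚ) (B₀ p : ℕ) [Fact p.Prime] : ZeroDiv (ZMod p) → Prop
  | factor (w : ZeroDiv (ZMod p)) (h : ∀ B ≥ B₀, ∃ u v,
      henselLift T w.level p (T w.level) w.poly
        (nfPoly (redTri p T) w.level (redTri p T w.level /ₘ w.poly)) B = .factors u v) :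
      GoodZeroDiv T B₀ p w
  | next (w w' : ZeroDiv (ZMod p)) (h : ∀ B, henselLift T w.level p (T w.level) w.poly
        (nfPoly (redTri p T) w.level (redTri p T w.level /ₘ w.poly)) B = .zeroDivisor w')
      (h' : GoodZeroDiv T B₀ p w') : GoodZeroDiv T B₀ p w

/-- Induction on the level, following the coprimality computation over `ℚ`. A new zero-divisor there
has smaller level and is met modulo almost all primes too. Otherwise the gcd is `1`, since the
factors of a separable polynomial are coprime, and the lifting succeeds for large bounds. -/
theorem exists_goodZeroDiv (hT : IsSepTri T n) (w : ZeroDiv ℚ) (hw : w.IsValid T n) :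
    ∃ B₀, ∀ᶠ p : Nat.Primes in cofinite, GoodZeroDiv T B₀ p (w.red p) := by
  induction hl : w.level using Nat.strong_induction_on generalizing w with
  | _ l ih =>
    have hk := hw.level_lt
    obtain ⟨hvm, hvd, hvr, hmul⟩ := cofactor_spec hT.tri hk hw.monic hw.dvd
    cases he : monicExtGcd T w.level w.poly (nfPoly T w.level (T w.level /ₘ w.poly)) with
    | error z =>
      have hz := monicExtGcd_error hT.tri hk.le hw.reduced hvr he
      obtain ⟨B₀, hB₀⟩ := ih z.level (hl ▸ hz.level_lt) z (hz.mono hk.le) rfl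
      refine ⟨B₀, ?_⟩
      filter_upwards [hB₀, eventually_redPoly_divModByMonic (T w.level) w.poly,
        eventually_redPoly_nfPoly hT.tri hk.le (T w.level /ₘ w.poly),
        eventually_monicExtGcd hT.tri hk.le w.poly (nfPoly T w.level (T w.level /ₘ w.poly))]
        with p h1 h2 h3 h4
      refine .next _ (z.red p) (fun B => ?_) h1
      have hv' : nfPoly (redTri p T) w.level (redTri p T w.level /ₘ redPoly p w.level w.poly) =
          redPoly p w.level (nfPoly T w.level (T w.level /ₘ w.poly)) := by
        rw [h3, h2.1]
        rfl
      change henselLift T w.level p (T w.level) (redPoly p w.level w.poly)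
        (nfPoly (redTri p T) w.level (redTri p T w.level /ₘ redPoly p w.level w.poly)) B = _
      rw [hv', henselLift, h4, he]
      rfl
    | ok e =>
      have hb := monicExtGcd_spec hT.tri hk.le hw.reduced hvr (fun h0 => hw.ne_zero h0.1) he
      have hs := hT.sep _ hk
      rw [hmul] at hs
      obtain ⟨B₀, hB₀⟩ := eventually_henselLift_factors hT.tri hw he
        (hb.eq_one hT.tri hk.le hs.isCoprime)
      exact ⟨B₀, hB₀.mono fun p h => .factor _ h⟩

end henselLift

/-! ### Splitting a triangular set -/

section comparison

variable {F : Type} [CommRing F] {T S : TriSet F} {k : ℕ}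

theorem quoPoly_eq_map_factor (h : triIdeal T k ≤ triIdeal S k) (a : (IterPoly F k)[X]) :
    quoPoly S k a = (quoPoly T k a).map (Ideal.Quotient.factor h) := by
  ext i
  rw [coeff_map, coeff_quoPoly, coeff_quoPoly]
  rfl

theorem quoPoly_dvd_mono (h : triIdeal T k ≤ triIdeal S k) {a b : (IterPoly F k)[X]}
    (hab : quoPoly T k a ∣ quoPoly T k b) : quoPoly S k a ∣ quoPoly S k b := by
  rw [quoPoly_eq_map_factor h, quoPoly_eq_map_factor h]
  exact Polynomial.map_dvd _ hab

theorem separable_quoPoly_mono (h : triIdeal T k ≤ triIdeal S k) {a : (IterPoly F k)[X]}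
    (ha : (quoPoly T k a).Separable) : (quoPoly S k a).Separable := by
  rw [quoPoly_eq_map_factor h]
  exact ha.map

/-- The divisibility at level `i` may use the inclusion below it, which is needed to carry
divisibilities from `T` over to `S`. -/
theorem triIdeal_le (h : ∀ i < k, triIdeal T i ≤ triIdeal S i →
    quoPoly S i (S i) ∣ quoPoly S i (T i)) : triIdeal T k ≤ triIdeal S k := by
  induction k with
  | zero => exact le_rfl
  | succ k ih =>
    have ih := ih fun i hi => h i (by omega)
    change ((triIdeal T k).map C ⊔ Ideal.span {T k} : Ideal (IterPoly F k)[X]) ≤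
      ((triIdeal S k).map C ⊔ Ideal.span {S k} : Ideal (IterPoly F k)[X])
    refine sup_le ((Ideal.map_mono ih).trans le_sup_left) ?_
    rw [Ideal.span_singleton_le_iff_mem]
    exact (mem_triIdeal_succ S k (T k)).2 (h k (Nat.lt_succ_self k) ih)

theorem nf_congr (h : ∀ i < k, T i = S i) : nf T k = nf S k := by
  induction k with
  | zero => rfl
  | succ k ih =>
    funext a
    change mapCoeffs (nf T k) ((show (IterPoly F k)[X] from a) %ₘ T k) =
      mapCoeffs (nf S k) ((show (IterPoly F k)[X] from a) %ₘ S k)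
    rw [ih fun i hi => h i (by omega), h k (Nat.lt_succ_self k)]

theorem nfPoly_congr (h : ∀ i < k, T i = S i) (a : (IterPoly F k)[X]) :
    nfPoly T k a = nfPoly S k a := by
  rw [nfPoly, nfPoly, nf_congr h]

theorem nfPoly_monic [Nontrivial F] {n : ℕ} (hT : IsTri T n) (hk : k ≤ n)
    {a : (IterPoly F k)[X]} (ha : a.Monic) :
    (nfPoly T k a).Monic ∧ (nfPoly T k a).natDegree = a.natDegree := by
  have := hT.nontrivial hk
  have hm : (quoPoly T k (nfPoly T k a)).Monic := by
    rw [quoPoly_nfPoly hT hk]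
    exact ha.map _
  have hr := isReducedPoly_nfPoly hT hk a
  refine ⟨monic_of_monic_quoPoly hT hk hr hm, ?_⟩
  rw [← natDegree_quoPoly hT hk hr, quoPoly_nfPoly hT hk]
  exact ha.natDegree_map _

end comparison

/-! ### Replacing one polynomial of a triangular set -/

section replace

variable {F : Type} [CommRing F] {T : TriSet F} {k n : ℕ} {w : (IterPoly F k)[X]}

theorem replaceAt_self (m : ℕ) : replaceAt T k w m k = w := by
  induction m with
  | zero => exact Function.update_self _ _ _
  | succ m ih =>
    rw [replaceAt]
    split_ifs with h
    · rw [Function.update_of_ne h.ne, ih]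
    · exact ih

theorem replaceAt_of_le (m : ℕ) {i : ℕ} (h : i < k ∨ k < i ∧ m ≤ i) : replaceAt T k w m i = T i := by
  induction m with
  | zero => exact Function.update_of_ne (by omega) _ _
  | succ m ih =>
    rw [replaceAt]
    split_ifs with h'
    · rw [Function.update_of_ne (by omega), ih (by omega)]
    · exact ih (by omega)

theorem replaceAt_of_lt {m i : ℕ} (hk : k < i) (hi : i < m) :
    replaceAt T k w m i = nfPoly (replaceAt T k w i) i (T i) := by
  induction m with
  | zero => omega
  | succ m ih =>
    rw [replaceAt]
    rcases Nat.lt_succ_iff_lt_or_eq.1 hi with h | rfl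
    · split_ifs
      · rw [Function.update_of_ne h.ne, ih h]
      · exact ih h
    · rw [if_pos hk, Function.update_self, replaceAt_of_le _ (Or.inr ⟨hk, le_rfl⟩)]

/-- Normal forms at level `i` see only entries below `i`, which later replacements leave alone; so
the final set may stand in for the intermediate one. -/
theorem replaceAt_of_gt {m i : ℕ} (hk : k < i) (hi : i < m) :
    replaceAt T k w m i = nfPoly (replaceAt T k w m) i (T i) := by
  rw [replaceAt_of_lt hk hi]
  refine nfPoly_congr (fun j hj => ?_) _
  rcases lt_trichotomy j k with h | rfl | h
  · rw [replaceAt_of_le _ (Or.inl h), replaceAt_of_le _ (Or.inl h)]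
  · rw [replaceAt_self, replaceAt_self]
  · rw [replaceAt_of_lt h hj, replaceAt_of_lt h (hj.trans hi)]

/-- The dimension of `R_n` over the base field. -/
def triDim (T : TriSet F) (n : ℕ) : ℕ := ∏ i ∈ Finset.range n, (T i).natDegree

theorem triDim_pos (hT : IsTri T n) : 0 < triDim T n :=
  Finset.prod_pos fun i hi => (hT i (Finset.mem_range.1 hi)).2.1

variable [Nontrivial F]

theorem isTri_replaceAt (hT : IsTri T n) (hw : (ZeroDiv.mk k w).IsValid T n) :
    IsTri (replaceAt T k w n) n ∧
      ∀ i < n, i ≠ k → (replaceAt T k w n i).natDegree = (T i).natDegree := by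
  have key : ∀ m ≤ n, IsTri (replaceAt T k w n) m ∧
      ∀ i < m, i ≠ k → (replaceAt T k w n i).natDegree = (T i).natDegree := by
    intro m hm
    induction m with
    | zero => exact ⟨fun i hi => absurd hi (by omega), fun i hi => absurd hi (by omega)⟩
    | succ m ih =>
      obtain ⟨h1, h2⟩ := ih (by omega)
      obtain ⟨t1, t2, t3⟩ := hT m hm
      have key : ((replaceAt T k w n m).Monic ∧ 0 < (replaceAt T k w n m).natDegree ∧
          IsReducedPoly (mainDeg (replaceAt T k w n)) m (replaceAt T k w n m)) ∧
          (m ≠ k → (replaceAt T k w n m).natDegree = (T m).natDegree) := by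
        rcases lt_trichotomy m k with h | rfl | h
        · rw [replaceAt_of_le n (Or.inl h)]
          exact ⟨⟨t1, t2, t3.congr fun j hj => (h2 j hj (by omega)).symm⟩, fun _ => rfl⟩
        · rw [replaceAt_self]
          exact ⟨⟨hw.monic, hw.pos, hw.reduced.congr fun j hj => (h2 j hj (by omega)).symm⟩,
            fun h => absurd rfl h⟩
        · rw [replaceAt_of_gt h (by omega)]
          obtain ⟨e1, e2⟩ := nfPoly_monic h1 le_rfl t1
          exact ⟨⟨e1, e2 ▸ t2, isReducedPoly_nfPoly h1 le_rfl _⟩, fun _ => e2⟩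
      constructor
      · intro i hi
        rcases Nat.lt_succ_iff_lt_or_eq.1 hi with h | rfl
        exacts [h1 i h, key.1]
      · intro i hi hik
        rcases Nat.lt_succ_iff_lt_or_eq.1 hi with h | rfl
        exacts [h2 i h hik, key.2 hik]
  exact key n le_rfl

/-- Each ring of the new tower is a quotient of the old one, where the new polynomial divides the
image of the old. Separability survives ring homomorphisms and passes to divisors. -/
theorem isSepTri_replaceAt (hT : IsSepTri T n) (hw : (ZeroDiv.mk k w).IsValid T n) :
    IsSepTri (replaceAt T k w n) n := by
  obtain ⟨h1, -⟩ := isTri_replaceAt hT.tri hw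
  have hdvd : ∀ i < n, triIdeal T i ≤ triIdeal (replaceAt T k w n) i →
      quoPoly (replaceAt T k w n) i (replaceAt T k w n i) ∣ quoPoly (replaceAt T k w n) i (T i) := by
    intro i hi hle
    rcases lt_trichotomy i k with h | rfl | h
    · rw [replaceAt_of_le n (Or.inl h)]
    · rw [replaceAt_self]
      exact quoPoly_dvd_mono hle hw.dvd
    · rw [replaceAt_of_gt h hi, quoPoly_nfPoly h1 hi.le]
  refine ⟨h1, fun i hi => ?_⟩
  have hle : triIdeal T i ≤ triIdeal (replaceAt T k w n) i :=
    triIdeal_le fun j hj => hdvd j (by omega)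
  exact (separable_quoPoly_mono hle (hT.sep i hi)).of_dvd (hdvd i hi hle)

theorem triDim_replaceAt (hT : IsTri T n) (hw : (ZeroDiv.mk k w).IsValid T n) :
    triDim (replaceAt T k w n) n =
      w.natDegree * ∏ i ∈ (Finset.range n).erase k, (T i).natDegree := by
  rw [triDim, ← Finset.mul_prod_erase _ _ (Finset.mem_range.2 hw.level_lt), replaceAt_self]
  congr 1
  refine Finset.prod_congr rfl fun i hi => ?_
  rw [Finset.mem_erase, Finset.mem_range] at hi
  exact (isTri_replaceAt hT hw).2 i hi.2 hi.1

theorem isValid_cofactor (hT : IsTri T n) (hw : (ZeroDiv.mk k w).IsValid T n) :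
    (ZeroDiv.mk k (nfPoly T k (T k /ₘ w))).IsValid T n := by
  obtain ⟨h1, h2, h3, h4⟩ := cofactor_spec hT hw.level_lt hw.monic hw.dvd
  have hp := hw.pos
  have hl := hw.lt
  dsimp only at h1 h2 h3 h4 hp hl
  refine ⟨hw.level_lt, h1, h3, ?_, ?_, h4 ▸ dvd_mul_left _ _⟩ <;> dsimp only <;> omega

/-- The two factors have complementary degrees at level `k`, and all other main degrees are
unchanged. -/
theorem triDim_split (hT : IsTri T n) (hw : (ZeroDiv.mk k w).IsValid T n) :
    triDim (replaceAt T k w n) n + triDim (replaceAt T k (nfPoly T k (T k /ₘ w)) n) n =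
      triDim T n := by
  obtain ⟨-, h2, -, -⟩ := cofactor_spec hT hw.level_lt hw.monic hw.dvd
  dsimp only at h2
  rw [triDim_replaceAt hT hw, triDim_replaceAt hT (isValid_cofactor hT hw), ← add_mul, h2, triDim,
    ← Finset.mul_prod_erase _ _ (Finset.mem_range.2 hw.level_lt)]

end replace

/-! ### Weights of inputs -/

section input

variable {n : ℕ}

/-- The triangular set is separable, and the polynomials are reduced. -/
structure Input.IsGood (I : Input n) : Prop where
  sepTri : IsSepTri I.T n
  reduced_a : IsReducedPoly (mainDeg I.T) n I.a
  reduced_b : IsReducedPoly (mainDeg I.T) n I.b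

theorem Input.IsGood.split {I : Input n} (hI : I.IsGood) {k : ℕ} {w : (IterPoly ℚ k)[X]}
    (hw : (ZeroDiv.mk k w).IsValid I.T n) : (I.split k w).IsGood := by
  have h := isSepTri_replaceAt hI.sepTri hw
  exact ⟨h, isReducedPoly_nfPoly h.tri le_rfl _, isReducedPoly_nfPoly h.tri le_rfl _⟩

/-- A bound for the number of calls that a call leads to. -/
def Input.weight (I : Input n) : ℕ := 2 * triDim I.T n - 1

theorem Input.IsGood.weight_pos {I : Input n} (hI : I.IsGood) : 0 < I.weight := by
  have := triDim_pos hI.sepTri.tri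
  rw [weight]
  omega

/-- With `d = d₁ + d₂` the sum is `(2 d₁ - 1) + (2 d₂ - 1) = 2 d - 2`. The weight `2 d - 1` is the
number of nodes of a binary tree with `d` leaves; `d` alone would not drop. -/
theorem Input.IsGood.weight_split {I : Input n} (hI : I.IsGood) {k : ℕ} {w : (IterPoly ℚ k)[X]}
    (hw : (ZeroDiv.mk k w).IsValid I.T n) :
    (I.split k w).weight + (I.split k (nfPoly I.T k (I.T k /ₘ w))).weight < I.weight := by
  have h := triDim_split hI.sepTri.tri hw
  have h1 := triDim_pos (isTri_replaceAt hI.sepTri.tri hw).1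
  have h2 := triDim_pos (isTri_replaceAt hI.sepTri.tri (isValid_cofactor hI.sepTri.tri hw)).1
  change 2 * triDim (replaceAt I.T k w n) n - 1 +
    (2 * triDim (replaceAt I.T k (nfPoly I.T k (I.T k /ₘ w)) n) n - 1) < 2 * triDim I.T n - 1
  omega

end input

/-! ### Termination of a call -/

section gcd

variable {n : ℕ}

theorem Input.not_isBad_iff {I : Input n} {p : ℕ} [Fact p.Prime] : ¬ I.IsBad p ↔
    (∀ i < n, IsInt p i (I.T i)) ∧ IsInt p n I.a ∧ IsInt p n I.b ∧
      (I.a ≠ 0 → red p n I.a.leadingCoeff ≠ 0) ∧ (I.b ≠ 0 → red p n I.b.leadingCoeff ≠ 0) := by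
  rw [Input.IsBad]
  push Not
  rfl

/-- Modulo a prime that is not bad, the degree of the gcd is not smaller than over `ℚ`, and if the
degrees agree then so do the gcds. -/
theorem Input.IsGood.gcd_spec {I : Input n} (hI : I.IsGood) {e : Bezout ℚ n}
    (he : monicExtGcd I.T n I.a I.b = .ok e) :
    Divides I.T n e.g I.a ∧ Divides I.T n e.g I.b ∧ e.g.degree ≤ (Call.start I).dg ∧
      ∀ (p : ℕ) [Fact p.Prime], ¬ I.IsBad p → ∀ e' : Bezout (ZMod p) n,
        monicExtGcd (redTri p I.T) n (redPoly p n I.a) (redPoly p n I.b) = .ok e' →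
        e.g.degree ≤ e'.g.degree ∧
          (e.g.degree = e'.g.degree → IsInt p n e.g ∧ redPoly p n e.g = e'.g) := by
  have hT := hI.sepTri.tri
  -- For the pair `0, 0` the answer is `0`, which is not monic, so the Bézout description does not
  -- apply.
  by_cases hab : I.a = 0 ∧ I.b = 0
  · obtain ⟨ha, hb⟩ := hab
    have h0 : ∀ {F : Type} [Field F] (T : TriSet F), monicExtGcd T n 0 0 = .ok ⟨0, 0, 0⟩ :=
      fun T => by rw [monicExtGcd, monicEuclid, if_pos rfl, if_pos rfl]
    rw [ha, hb, h0] at he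
    obtain rfl := Except.ok.inj he
    have hdvd : Divides I.T n 0 0 := (divides_iff hT le_rfl _ _).2 dvd_rfl
    refine ⟨ha ▸ hdvd, hb ▸ hdvd, by rw [degree_zero]; exact bot_le, fun p _ _ e' he' => ?_⟩
    rw [ha, hb, redPoly_zero, h0] at he'
    obtain rfl := Except.ok.inj he'
    refine ⟨le_rfl, fun _ => ⟨?_, redPoly_zero p n⟩⟩
    have := isInt_map_incl p (0 : (IterPoly (pInt p) n)[X])
    rwa [Polynomial.map_zero] at this
  have hbz := monicExtGcd_spec hT le_rfl hI.reduced_a hI.reduced_b hab he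
  refine ⟨(divides_iff hT le_rfl _ _).2 hbz.dvd_left, (divides_iff hT le_rfl _ _).2 hbz.dvd_right,
    ?_, fun p _ hp e' he' => ?_⟩
  · have hle : ∀ {f : (IterPoly ℚ n)[X]}, IsReducedPoly (mainDeg I.T) n f → f ≠ 0 →
        quoPoly I.T n e.g ∣ quoPoly I.T n f → e.g.degree ≤ f.degree := by
      intro f hf hf0 hd
      by_contra! hlt
      have hm : (quoPoly I.T n e.g).Monic := hbz.monic.map _
      refine hm.not_dvd_of_degree_lt ?_ ?_ hd
      · rwa [← degree_ne_bot, degree_quoPoly hT le_rfl hf, degree_ne_bot]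
      · rwa [degree_quoPoly hT le_rfl hf, degree_quoPoly hT le_rfl hbz.reduced]
    change _ ≤ if I.b = 0 then I.a.degree else I.b.degree
    split_ifs with h
    · exact hle hI.reduced_a (fun ha => hab ⟨ha, h⟩) hbz.dvd_left
    · exact hle hI.reduced_b h hbz.dvd_right
  · obtain ⟨hint, hia, hib, hla, hlb⟩ := Input.not_isBad_iff.1 hp
    have hTp := hT.redTri p
    have hred : ∀ {a : (IterPoly ℚ n)[X]}, IsReducedPoly (mainDeg I.T) n a →
        IsReducedPoly (mainDeg (redTri p I.T)) n (redPoly p n a) := fun ha =>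
      ha.mapTri (redRat_zero p) (redRat_one p) hT le_rfl
    have h0 : ∀ {f : (IterPoly ℚ n)[X]}, (f ≠ 0 → red p n f.leadingCoeff ≠ 0) →
        (redPoly p n f = 0 ↔ f = 0) := by
      intro f hf
      by_cases h : f = 0
      · simp only [h, redPoly_zero]
      · exact redPoly_eq_zero (natDegree_redPoly (hf h)).1
    have hab' : ¬ (redPoly p n I.a = 0 ∧ redPoly p n I.b = 0) := by rwa [h0 hla, h0 hlb]
    have hbz' := monicExtGcd_spec hTp le_rfl (hred hI.reduced_a) (hred hI.reduced_b) hab' he'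
    have hu := monicExtGcd_isUnit hTp le_rfl (hred hI.reduced_a) (hred hI.reduced_b) hab' he'
    -- The first turn of the modular run inverted the leading coefficient of `b`, or of `a` if `b =
    -- 0`. The prime is not bad, so this is the reduction of the rational leading coefficient.
    by_cases hb : I.b = 0
    · have ha : I.a ≠ 0 := fun ha => hab ⟨ha, hb⟩
      rw [if_pos ((h0 hlb).2 hb), (natDegree_redPoly (hla ha)).2.2] at hu
      exact gcd_mod_prime hT hint hia hib (Or.inl rfl) hI.reduced_a hu hbz hbz'
    · rw [if_neg ((h0 hlb).not.2 hb), (natDegree_redPoly (hlb hb)).2.2] at hu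
      exact gcd_mod_prime hT hint hia hib (Or.inr rfl) hI.reduced_b hu hbz hbz'

end gcd

/-! ### The outcomes of one turn -/

section turn

variable {n : ℕ}

theorem finishTurn_cases (c : Call n) (todo : List (Input n))
    (out : List (TriSet ℚ × (IterPoly ℚ n)[X])) (B : Option ℕ) :
    finishTurn c todo out B = .mainLoop c todo out B ∨
      ∃ out', finishTurn c todo out B = nextCall todo out' B := by
  rw [finishTurn]
  split
  · exact Or.inl rfl
  · split_ifs
    exacts [Or.inr ⟨_, rfl⟩, Or.inl rfl]

theorem finishTurn_of_ratRecon {c : Call n} {g : (IterPoly ℚ n)[X]}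
    (hg : ratReconPoly c.M n c.G = some g) (ha : Divides c.inp.T n g c.inp.a)
    (hb : Divides c.inp.T n g c.inp.b) (todo : List (Input n))
    (out : List (TriSet ℚ × (IterPoly ℚ n)[X])) (B : Option ℕ) :
    ∃ out', finishTurn c todo out B = nextCall todo out' B := by
  refine ⟨out ++ [(c.inp.T, g)], ?_⟩
  rw [finishTurn]
  simp only [hg]
  rw [if_pos ⟨ha, hb⟩]

theorem mainTurn_cases {p : ℕ} [Fact p.Prime] {c : Call n} (hI : c.inp.IsGood)
    (todo : List (Input n)) (out : List (TriSet ℚ × (IterPoly ℚ n)[X])) (B : Option ℕ) :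
    (∃ w, w.IsValid (redTri p c.inp.T) n ∧
      (isRadical (redTri p c.inp.T) n = .error w ∨ isRadical (redTri p c.inp.T) n = .ok true ∧
        monicExtGcd (redTri p c.inp.T) n (redPoly p n c.inp.a) (redPoly p n c.inp.b) = .error w) ∧
      mainTurn p c todo out B =
      .zeroDivisor p w { c with used := insert p c.used } todo out B) ∨
    (isRadical (redTri p c.inp.T) n = .ok false ∧
      mainTurn p c todo out B = .mainLoop { c with used := insert p c.used } todo out B) ∨
    ∃ e, monicExtGcd (redTri p c.inp.T) n (redPoly p n c.inp.a) (redPoly p n c.inp.b) = .ok e ∧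
      isRadical (redTri p c.inp.T) n = .ok true ∧
      ((e.g.degree = c.dg ∧ mainTurn p c todo out B = finishTurn
        { c with used := insert p c.used, G := crt c.M p c.G e.g, M := c.M * p } todo out B) ∨
      (c.dg < e.g.degree ∧
        mainTurn p c todo out B = .mainLoop { c with used := insert p c.used } todo out B) ∨
      (e.g.degree < c.dg ∧ mainTurn p c todo out B = finishTurn
        { c with used := insert p c.used, dg := e.g.degree, G := mapPoly (liftInt p) n e.g, M := p }
        todo out B)) := by
  have hT := hI.sepTri.tri
  have hTp := hT.redTri p
  have hred : ∀ {a : (IterPoly ℚ n)[X]}, IsReducedPoly (mainDeg c.inp.T) n a →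
      IsReducedPoly (mainDeg (redTri p c.inp.T)) n (redPoly p n a) := fun ha =>
    ha.mapTri (redRat_zero p) (redRat_one p) hT le_rfl
  rw [mainTurn]
  cases h : isRadical (redTri p c.inp.T) n with
  | error w => exact Or.inl ⟨w, isRadical_error hTp le_rfl h, Or.inl rfl, rfl⟩
  | ok b =>
    cases b with
    | false => exact Or.inr (Or.inl ⟨rfl, rfl⟩)
    | true =>
      cases h' : monicExtGcd (redTri p c.inp.T) n (redPoly p n c.inp.a) (redPoly p n c.inp.b) with
      | error w =>
        exact Or.inl ⟨w, monicExtGcd_error hTp le_rfl (hred hI.reduced_a) (hred hI.reduced_b) h',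
          Or.inr ⟨rfl, rfl⟩, rfl⟩
      | ok e =>
        refine Or.inr (Or.inr ⟨e, rfl, rfl, ?_⟩)
        dsimp only
        rcases lt_trichotomy e.g.degree c.dg with hlt | heq | hgt
        · exact Or.inr (Or.inr ⟨hlt, by rw [if_neg hlt.ne, if_neg hlt.asymm]⟩)
        · exact Or.inl ⟨heq, by rw [if_pos heq]⟩
        · exact Or.inr (Or.inl ⟨hgt, by rw [if_neg hgt.ne', if_pos hgt]⟩)

end turn

/-! ### A rank for the states of one call -/

section rank

variable {n : ℕ}

/-- The rank of a state in a call. -/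
def lexRank (a b c d : ℕ) : ℕ ×ₗ ℕ ×ₗ ℕ ×ₗ ℕ := toLex (a, toLex (b, toLex (c, d)))

theorem lexRank_lt {a b c d a' b' c' d' : ℕ}
    (h : a < a' ∨ a ≤ a' ∧ (b < b' ∨ b ≤ b' ∧ (c < c' ∨ c ≤ c' ∧ d < d'))) :
    lexRank a b c d < lexRank a' b' c' d' := by
  simp only [lexRank, Prod.Lex.toLex_lt_toLex]
  omega

/-- The rank need not decrease on steps that leave the invariant, provided that they lead to states
already known to be accessible: the call returns or splits. -/
theorem acc_of_rank {α β : Type} [Preorder β] [WellFoundedLT β] {r : α → α → Prop} (f : α → β)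
    (P : α → Prop) (h : ∀ s, P s → ∀ s', r s s' → Acc (flip r) s' ∨ P s' ∧ f s' < f s) (s : α)
    (hs : P s) : Acc (flip r) s := by
  induction hb : f s using WellFoundedLT.induction generalizing s with
  | _ b ih =>
    refine ⟨_, fun s' hs' => ?_⟩
    rcases h s hs s' hs' with h' | ⟨h', hlt⟩
    · exact h'
    · exact ih _ (hb ▸ hlt) s' h' rfl

/-- If the global bound is assigned, then it is at least `2`. -/
def BoundOK (B : Option ℕ) : Prop := ∀ b, B = some b → 2 ≤ b

/-- Squaring increases the bound only from `2` on; an unassigned bound counts as `0`. -/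
theorem BoundOK.next {B : Option ℕ} (hB : BoundOK B) :
    BoundOK (some (nextBound B)) ∧ B.getD 0 < nextBound B := by
  cases B with
  | none => exact ⟨fun b hb => by cases hb; norm_num [nextBound], by norm_num [nextBound]⟩
  | some b =>
    have hb := hB b rfl
    have : b < b ^ 2 := by nlinarith
    exact ⟨fun b' hb' => by cases hb'; exact hb.trans this.le, this⟩

/-- A state of a call for `I`: the local variables satisfy `Q`, the zero-divisors satisfy `Z`. -/
def InCall (I : Input n) (todo : List (Input n)) (Q : Call n → Prop)
    (Z : (p : ℕ) → [Fact p.Prime] → ZeroDiv (ZMod p) → Prop) : State n → Prop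
  | .mainLoop c t _ B => c.inp = I ∧ t = todo ∧ BoundOK B ∧ Q c
  | .zeroDivisor p w c t _ B => c.inp = I ∧ t = todo ∧ BoundOK B ∧ Q c ∧
      ∃ _ : Fact p.Prime, w.IsValid (redTri p I.T) n ∧ Z p w
  | .done _ => False

/-- The rank of a state of a call, where `E` is the set of exceptional primes. -/
def callRank (E : Finset ℕ) (X : Call n → Option ℕ → ℕ) : State n → ℕ ×ₗ ℕ ×ₗ ℕ ×ₗ ℕ
  | .mainLoop c _ _ B => lexRank (2 * (E \ c.used).card) (X c B) 1 0
  | .zeroDivisor p w c _ _ B =>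
      lexRank (2 * (E \ c.used).card + if p ∈ E then 1 else 0) (X c B) 0 w.level
  | .done _ => lexRank 0 0 0 0

/-- The answer of the Hensel lifting for the zero-divisor `w`. -/
abbrev liftZeroDiv (T : TriSet ℚ) (p : ℕ) [Fact p.Prime] (w : ZeroDiv (ZMod p)) (B : ℕ) :
    HenselResult p w.level :=
  henselLift T w.level p (T w.level) w.poly
    (nfPoly (redTri p T) w.level (redTri p T w.level /ₘ w.poly)) B

theorem card_sdiff_insert (E U : Finset ℕ) (p : ℕ) (hp : p ∉ U) :
    (E \ insert p U).card + (if p ∈ E then 1 else 0) = (E \ U).card := by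
  rw [Finset.sdiff_insert]
  split_ifs with h
  · exact Finset.card_erase_add_one (Finset.mem_sdiff.2 ⟨h, hp⟩)
  · rw [Finset.erase_eq_of_notMem fun h' => h (Finset.mem_sdiff.1 h').1, add_zero]

/-- A call terminates if its states have a rank in the sense of `callRank`, and if the calls that
follow terminate. -/
theorem acc_inCall {I : Input n} (hI : I.IsGood) {todo : List (Input n)}
    {Q : Call n → Prop} {Z : (p : ℕ) → [Fact p.Prime] → ZeroDiv (ZMod p) → Prop}
    (E : Finset ℕ) (X : Call n → Option ℕ → ℕ)
    (hnext : ∀ out B, BoundOK B → Acc (flip Step) (nextCall todo out B))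
    (hsplit : ∀ k u, (ZeroDiv.mk k u).IsValid I.T n → ∀ out B, BoundOK B → Acc (flip Step)
      (.mainLoop (Call.start (I.split k u)) (I.split k (nfPoly I.T k (I.T k /ₘ u)) :: todo) out B))
    (hX : ∀ c B, BoundOK B → X c (some (nextBound B)) ≤ X c B)
    (hZ : ∀ (p : ℕ) [Fact p.Prime] (w w' : ZeroDiv (ZMod p)) (B : ℕ), Z p w →
      liftZeroDiv I.T p w B = .zeroDivisor w' → Z p w')
    (hfail : ∀ (p : ℕ) [Fact p.Prime] (w : ZeroDiv (ZMod p)) (c : Call n) (B : Option ℕ),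
      p ∉ E → Z p w → BoundOK B → liftZeroDiv I.T p w (nextBound B) = .fail →
      X c (some (nextBound B)) < X c B)
    (hmain : ∀ (p : ℕ) [Fact p.Prime] (c : Call n) (out : List (TriSet ℚ × (IterPoly ℚ n)[X]))
      (B : Option ℕ), ¬ I.IsBad p → c.inp = I → p ∉ c.used → Q c →
      (∃ out', mainTurn p c todo out B = nextCall todo out' B) ∨
      (∃ w c', mainTurn p c todo out B = .zeroDivisor p w c' todo out B ∧ c'.inp = I ∧
        c'.used = insert p c.used ∧ Q c' ∧ w.IsValid (redTri p I.T) n ∧ Z p w ∧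
        (p ∉ E → X c' B ≤ X c B)) ∨
      ∃ c', mainTurn p c todo out B = .mainLoop c' todo out B ∧ c'.inp = I ∧
        c'.used = insert p c.used ∧ Q c' ∧ (p ∉ E → X c' B < X c B))
    (s : State n) (hs : InCall I todo Q Z s) : Acc (flip Step) s := by
  -- Picking `p ∈ E` lowers the first component by one if a zero-divisor is met, and handling it
  -- failing lowers it by one more; this is why the unused exceptional primes count twice. For `p ∉
  -- E` a completed turn or a failed lifting lowers `X`, meeting a zero-divisor lowers the third
  -- component, and a further zero-divisor lowers the level.
  refine acc_of_rank (callRank E X) (InCall I todo Q Z) (fun s hs s' hstep => ?_) s hs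
  cases hstep with
  | pickPrime p c t out B hbad hnew =>
    obtain ⟨hc, rfl, hB, hQ⟩ := hs
    have hcard := card_sdiff_insert E c.used p hnew
    rcases hmain p c out B (hc ▸ hbad) hc hnew hQ with
      ⟨out', h⟩ | ⟨w, c', h, h1, h2, h3, h4, h5, h6⟩ | ⟨c', h, h1, h2, h3, h4⟩
    · rw [h]
      exact Or.inl (hnext _ _ hB)
    · rw [h]
      refine Or.inr ⟨⟨h1, rfl, hB, h3, inferInstance, h4, h5⟩, lexRank_lt ?_⟩
      rw [h2]
      by_cases hE : p ∈ E
      · simp only [hE, if_true] at hcard ⊢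
        omega
      · have := h6 hE
        simp only [hE, if_false] at hcard ⊢
        omega
    · rw [h]
      refine Or.inr ⟨⟨h1, rfl, hB, h3⟩, lexRank_lt ?_⟩
      rw [h2]
      by_cases hE : p ∈ E
      · simp only [hE, if_true] at hcard
        omega
      · have := h4 hE
        simp only [hE, if_false] at hcard
        omega
  | handle p w c t out B =>
    obtain ⟨rfl, rfl, hB, hQ, _, hw, hz⟩ := hs
    have hT := hI.sepTri.tri
    rw [handleZeroDivisor]
    cases h : liftZeroDiv c.inp.T p w (nextBound B) with
    | zeroDivisor w' =>
      simp only [h]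
      have hw' := henselLift_zeroDivisor hT hw h
      refine Or.inr ⟨⟨rfl, rfl, hB.next.1, hQ, inferInstance, hw'.mono hw.level_lt.le,
        hZ p w w' _ hz h⟩, lexRank_lt ?_⟩
      have := hX c B hB
      have := hw'.level_lt
      omega
    | fail =>
      simp only [h]
      refine Or.inr ⟨⟨rfl, rfl, hB.next.1, hQ⟩, lexRank_lt ?_⟩
      by_cases hE : p ∈ E
      · simp only [hE, if_true]
        omega
      · have := hfail p w c B hE hz hB h
        omega
    | factors u v =>
      simp only [h]
      obtain ⟨hu, rfl⟩ := henselLift_factors hT hw h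
      exact Or.inl (hsplit _ u hu _ _ hB.next.1)

end rank

/-! ### Accessibility of the start of a call -/

section termination

variable {n : ℕ}

theorem exists_finset_of_eventually {φ : Nat.Primes → Prop} (h : ∀ᶠ p in cofinite, φ p) :
    ∃ E : Finset ℕ, ∀ (p : ℕ) [hp : Fact p.Prime], p ∉ E → φ ⟨p, hp.1⟩ := by
  refine ⟨(eventually_cofinite.1 h).toFinset.image Subtype.val, fun p hp hpE => ?_⟩
  by_contra hφ
  exact hpE (Finset.mem_image.2 ⟨⟨p, hp.1⟩, (Set.Finite.mem_toFinset _).2 hφ, rfl⟩)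

/-- A call terminates if the computation over `ℚ` meets no zero-divisor. -/
theorem acc_start_of_ok {I : Input n} (hI : I.IsGood) {todo : List (Input n)}
    (hnext : ∀ out B, BoundOK B → Acc (flip Step) (nextCall todo out B))
    (hsplit : ∀ k u, (ZeroDiv.mk k u).IsValid I.T n → ∀ out B, BoundOK B → Acc (flip Step)
      (.mainLoop (Call.start (I.split k u)) (I.split k (nfPoly I.T k (I.T k /ₘ u)) :: todo) out B))
    (hrad : isRadical I.T n = .ok true) {e : Bezout ℚ n}
    (he : monicExtGcd I.T n I.a I.b = .ok e) (out : List (TriSet ℚ × (IterPoly ℚ n)[X]))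
    (B : Option ℕ) (hB : BoundOK B) :
    Acc (flip Step) (.mainLoop (Call.start I) todo out B) := by
  have hT := hI.sepTri.tri
  obtain ⟨hga, hgb, hstart, hmod⟩ := hI.gcd_spec he
  obtain ⟨M₀, hM₀⟩ := exists_ratReconPoly e.g
  obtain ⟨E, hE⟩ := exists_finset_of_eventually (((eventually_isRadical hT le_rfl).and
    (eventually_monicExtGcd hT le_rfl I.a I.b)).and (eventually_natDegree_redPoly e.g))
  rw [hrad, he] at hE
  -- The degree never drops below that of the rational gcd, and once it is equal, `G` is congruent
  -- to that gcd modulo `M`. `X` is what `M` lacks to reach `M₀`, and `M₀ + 1` while the degree is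
  -- still too large. Zero-divisors occur only at exceptional primes, so `hfail` is vacuous. At the
  -- start `M = 1`, and every congruence holds.
  refine acc_inCall hI
    (Q := fun c => 0 < c.M ∧ (∀ q, q.Prime → q ∉ c.used → c.M.Coprime q) ∧
      e.g.degree ≤ c.dg ∧ (c.dg = e.g.degree → RatCongPoly c.M n c.G e.g))
    (Z := fun p _ _ => p ∈ E) E (fun c _ => if c.dg = e.g.degree then M₀ - c.M else M₀ + 1)
    hnext hsplit (fun _ _ _ => le_rfl) (fun _ _ _ _ _ h _ => h)
    (fun _ _ _ _ _ h h' => absurd h' h) ?_ _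
    ⟨rfl, rfl, hB, Nat.one_pos, fun q _ _ => Nat.coprime_one_left q, hstart, fun _ => ?_⟩
  swap
  · intro i d
    exact ⟨Nat.coprime_one_right _, one_dvd _⟩
  intro p hp c out B hbad hc hnew ⟨hM, hcop, hdeg, hcong⟩
  subst hc
  have hcop' : ∀ {M : ℕ}, (∀ q, q.Prime → q ∉ c.used → M.Coprime q) →
      ∀ q, q.Prime → q ∉ insert p c.used → M.Coprime q := fun h q hq hqu =>
    h q hq fun hmem => hqu (Finset.mem_insert_of_mem hmem)
  have hpq : ∀ q, q.Prime → q ∉ insert p c.used → p.Coprime q := fun q hq hqu =>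
    (Nat.coprime_primes hp.1 hq).2 fun h => hqu (h ▸ Finset.mem_insert_self p c.used)
  rcases mainTurn_cases hI todo out B (p := p) with
    ⟨w, hw, herr, h⟩ | ⟨hf, h⟩ | ⟨e', he', hr, h⟩
  · have hpE : p ∈ E := by
      by_contra hpE
      obtain ⟨⟨h1, h2⟩, -⟩ := hE p hpE
      rcases herr with h' | ⟨-, h'⟩
      · cases h'.symm.trans h1
      · cases h'.symm.trans h2
    exact Or.inr (Or.inl ⟨w, _, h, rfl, rfl, ⟨hM, hcop' hcop, hdeg, hcong⟩, hw, hpE,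
      fun h => absurd hpE h⟩)
  · refine Or.inr (Or.inr ⟨_, h, rfl, rfl, ⟨hM, hcop' hcop, hdeg, hcong⟩, fun hpE => ?_⟩)
    cases hf.symm.trans (hE p hpE).1.1
  · obtain ⟨hle, heq⟩ := hmod p hbad e' he'
    have hdeg' : p ∉ E → e'.g.degree = e.g.degree := fun hpE => by
      obtain ⟨⟨-, h2⟩, h3⟩ := hE p hpE
      obtain rfl := Except.ok.inj (he'.symm.trans h2)
      exact h3.1
    rcases h with ⟨hd, h⟩ | ⟨hd, h⟩ | ⟨hd, h⟩
    -- The congruence survives exceptional primes too: at the right degree a prime that is not bad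
    -- contributes the true gcd.
    · have hcong' : c.dg = e.g.degree → RatCongPoly (c.M * p) n (crt c.M p c.G e'.g) e.g := by
        intro hdg
        obtain ⟨h1, h2⟩ := heq (hdg.symm.trans hd.symm)
        rw [← h2]
        exact ratCongPoly_crt (hcop p hp.1 hnew) (hcong hdg) h1
      by_cases hlarge : c.dg = e.g.degree ∧ M₀ ≤ c.M * p
      · obtain ⟨out', h'⟩ := finishTurn_of_ratRecon
          (c := { c with used := insert p c.used, G := crt c.M p c.G e'.g, M := c.M * p })
          (hM₀ _ hlarge.2 _ (hcong' hlarge.1)) hga hgb todo out B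
        exact Or.inl ⟨out', h.trans h'⟩
      rcases finishTurn_cases
        { c with used := insert p c.used, G := crt c.M p c.G e'.g, M := c.M * p } todo out B with
        h' | ⟨out', h'⟩
      · refine Or.inr (Or.inr ⟨_, h.trans h', rfl, rfl, ⟨Nat.mul_pos hM hp.1.pos, fun q hq hqu =>
          Nat.Coprime.mul_left (hcop' hcop q hq hqu) (hpq q hq hqu), hdeg, hcong'⟩, fun hpE => ?_⟩)
        have hdg := hd.symm.trans (hdeg' hpE)
        have h2 := hp.1.two_le
        -- The modulus is still below `M₀` here but has grown strictly, so `M₀ - M` decreases.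
        have : c.M < c.M * p := by nlinarith
        simp only [hdg, true_and, if_true] at hlarge ⊢
        omega
      · exact Or.inl ⟨out', h.trans h'⟩
    · refine Or.inr (Or.inr ⟨_, h, rfl, rfl, ⟨hM, hcop' hcop, hdeg, hcong⟩, fun hpE => ?_⟩)
      exact absurd (hd.trans_eq (hdeg' hpE)) hdeg.not_gt
    · rcases finishTurn_cases { c with
        used := insert p c.used, dg := e'.g.degree, G := mapPoly (liftInt p) n e'.g, M := p }
        todo out B with h' | ⟨out', h'⟩
      · refine Or.inr (Or.inr ⟨_, h.trans h', rfl, rfl, ⟨hp.1.pos, hpq, hle, fun hdg => ?_⟩,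
          fun hpE => ?_⟩)
        · obtain ⟨h1, h2⟩ := heq hdg.symm
          dsimp only
          rw [← h2]
          exact ratCongPoly_liftInt h1
        -- Outside `E` the degree drops directly to the right one, so `X` passes from `M₀ + 1` to at
        -- most `M₀`.
        · have hdg := hdeg' hpE
          have hne : ¬ c.dg = e.g.degree := fun h => (hd.trans_eq h).ne hdg
          simp only [hdg, hne, if_true, if_false]
          omega
      · exact Or.inl ⟨out', h.trans h'⟩

/-- The bound enters only after the coprimality computation has succeeded. -/
theorem liftZeroDiv_zeroDivisor {T : TriSet ℚ} {p : ℕ} [Fact p.Prime] {w w' : ZeroDiv (ZMod p)}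
    {B : ℕ} (h : liftZeroDiv T p w B = .zeroDivisor w') (B' : ℕ) :
    liftZeroDiv T p w B' = .zeroDivisor w' := by
  rw [liftZeroDiv, henselLift] at h ⊢
  split at h
  · exact h
  · split_ifs at h
    split at h <;> cases h

/-- A call terminates if the computation over `ℚ` meets a zero-divisor. -/
theorem acc_start_of_error {I : Input n} (hI : I.IsGood) {todo : List (Input n)}
    (hnext : ∀ out B, BoundOK B → Acc (flip Step) (nextCall todo out B))
    (hsplit : ∀ k u, (ZeroDiv.mk k u).IsValid I.T n → ∀ out B, BoundOK B → Acc (flip Step)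
      (.mainLoop (Call.start (I.split k u)) (I.split k (nfPoly I.T k (I.T k /ₘ u)) :: todo) out B))
    {z : ZeroDiv ℚ} (herr : isRadical I.T n = .error z ∨
      isRadical I.T n = .ok true ∧ monicExtGcd I.T n I.a I.b = .error z)
    (out : List (TriSet ℚ × (IterPoly ℚ n)[X])) (B : Option ℕ) (hB : BoundOK B) :
    Acc (flip Step) (.mainLoop (Call.start I) todo out B) := by
  have hT := hI.sepTri.tri
  have hz : z.IsValid I.T n := by
    rcases herr with h | ⟨-, h⟩
    exacts [isRadical_error hT le_rfl h, monicExtGcd_error hT le_rfl hI.reduced_a hI.reduced_b h]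
  obtain ⟨B₀, hB₀⟩ := exists_goodZeroDiv hI.sepTri z hz
  obtain ⟨E, hE⟩ := exists_finset_of_eventually (((eventually_isRadical hT le_rfl).and
    (eventually_monicExtGcd hT le_rfl I.a I.b)).and hB₀)
  -- Outside `E` every zero-divisor leads to a factorization as soon as the bound reaches `B₀`; each
  -- zero-divisor raises the bound, so `B₀ - B` measures the remaining failures.
  refine acc_inCall hI (Q := fun _ => True) (Z := fun p _ w => p ∉ E → GoodZeroDiv I.T B₀ p w) E
    (fun _ B => B₀ - B.getD 0) hnext hsplit ?_ ?_ ?_ ?_ _ ⟨rfl, rfl, hB, trivial⟩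
  · intro c B hB
    have := hB.next.2
    dsimp only [Option.getD_some]
    omega
  · intro p hp w w' B hw h hpE
    cases hw hpE with
    | factor _ h' =>
      obtain ⟨u, v, h'⟩ := h' B₀ le_rfl
      cases h'.symm.trans (liftZeroDiv_zeroDivisor h B₀)
    | next _ w'' h' hgood =>
      obtain rfl := HenselResult.zeroDivisor.inj ((h' B).symm.trans h)
      exact hgood
  · intro p hp w c B hpE hw hB h
    cases hw hpE with
    | factor _ h' =>
      have := hB.next.2
      dsimp only [Option.getD_some]
      by_contra hlt
      obtain ⟨u, v, h'⟩ := h' (nextBound B) (by omega)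
      cases h'.symm.trans h
    | next _ w'' h' hgood => cases (h' _).symm.trans h
  · intro p hp c out B hbad hc hnew _
    subst hc
    rcases mainTurn_cases hI todo out B (p := p) with
      ⟨w, hw, herr', h⟩ | ⟨hf, h⟩ | ⟨e', he', hr, h⟩
    · refine Or.inr (Or.inl ⟨w, _, h, rfl, rfl, trivial, hw, fun hpE => ?_, fun _ => le_rfl⟩)
      obtain ⟨⟨h1, h2⟩, h3⟩ := hE p hpE
      have : w = z.red p := by
        rcases herr with h' | ⟨h', h''⟩
        · rw [h'] at h1
          rcases herr' with h4 | ⟨h4, -⟩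
          · exact Except.error.inj (h4.symm.trans h1)
          · cases h4.symm.trans h1
        · rw [h'] at h1
          rw [h''] at h2
          rcases herr' with h4 | ⟨-, h4⟩
          · cases h4.symm.trans h1
          · exact Except.error.inj (h4.symm.trans h2)
      rw [this]
      exact h3
    · refine Or.inr (Or.inr ⟨_, h, rfl, rfl, trivial, fun hpE => ?_⟩)
      obtain ⟨⟨h1, -⟩, -⟩ := hE p hpE
      rcases herr with h' | ⟨h', -⟩ <;> rw [h'] at h1 <;> cases hf.symm.trans h1
    -- Over `ℚ` the run ends with an error, so only an exceptional prime lets the modular gcd be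
    -- completed.
    · have hpE : p ∈ E := by
        by_contra hpE
        obtain ⟨⟨h1, h2⟩, -⟩ := hE p hpE
        rcases herr with h' | ⟨-, h'⟩
        · rw [h'] at h1
          cases hr.symm.trans h1
        · rw [h'] at h2
          cases he'.symm.trans h2
      rcases h with ⟨-, h⟩ | ⟨-, h⟩ | ⟨-, h⟩
      · rcases finishTurn_cases { c with
          used := insert p c.used, G := crt c.M p c.G e'.g, M := c.M * p } todo out B with
          h' | ⟨out', h'⟩
        · exact Or.inr (Or.inr ⟨_, h.trans h', rfl, rfl, trivial, fun h => absurd hpE h⟩)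
        · exact Or.inl ⟨out', h.trans h'⟩
      · exact Or.inr (Or.inr ⟨_, h, rfl, rfl, trivial, fun h => absurd hpE h⟩)
      · rcases finishTurn_cases { c with
          used := insert p c.used, dg := e'.g.degree, G := mapPoly (liftInt p) n e'.g, M := p }
          todo out B with h' | ⟨out', h'⟩
        · exact Or.inr (Or.inr ⟨_, h.trans h', rfl, rfl, trivial, fun h => absurd hpE h⟩)
        · exact Or.inl ⟨out', h.trans h'⟩

/-- Induction on the total weight of the current and the pending calls, which drops both when a call
returns and when it splits. Within a call the computation over `ℚ`, which never answers that the
ideal is not radical, decides which of the two arguments applies. -/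
theorem acc_start {I : Input n} (hI : I.IsGood) {todo : List (Input n)}
    (htodo : ∀ J ∈ todo, J.IsGood) (out : List (TriSet ℚ × (IterPoly ℚ n)[X])) (B : Option ℕ)
    (hB : BoundOK B) : Acc (flip Step) (.mainLoop (Call.start I) todo out B) := by
  induction hm : I.weight + (todo.map Input.weight).sum using Nat.strong_induction_on
    generalizing I todo out B with
  | _ m ih =>
    have hnext : ∀ out B, BoundOK B → Acc (flip Step) (nextCall todo out B) := by
      intro out B hB
      cases todo with
      | nil => exact ⟨_, fun s hs => by cases hs⟩
      | cons J rest =>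
        refine ih _ ?_ (htodo J List.mem_cons_self)
          (fun K hK => htodo K (List.mem_cons_of_mem _ hK)) _ _ hB rfl
        have := hI.weight_pos
        rw [List.map_cons, List.sum_cons] at hm
        omega
    have hsplit : ∀ k u, (ZeroDiv.mk k u).IsValid I.T n → ∀ out B, BoundOK B → Acc (flip Step)
        (.mainLoop (Call.start (I.split k u))
          (I.split k (nfPoly I.T k (I.T k /ₘ u)) :: todo) out B) := by
      intro k u hu out B hB
      refine ih _ ?_ (hI.split hu) (fun J hJ => ?_) _ _ hB rfl
      · have := hI.weight_split hu
        rw [List.map_cons, List.sum_cons]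
        omega
      · rcases List.mem_cons.1 hJ with rfl | hJ
        exacts [hI.split (isValid_cofactor hI.sepTri.tri hu), htodo J hJ]
    cases hr : isRadical I.T n with
    | error z => exact acc_start_of_error hI hnext hsplit (Or.inl hr) out B hB
    | ok b =>
      have hb := isRadical_eq_true hI.sepTri.tri hI.sepTri.sep le_rfl hr
      cases he : monicExtGcd I.T n I.a I.b with
      | error z =>
        exact acc_start_of_error hI hnext hsplit (Or.inr ⟨hb ▸ hr, he⟩) out B hB
      | ok e => exact acc_start_of_ok hI hnext hsplit (hb ▸ hr) he out B hB

end termination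

/-! ### A run that has not ended can continue -/

section progress

variable {n : ℕ}

/-- Each requirement excludes finitely many primes, and there are infinitely many primes. -/
theorem exists_not_isBad (I : Input n) (U : Finset ℕ) :
    ∃ (p : ℕ) (_ : Fact p.Prime), ¬ I.IsBad p ∧ p ∉ U := by
  have hlc : ∀ f : (IterPoly ℚ n)[X], ∀ᶠ p : Nat.Primes in cofinite,
      f ≠ 0 → red p n f.leadingCoeff ≠ 0 := by
    intro f
    by_cases hf : f = 0
    · exact Eventually.of_forall fun p h => absurd hf h
    · filter_upwards [eventually_red_ne (leadingCoeff_ne_zero.2 hf)] with p hp _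
      rwa [red_zero] at hp
  have hU : ∀ᶠ p : Nat.Primes in cofinite, (p : ℕ) ∉ U := by
    rw [eventually_cofinite]
    refine (U.finite_toSet.preimage (f := fun p : Nat.Primes => (p : ℕ))
      Subtype.val_injective.injOn).subset fun p hp => by simpa using hp
  obtain ⟨p, h1, h2, h3, h4, h5, h6⟩ := ((eventually_isInt_tri I.T n).and
    ((eventually_isInt I.a).and ((eventually_isInt I.b).and ((hlc I.a).and
      ((hlc I.b).and hU))))).exists
  exact ⟨p, ⟨p.2⟩, Input.not_isBad_iff.2 ⟨h1, h2, h3, h4, h5⟩, h6⟩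

/-- The moduli of the zero-divisors are primes. -/
def State.HasPrime : State n → Prop
  | .zeroDivisor p .. => p.Prime
  | _ => True

theorem hasPrime_nextCall (todo : List (Input n)) (out : List (TriSet ℚ × (IterPoly ℚ n)[X]))
    (B : Option ℕ) : (nextCall todo out B).HasPrime := by
  cases todo <;> trivial

theorem hasPrime_finishTurn (c : Call n) (todo : List (Input n))
    (out : List (TriSet ℚ × (IterPoly ℚ n)[X])) (B : Option ℕ) :
    (finishTurn c todo out B).HasPrime := by
  rcases finishTurn_cases c todo out B with h | ⟨out', h⟩ <;> rw [h]
  exacts [trivial, hasPrime_nextCall _ _ _]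

/-- A zero-divisor state stores a bare number `p`, but handling it requires a prime; every state
entered by a step has one. -/
theorem Step.hasPrime {s s' : State n} (h : Step s s') : s'.HasPrime := by
  cases h with
  | pickPrime p c todo out B =>
    rw [mainTurn]
    split
    · exact Fact.out (p := p.Prime)
    · trivial
    · split
      · exact Fact.out (p := p.Prime)
      · split_ifs
        exacts [hasPrime_finishTurn _ _ _ _, trivial, hasPrime_finishTurn _ _ _ _]
  | handle p w c todo out B =>
    rw [handleZeroDivisor]
    split
    · exact Fact.out (p := p.Prime)
    · trivial
    · trivial

theorem exists_step {s : State n} (hs : s.HasPrime) : s.IsDone ∨ ∃ s', Step s s' := by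
  cases s with
  | mainLoop c todo out B =>
    obtain ⟨p, hp, h1, h2⟩ := exists_not_isBad c.inp c.used
    exact Or.inr ⟨_, .pickPrime p c todo out B h1 h2⟩
  | zeroDivisor p w c todo out B =>
    have : Fact p.Prime := ⟨hs⟩
    exact Or.inr ⟨_, .handle p w c todo out B⟩
  | done out => exact Or.inl trivial

end progress

/-! ### Runs reach their end -/

section run

variable {n : ℕ} {T : Fin n → MvPolynomial (Fin n) ℚ}

theorem isReducedPoly_mapCoeffs {R A : Type} [Semiring R] [CommRing A] {d : ℕ → ℕ} {k : ℕ}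
    {f : R → IterPoly A k} (hf : ∀ x, IsReduced d k (f x)) (a : R[X]) :
    IsReducedPoly d k (mapCoeffs f a) := by
  intro i
  rw [mapCoeffs, Polynomial.sum_def, Polynomial.finsetSum_coeff]
  simp only [coeff_monomial]
  rw [Finset.sum_ite_eq' a.support i (fun n => f (a.coeff n))]
  split_ifs
  exacts [hf _, isReduced_zero]

theorem isGood_initial (hT : IsTriangularSet T) (hrad : (Ideal.span (Set.range T)).IsRadical)
    (a b : (MvPolynomial (Fin n) ℚ ⧸ Ideal.span (Set.range T))[X]) :
    (⟨triOf T, mapCoeffs (repr T) a, mapCoeffs (repr T) b⟩ : Input n).IsGood := by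
  have h := isSepTri_triOf hT hrad
  exact ⟨h, isReducedPoly_mapCoeffs (f := repr T) (fun x => (isReduced_nf h.tri le_rfl _).1) a,
    isReducedPoly_mapCoeffs (f := repr T) (fun x => (isReduced_nf h.tri le_rfl _).1) b⟩

theorem exists_isDone_of_acc {r : ℕ → State n}
    (hr : ∀ i, Step (r i) (r (i + 1)) ∨ ((r i).IsDone ∧ r (i + 1) = r i)) {s : State n}
    (hs : Acc (flip Step) s) (i : ℕ) (hi : r i = s) : ∃ j, (r j).IsDone := by
  induction hs generalizing i with
  | intro s _ ih =>
    rcases hr i with h | ⟨h, -⟩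
    · exact ih _ (hi ▸ h) (i + 1) rfl
    · exact ⟨i, h⟩

theorem isDone_of_le {r : ℕ → State n}
    (hr : ∀ i, Step (r i) (r (i + 1)) ∨ ((r i).IsDone ∧ r (i + 1) = r i)) {i j : ℕ}
    (hij : i ≤ j) (hi : (r i).IsDone) : (r j).IsDone := by
  induction j, hij using Nat.le_induction with
  | base => exact hi
  | succ j _ ih =>
    rcases hr j with h | ⟨h, h'⟩
    · cases hs : r j with
      | mainLoop => rw [hs] at ih; exact ih.elim
      | zeroDivisor => rw [hs] at ih; exact ih.elim
      | done => rw [hs] at h; cases h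
    · rwa [h']

theorem exists_isDone (hT : IsTriangularSet T) (hrad : (Ideal.span (Set.range T)).IsRadical)
    {a b : (MvPolynomial (Fin n) ℚ ⧸ Ideal.span (Set.range T))[X]} {r : ℕ → State n}
    (hr : IsRun T a b r) : ∃ i, (r i).IsDone :=
  exists_isDone_of_acc hr.step (acc_start (isGood_initial hT hrad a b) (by simp) [] none
    fun b hb => by cases hb) 0 hr.init

end run

end

end ModularCGcd

theorem proposition2 (n : ℕ) (T : Fin n → MvPolynomial (Fin n) ℚ)
    (hT : ModularCGcd.IsTriangularSet T) (hrad : (Ideal.span (Set.range T)).IsRadical)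
    (a b : Polynomial (MvPolynomial (Fin n) ℚ ⧸ Ideal.span (Set.range T))) :
    (∀ r : ℕ → ModularCGcd.State n, ModularCGcd.IsRun T a b r →
      {i : ℕ | (r i).IsZeroDivisor}.Finite) ∧
    (∀ r : ℕ → ModularCGcd.State n, ModularCGcd.IsRun T a b r →
      ∃ i : ℕ, (r i).IsDone) ∧
    (∀ s : ModularCGcd.State n,
      Relation.ReflTransGen ModularCGcd.Step (ModularCGcd.initialState T a b) s →
        s.IsDone ∨ ∃ s' : ModularCGcd.State n, ModularCGcd.Step s s') := by
  refine ⟨fun r hr => ?_, fun r hr => ModularCGcd.exists_isDone hT hrad hr, fun s hs => ?_⟩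
  · obtain ⟨i, hi⟩ := ModularCGcd.exists_isDone hT hrad hr
    -- No step leaves `done`, so all zero-divisor states of the run precede its first known end `i`.
    refine (Set.finite_Iio i).subset fun j hj => ?_
    by_contra hij
    have h := ModularCGcd.isDone_of_le hr.step (not_lt.1 hij) hi
    change (r j).IsZeroDivisor at hj
    cases hs : r j with
    | mainLoop => rw [hs] at h; exact h
    | zeroDivisor => rw [hs] at h; exact h
    | done => rw [hs] at hj; exact hj
  · refine ModularCGcd.exists_step ?_
    cases hs with
    | refl => trivial
    | tail _ h => exact h.hasPrime
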